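/- Let $F$ be the bosonic Fock space over $\mathbb C$: free bosons $\phi_i$ ($i\in\frac12+\mathbb Z$) act on it with $\phi_i\phi_j-\phi_j\phi_i=(-1)^{j-\frac12}\delta_{i,-j}$, the vacuum $|0\rangle$ satisfies $\phi_j|0\rangle=0$ for $j<0$, and the monomials in the $\phi_j$, $j>0$, applied to $|0\rangle$ form a basis of $F$. Put $\phi(z)=\sum_{j\in\frac12+\mathbb Z}\phi_jz^{j-\frac12}$. Let $:\!\phi_i\phi_j\!:$ be $\phi_i\phi_j$ if $i\ge j$ and $\phi_j\phi_i$ if $j>i$, and let $J_n$ ($n\in\mathbb Z$) be the coefficient of $z^{-n-1}$ in $H(z)=-\frac12:\!\phi(-z)\phi(z)\!:$. Put $$V_\pm(z)=\exp\sum_{\pm k>0,\ k\ \mathrm{odd}}\frac2k J_kz^{-k},\qquad \theta(z)=V_-(z)^{-1}\phi(z)V_+(z)^{-1}.$$ All the infinite sums of operators involved are locally finite on $F$ (only finitely many terms act nontrivially on a given vector), so that these objects are well defined and $\phi(z)=V_-(z)\theta(z)V_+(z)$. Moreover: 1. $[J_n,\theta(z)]=0$ for all odd $n$. 2. With $\delta(z-y)=z^{-1}\sum_{k\in\mathbb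 Z}(z/y)^k$ and $D_y=y\partial_y+\partial_y y$, $$\theta(-z)\theta(y)+\theta(y)\theta(-z)=-2y\,\partial_y\delta(z-y)-\delta(z-y)=-D_y\delta(z-y).$$ 3. Write $\theta(z)=2\sum_{i\in\frac12+\mathbb Z}J_iz^{-i-\frac12}$. Let $[\ ,\ ]_s$ be the supercommutator in which $J_n$ ($n$ an odd integer) is even and $J_i$ ($i\in\frac12+\mathbb Z$) is odd, and let $[x]$ be the integer part of $x$. For all $i,j\in(1+2\mathbb Z)\cup(\frac12+\mathbb Z)$, $$[J_i,J_j]_s=\frac j2(-1)^{[j-\frac12]}\delta_{i,-j}.$$ 4. Let $\mathbb C[\mathbf t]=\mathbb C[t_{2j-1},t_{\frac{2j-1}2};\,j=1,2,\dots]$ be the polynomial superalgebra with commuting even variables $t_1,t_3,\dots$ and anticommuting (Grassmann) odd variables $t_{\frac12},t_{\frac32},\dots$, the even variables commuting with the odd ones; $\partial/\partial t_j$ denotes the left derivative. There is exactly one linear isomorphism $\sigma:F\to\mathbb C[\mathbf t]$ such that $\sigma|0\rangle=1$ and, for all $j>0$ that are odd integers or elements of $\frac12+\mathbb Z$, $$\sigma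 J_{-j}\sigma^{-1}=(-1)^{[\frac12-j]}\frac j2\,t_j,\qquad \sigma J_j\sigma^{-1}=\frac{\partial}{\partial t_j}.$$ 5. Under this $\sigma$, $$\sigma\phi(z)\sigma^{-1}=\exp\Big(\sum_{k>0\ \mathrm{odd}}t_kz^k\Big)\exp\Big(\sum_{k>0\ \mathrm{odd}}\frac2k\frac{\partial}{\partial t_k}z^{-k}\Big)\sum_{j=1}^\infty\Big(\frac{2j-1}2\,t_{\frac{2j-1}2}(-z)^{j-1}+2\frac{\partial}{\partial t_{\frac{2j-1}2}}z^{-j}\Big),$$ where the sums in the products on the right are locally finite on $\mathbb C[\mathbf t]$. -/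

import Mathlib

open scoped TensorProduct

noncomputable section

namespace CKP

/-! ### Formal fields acting on a complex vector space -/

/-- A family of operators is locally finite if only finitely many members act nontrivially
on any given vector. -/
def LocFin {I M : Type} [AddCommGroup M] [Module ℂ M] (f : I → Module.End ℂ M) : Prop :=
  ∀ v : M, (Function.support fun i => f i v).Finite

open Classical in
/-- The pointwise sum of a locally finite family of operators
(and `0` if the family is not locally finite). -/
def locSum {I M : Type} [AddCommGroup M] [Module ℂ M] (f : I → Module.End ℂ M) :
    Module.End ℂ M :=
  if h : LocFin f then
    { toFun := fun v => ∑ᶠ i, f i v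
      map_add' := fun v w => by
        simp only [map_add]
        exact finsum_add_distrib (h v) (h w)
      map_smul' := fun c v => by
        simp only [map_smul, RingHom.id_apply]
        exact (smul_finsum' c (h v)).symm }
  else 0

theorem locSum_apply {I M : Type} [AddCommGroup M] [Module ℂ M] {f : I → Module.End ℂ M}
    (h : LocFin f) (v : M) : locSum f v = ∑ᶠ i, f i v := by
  simp [locSum, h]

/-- A formal distribution `A(z) = ∑ₘ A m z ^ m` with operator coefficients. -/
abbrev Field (M : Type) [AddCommGroup M] [Module ℂ M] : Type := ℤ → Module.End ℂ M

/-- The product `A(z) B(z)` makes sense: each of its coefficients is a locally finite sum. -/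
def Composable {M : Type} [AddCommGroup M] [Module ℂ M] (A B : Field M) : Prop :=
  ∀ m : ℤ, LocFin fun k : ℤ => A (m - k) * B k

/-- The product `A(z) B(z)`. -/
def fieldMul {M : Type} [AddCommGroup M] [Module ℂ M] (A B : Field M) : Field M :=
  fun m => locSum fun k : ℤ => A (m - k) * B k

/-- The field `A(-z)`. -/
def reflect {M : Type} [AddCommGroup M] [Module ℂ M] (A : Field M) : Field M :=
  fun m => (-1 : ℂ) ^ m • A m

/-- A power series in `z`, regarded as a field. -/
def ofPow {M : Type} [AddCommGroup M] [Module ℂ M] (P : PowerSeries (Module.End ℂ M)) :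
    Field M :=
  fun m => if 0 ≤ m then PowerSeries.coeff m.toNat P else 0

/-- A power series in `z⁻¹`, regarded as a field. -/
def ofPowInv {M : Type} [AddCommGroup M] [Module ℂ M] (P : PowerSeries (Module.End ℂ M)) :
    Field M :=
  fun m => if m ≤ 0 then PowerSeries.coeff (-m).toNat P else 0

/-- The exponential `∑ₙ Xⁿ / n!` of a power series `X` with zero constant term
(the coefficient of degree `m` of `Xⁿ` vanishes for `n > m`). -/
def expSeries {R : Type} [Ring R] [Algebra ℂ R] (X : PowerSeries R) : PowerSeries R :=
  PowerSeries.mk fun m =>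
    ∑ n ∈ Finset.range (m + 1), ((n.factorial : ℂ)⁻¹) • PowerSeries.coeff m (X ^ n)

/-! ### Two-variable formal distributions `∑ f p q z ^ p y ^ q` -/

abbrev Dist2 (M : Type) : Type := ℤ → ℤ → M

/-- `∂/∂y`. -/
def dy {M : Type} [AddCommGroup M] (f : Dist2 M) : Dist2 M :=
  fun p q => (q + 1) • f p (q + 1)

/-- Multiplication by `y`. -/
def ymul {M : Type} (f : Dist2 M) : Dist2 M := fun p q => f p (q - 1)

/-- The Euler operator `D_y = y ∂_y + ∂_y y`. -/
def eulerY {M : Type} [AddCommGroup M] (f : Dist2 M) : Dist2 M := ymul (dy f) + dy (ymul f)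

/-- `δ(z - y) = z⁻¹ ∑ₖ (z / y) ^ k`, times the unit of `R`. -/
def delta (R : Type) [Ring R] : Dist2 R := fun p q => if p + q = -1 then 1 else 0

/-- The anticommutator `A(z) B(y) + B(y) A(z)`. -/
def anticomm {M : Type} [AddCommGroup M] [Module ℂ M] (A B : Field M) :
    Dist2 (Module.End ℂ M) :=
  fun p q => A p * B q + B q * A p

/-! ### The bosonic Fock space -/

/-- The Fock space. The variable `X k` stands for the creation operator `φ_{k+1/2}`, so the
monomials are the basis vectors `φ_{j₁}^{m₁} ⋯ φ_{jₙ}^{mₙ} |0⟩`. -/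
abbrev F : Type := MvPolynomial ℕ ℂ

/-- The vacuum vector `|0⟩`. -/
def vac : F := 1

/-- `phi m` is `φ_{m+1/2}`, the coefficient of `z ^ m` in `φ(z) = ∑ φ_j z^{j-1/2}`. -/
def phi : Field F
  | Int.ofNat k => LinearMap.mulLeft ℂ (MvPolynomial.X k)
  | Int.negSucc k => (-1 : ℂ) ^ k • (MvPolynomial.pderiv k).toLinearMap

/-- Normal ordering `:φ_{a+1/2} φ_{b+1/2}:`. -/
def nord (a b : ℤ) : Module.End ℂ F := if b ≤ a then phi a * phi b else phi b * phi a

/-- The terms whose sum over `a` is the coefficient of `z^{-n-1}` in `-½ :φ(-z)φ(z):`. -/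
def currentTerm (n a : ℤ) : Module.End ℂ F := (-(1 / 2) * (-1 : ℂ) ^ a) • nord a (-n - 1 - a)

/-- The current `J_n`, `n ∈ ℤ`: the coefficient of `z^{-n-1}` in `H(z) = -½ :φ(-z)φ(z):`. -/
def current (n : ℤ) : Module.End ℂ F := locSum (currentTerm n)

/-- `V_+(z) = exp (∑_{k>0 odd} (2/k) J_k z^{-k})`, as a power series in `z⁻¹`. -/
def Vplus : PowerSeries (Module.End ℂ F) :=
  expSeries (PowerSeries.mk fun k => if Odd k then (2 / (k : ℂ)) • current k else 0)

/-- `V_-(z) = exp (∑_{k<0 odd} (2/k) J_k z^{-k})`, as a power series in `z`. -/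
def Vminus : PowerSeries (Module.End ℂ F) :=
  expSeries (PowerSeries.mk fun k => if Odd k then (2 / (-(k : ℂ))) • current (-k) else 0)

/-- `V_+(z)⁻¹`. -/
def VplusInv : Field F := ofPowInv (Ring.inverse Vplus)

/-- `V_-(z)⁻¹`. -/
def VminusInv : Field F := ofPow (Ring.inverse Vminus)

/-- `θ(z) = V_-(z)⁻¹ φ(z) V_+(z)⁻¹`. -/
def theta : Field F := fieldMul VminusInv (fieldMul phi VplusInv)

/-! ### The indices of the supercurrents -/

/-- Indices: odd integers and elements of `½ + ℤ`. -/
inductive Idx : Type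
  /-- the odd integer `2k+1` -/
  | int (k : ℤ) : Idx
  /-- the half-integer `k+½` -/
  | half (k : ℤ) : Idx

/-- The value of an index as a rational number. -/
def Idx.val : Idx → ℚ
  | .int k => 2 * k + 1
  | .half k => k + 1 / 2

/-- Currents with odd integer index are even, those with half-integer index are odd. -/
def Idx.parity : Idx → ℕ
  | .int _ => 0
  | .half _ => 1

/-- The operators `J_i`; those with `i ∈ ½ + ℤ` are defined by
`θ(z) = 2 ∑ J_i z^{-i-1/2}`. -/
def J : Idx → Module.End ℂ F
  | .int k => current (2 * k + 1)
  | .half k => (1 / 2 : ℂ) • theta (-k - 1)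

/-- The supercommutator `[J_i, J_j]_s`. -/
def superComm (i j : Idx) : Module.End ℂ F :=
  J i * J j - (-1 : ℂ) ^ (i.parity * j.parity) • (J j * J i)

/-! ### The polynomial superalgebra -/

/-- `ℂ[t₁, t₃, t₅, …; t_{1/2}, t_{3/2}, …]`: polynomials in the even variables
`t_{2k+1}` tensored with the Grassmann algebra of the odd variables `t_{k+1/2}`. -/
abbrev T : Type := MvPolynomial ℕ ℂ ⊗[ℂ] ExteriorAlgebra ℂ (ℕ →₀ ℂ)

/-- Indices of the times: `int k` is `2k+1` and `half k` is `k+½`, with `k ≥ 0`. -/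
inductive TIdx : Type
  | int (k : ℕ) : TIdx
  | half (k : ℕ) : TIdx

/-- The positive index `j`. -/
def TIdx.pos : TIdx → Idx
  | .int k => .int k
  | .half k => .half k

/-- The negative index `-j`. -/
def TIdx.neg : TIdx → Idx
  | .int k => .int (-k - 1)
  | .half k => .half (-k - 1)

/-- The variable `t_j`. -/
def t : TIdx → T
  | .int k => MvPolynomial.X k ⊗ₜ 1
  | .half k => 1 ⊗ₜ ExteriorAlgebra.ι ℂ (Finsupp.single k 1)

/-- Multiplication by `t_j` from the left. -/
def tMul (j : TIdx) : Module.End ℂ T := LinearMap.mulLeft ℂ (t j)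

/-- The derivative `∂/∂t_j`; for odd variables it is the left derivative (the contraction). -/
def tDer : TIdx → Module.End ℂ T
  | .int k => LinearMap.rTensor _ (MvPolynomial.pderiv k).toLinearMap
  | .half k => LinearMap.lTensor _
      (CliffordAlgebra.contractLeft (Q := (0 : QuadraticForm ℂ (ℕ →₀ ℂ))) (Finsupp.lapply k))

/-- `σ : F → ℂ[t]` sends the vacuum to `1`, and for all `j > 0`
`σ J_{-j} σ⁻¹ = (-1)^{[1/2-j]} (j/2) t_j` and `σ J_j σ⁻¹ = ∂/∂t_j`. -/
def IsBosonization (σ : F ≃ₗ[ℂ] T) : Prop :=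
  σ vac = 1 ∧
  ∀ j : TIdx,
    σ.conj (J j.neg) = ((-1 : ℂ) ^ ⌊1 / 2 - j.pos.val⌋ * ((j.pos.val : ℂ) / 2)) • tMul j ∧
    σ.conj (J j.pos) = tDer j

/-- `exp (∑_{k>0 odd} t_k z^k)`. -/
def expT : Field T :=
  ofPow (expSeries (PowerSeries.mk fun k => if Odd k then tMul (.int (k / 2)) else 0))

/-- `exp (∑_{k>0 odd} (2/k) ∂/∂t_k z^{-k})`. -/
def expD : Field T :=
  ofPowInv (expSeries (PowerSeries.mk fun k =>
    if Odd k then (2 / (k : ℂ)) • tDer (.int (k / 2)) else 0))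

/-- `∑_{j≥1} ( ((2j-1)/2) t_{(2j-1)/2} (-z)^{j-1} + 2 ∂/∂t_{(2j-1)/2} z^{-j} )`. -/
def oddField : Field T
  | Int.ofNat k => ((2 * (k : ℂ) + 1) / 2 * (-1) ^ k) • tMul (.half k)
  | Int.negSucc k => (2 : ℂ) • tDer (.half k)

/-! ### Basic facts showing that the objects above are the intended ones -/

/-- `φ_i φ_j - φ_j φ_i = (-1)^{j-1/2} δ_{i,-j}` with `i = m+½`, `j = n+½`. -/
theorem phi_comm (m n : ℤ) :
    phi m * phi n - phi n * phi m = if m + n = -1 then (-1 : ℂ) ^ n • 1 else 0 := by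
  rcases m with a | a <;> rcases n with b | b
  · have h : ¬ (Int.ofNat a + Int.ofNat b = -1) := by simp only [Int.ofNat_eq_natCast]; omega
    rw [if_neg h]
    refine LinearMap.ext fun v => ?_
    simp only [phi, LinearMap.sub_apply, Module.End.mul_apply, LinearMap.mulLeft_apply,
      LinearMap.zero_apply]
    ring
  · refine LinearMap.ext fun v => ?_
    simp only [phi, LinearMap.sub_apply, Module.End.mul_apply, LinearMap.mulLeft_apply,
      LinearMap.smul_apply, Derivation.coeFn_coe, Derivation.leibniz, MvPolynomial.pderiv_X,
      smul_eq_mul]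
    by_cases hab : a = b
    · subst hab
      have h : Int.ofNat a + Int.negSucc a = -1 := by
        simp only [Int.ofNat_eq_natCast, Int.negSucc_eq]; omega
      rw [if_pos h]
      have hz : (-1 : ℂ) ^ Int.negSucc a = -(-1) ^ a := by
        rw [zpow_negSucc, ← inv_pow, pow_succ]; norm_num
      rw [hz]
      simp only [Pi.single_eq_same, mul_one, smul_add, mul_smul_comm, LinearMap.smul_apply,
        Module.End.one_apply, neg_smul]
      abel
    · have h : ¬ (Int.ofNat a + Int.negSucc b = -1) := by
        simp only [Int.ofNat_eq_natCast, Int.negSucc_eq]; omega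
      rw [if_neg h]
      simp [hab]
  · refine LinearMap.ext fun v => ?_
    simp only [phi, LinearMap.sub_apply, Module.End.mul_apply, LinearMap.mulLeft_apply,
      LinearMap.smul_apply, Derivation.coeFn_coe, Derivation.leibniz, MvPolynomial.pderiv_X,
      smul_eq_mul]
    by_cases hab : b = a
    · subst hab
      have h : Int.negSucc b + Int.ofNat b = -1 := by
        simp only [Int.ofNat_eq_natCast, Int.negSucc_eq]; omega
      rw [if_pos h]
      simp
    · have h : ¬ (Int.negSucc a + Int.ofNat b = -1) := by
        simp only [Int.ofNat_eq_natCast, Int.negSucc_eq]; omega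
      rw [if_neg h]
      simp [hab]
  · have h : ¬ (Int.negSucc a + Int.negSucc b = -1) := by
      simp only [Int.negSucc_eq]; omega
    rw [if_neg h]
    refine LinearMap.ext fun v => ?_
    have hc : MvPolynomial.pderiv a (MvPolynomial.pderiv b v) =
        MvPolynomial.pderiv b (MvPolynomial.pderiv a v) := by
      have h0 : ⁅MvPolynomial.pderiv (R := ℂ) a, MvPolynomial.pderiv (R := ℂ) b⁆ = 0 := by
        refine MvPolynomial.derivation_ext fun i => ?_
        simp [Derivation.commutator_apply, MvPolynomial.pderiv_X, Pi.single_apply, apply_ite]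
      have h1 := congrArg (fun D => D v) h0
      simpa [Derivation.commutator_apply, sub_eq_zero] using h1
    simp only [phi, LinearMap.sub_apply, Module.End.mul_apply, LinearMap.smul_apply,
      Derivation.coeFn_coe, LinearMap.zero_apply, map_smul, hc]
    rw [smul_comm, sub_self]

/-- `φ_j |0⟩ = 0` for `j < 0`. -/
theorem phi_vac (m : ℤ) (hm : m < 0) : phi m vac = 0 := by
  rcases m with a | a
  · simp only [Int.ofNat_eq_natCast] at hm; omega
  · simp [phi, vac]

/-- The ordered monomials in the creation operators, applied to the vacuum, give the
monomial basis of `F`. -/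
theorem phi_monomial (s : ℕ →₀ ℕ) :
    ((s.support.sort (· ≥ ·)).map fun k : ℕ => phi (k : ℤ) ^ s k).prod vac =
      MvPolynomial.basisMonomials ℕ ℂ s := by
  have h : ∀ (l : List ℕ), (l.map fun k : ℕ => phi (k : ℤ) ^ s k).prod =
      LinearMap.mulLeft ℂ ((l.map fun k : ℕ => (MvPolynomial.X k : F) ^ s k).prod) := by
    intro l
    induction l with
    | nil => simp [Module.End.one_eq_id]
    | cons k l ih =>
      simp only [List.map_cons, List.prod_cons]
      rw [ih, LinearMap.mulLeft_mul, ← LinearMap.pow_mulLeft]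
      rfl
  rw [h, LinearMap.mulLeft_apply, vac, mul_one, MvPolynomial.coe_basisMonomials]
  change _ = MvPolynomial.monomial s 1
  rw [MvPolynomial.monomial_eq, Finsupp.prod, map_one, one_mul, ← Multiset.prod_coe,
    ← Multiset.map_coe, Finset.sort_eq]
  rfl

theorem constantCoeff_expSeries {R : Type} [Ring R] [Algebra ℂ R] (X : PowerSeries R) :
    PowerSeries.constantCoeff (expSeries X) = 1 := by
  rw [← PowerSeries.coeff_zero_eq_constantCoeff_apply]
  simp [expSeries]

theorem isUnit_expSeries {R : Type} [Ring R] [Algebra ℂ R] (X : PowerSeries R) :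
    IsUnit (expSeries X) := by
  rw [PowerSeries.isUnit_iff_constantCoeff, constantCoeff_expSeries]
  exact isUnit_one

theorem isUnit_Vplus : IsUnit Vplus := isUnit_expSeries _

theorem isUnit_Vminus : IsUnit Vminus := isUnit_expSeries _

/-- `t_i t_j = (-1)^{4ij} t_j t_i`; in particular the square of an odd variable is zero. -/
theorem t_comm (i j : TIdx) :
    t i * t j = (-1 : ℂ) ^ (i.pos.parity * j.pos.parity) • (t j * t i) := by
  rcases i with a | a <;> rcases j with b | b
  · simp [t, TIdx.pos, Idx.parity, mul_comm]
  · simp [t, TIdx.pos, Idx.parity]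
  · simp [t, TIdx.pos, Idx.parity]
  · have h := ExteriorAlgebra.ι_add_mul_swap (R := ℂ) (Finsupp.single a (1 : ℂ))
      (Finsupp.single b (1 : ℂ))
    simp only [t, TIdx.pos, Idx.parity, Algebra.TensorProduct.tmul_mul_tmul, mul_one, pow_one]
    rw [eq_neg_of_add_eq_zero_left h, ← TensorProduct.tmul_smul, neg_one_smul]

/-- `∂/∂t_i` kills `1`. -/
theorem tDer_one (i : TIdx) : tDer i 1 = 0 := by
  rcases i with a | a
  · simp [tDer, Algebra.TensorProduct.one_def]
  · rw [tDer, Algebra.TensorProduct.one_def, LinearMap.lTensor_tmul]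
    erw [CliffordAlgebra.contractLeft_one]
    simp

/-- `[∂/∂t_i, t_j]_s = δ_{ij}`. -/
theorem tDer_tMul (i j : TIdx) [Decidable (i = j)] :
    tDer i * tMul j - (-1 : ℂ) ^ (i.pos.parity * j.pos.parity) • (tMul j * tDer i) =
      if i = j then 1 else 0 := by
  rcases i with a | a <;> rcases j with b | b
  · refine TensorProduct.ext' fun p w => ?_
    by_cases hab : a = b
    · subst hab
      simp [tDer, tMul, t, TIdx.pos, Idx.parity, TensorProduct.add_tmul]
    · simp [tDer, tMul, t, TIdx.pos, Idx.parity, MvPolynomial.pderiv_X, hab, Ne.symm hab]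
  · refine TensorProduct.ext' fun p w => ?_
    simp [tDer, tMul, t, TIdx.pos, Idx.parity]
  · refine TensorProduct.ext' fun p w => ?_
    simp [tDer, tMul, t, TIdx.pos, Idx.parity]
  · refine TensorProduct.ext' fun p w => ?_
    have h := CliffordAlgebra.contractLeft_ι_mul (Q := (0 : QuadraticForm ℂ (ℕ →₀ ℂ)))
      (d := Finsupp.lapply a) (Finsupp.single b (1 : ℂ)) w
    simp only [tDer, tMul, t, TIdx.pos, Idx.parity, LinearMap.sub_apply, Module.End.mul_apply,
      LinearMap.mulLeft_apply, LinearMap.smul_apply, Algebra.TensorProduct.tmul_mul_tmul,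
      one_mul, LinearMap.lTensor_tmul, mul_one, pow_one, neg_smul, one_smul, sub_neg_eq_add,
      ← TensorProduct.tmul_add]
    erw [h]
    by_cases hab : a = b
    · subst hab
      simp
    · simp [hab]

end CKP

end

/-!
The idea is to split `φ(z)` into a part generated by the odd currents `J_n` and a part `θ(z)` that
commutes with them, and to show that the modes of `θ` form a Clifford algebra, so that all `J_i`
together act on the Fock space as the variables and derivatives of a polynomial superalgebra.

*Currents.* For odd `n` one has `[J_n, φ(z)] = z^n φ(z)` (`current_commutator_phi`). An operator on
the Fock space that commutes with all `φ_j` is a scalar (`exists_scalar_of_commute_phi`), and a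
nonzero scalar has degree `0`; this reduces the Heisenberg relations of the currents to an
evaluation on the vacuum (`current_commutator_current`).

*Vertex operators.* The exponential of a series `X` with commuting coefficients is the unique
solution of `z W' = z X' W` with constant term `1` (`eulerPS_unique`, `eulerPS_expSeries`).
Uniqueness yields the inverse `exp (-X)`, its coincidence with `(exp X)(-z)` for odd `X`, the
commutators with the currents, and the exchange relations
`(1 - z/y) V(z) A(y) = (1 + z/y) A(y) V(z)` (`expSeries_oddLog_exchange`). As `V_-` involves only
nonnegative powers of `z` and `V_+` only nonpositive ones, and since fields of fixed degree have
only finitely many negative modes on a given vector, all products converge and are associative;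
hence `A ↦ V_- A V_+` (`dress`) and `A ↦ V_-⁻¹ A V_+⁻¹` (`undress`) are inverse to each other, and
`φ = V_- θ V_+` (`phi_eq_dress_theta`). In `[J_n, θ(z)]` the term `z^n` coming from `φ` is
cancelled by the one from `V_-⁻¹` or `V_+⁻¹` (`lmul_current_theta`).

*Anticommutators of `θ`.* The exchange relations give
`(z + y) {θ(z), φ(y)} = 2 z δ(z + y) V_-(z)⁻¹ V_+(z)⁻¹` (`theta_phi_anticomm`); as the modes of `θ`
commute with the currents, undressing in `y` gives `(z + y) {θ(z), θ(y)} = 2 z δ(z + y)`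
(`thetaAnti_rec`). This determines `{θ_p, θ_q}` up to one operator for each value of `p + q`. If
`p + q` is odd, the symmetry in `p` and `q` fixes it. If `p + q` is even, it commutes with `θ` by
the super Jacobi identity and with the currents, hence with `φ`; so it is a scalar of degree
`2 (p + q) + 2 ≠ 0`, which is `0` (`theta_anticomm`).

*The isomorphism.* The rescaled operators `J_{-j}`, `j > 0`, supercommute, and applying polynomials
in them to the vacuum defines a map `ℂ[t] → F` (`exists_fockMap`) that carries `∂/∂t_j` to `J_j`. It
is surjective, since the `J_i` generate `θ` and the vertex operators and therefore `φ`. It is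
injective, since its kernel is stable under all derivatives, and a nonzero subspace with this
property contains `1` (`eq_bot_of_tDer_stable`, by means of the Euler operator `∑ t_j ∂/∂t_j`).
Its inverse is `σ`. Conjugating `φ = V_- θ V_+ = V_- V_+ θ` by `σ` gives the formula for `σ φ σ⁻¹`
(`IsBosonization.conjField_phi`). Two such isomorphisms conjugate `φ` to the same field and agree
on the vacuum, hence they are equal (`IsBosonization.unique`).
-/

noncomputable section

namespace CKP

/-! ### Products of fields -/

section FieldProducts

variable {M : Type} [AddCommGroup M] [Module ℂ M]

/-- `A(z) v` is a formal Laurent series in `z` for every vector `v`. -/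
def LowerTrunc (A : Field M) : Prop := ∀ v : M, ∃ N : ℤ, ∀ m < N, A m v = 0

/-- Only nonnegative powers of `z` occur in `A(z)`. -/
def NonnegSupp (A : Field M) : Prop := ∀ m < 0, A m = 0

/-- Only nonpositive powers of `z` occur in `A(z)`. -/
def NonposSupp (A : Field M) : Prop := ∀ m > 0, A m = 0

theorem fieldMul_apply {A B : Field M} (h : Composable A B) (m : ℤ) (v : M) :
    fieldMul A B m v = ∑ᶠ k : ℤ, A (m - k) (B k v) := by
  rw [fieldMul, locSum_apply (h m)]
  rfl

theorem Composable.finite {A B : Field M} (h : Composable A B) (m : ℤ) (v : M) :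
    (Function.support fun k : ℤ => A (m - k) (B k v)).Finite := h m v

/-- If the terms of the triple product are jointly locally finite, then both bracketings
are defined and they agree. -/
theorem fieldMul_assoc_of_finite {A B C : Field M} (hAB : Composable A B)
    (hBC : Composable B C)
    (h : ∀ m v, (Function.support fun kl : ℤ × ℤ =>
      A (m - kl.1) (B (kl.1 - kl.2) (C kl.2 v))).Finite) :
    Composable A (fieldMul B C) ∧ Composable (fieldMul A B) C ∧
      fieldMul A (fieldMul B C) = fieldMul (fieldMul A B) C := by
  have e1 : ∀ m k v, A (m - k) (fieldMul B C k v) =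
      ∑ᶠ l : ℤ, A (m - k) (B (k - l) (C l v)) := by
    intro m k v
    rw [fieldMul_apply hBC]
    exact (A (m - k)).toAddMonoidHom.map_finsum (hBC.finite k v)
  have e2 : ∀ m l v, fieldMul A B (m - l) (C l v) =
      ∑ᶠ k : ℤ, A (m - k) (B (k - l) (C l v)) := by
    intro m l v
    rw [fieldMul_apply hAB, ← finsum_comp_equiv (Equiv.subRight l)]
    refine finsum_congr fun k => ?_
    simp [Equiv.subRight_apply]
  have c1 : Composable A (fieldMul B C) := by
    intro m v
    refine ((h m v).image Prod.fst).subset fun k hk => ?_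
    have hk' : ∑ᶠ l : ℤ, A (m - k) (B (k - l) (C l v)) ≠ 0 := by
      rw [← e1]; exact hk
    obtain ⟨l, hl⟩ := not_forall.mp (mt finsum_eq_zero_of_forall_eq_zero hk')
    exact ⟨(k, l), hl, rfl⟩
  have c2 : Composable (fieldMul A B) C := by
    intro m v
    refine ((h m v).image Prod.snd).subset fun l hl => ?_
    have hl' : ∑ᶠ k : ℤ, A (m - k) (B (k - l) (C l v)) ≠ 0 := by
      rw [← e2]; exact hl
    obtain ⟨k, hk⟩ := not_forall.mp (mt finsum_eq_zero_of_forall_eq_zero hl')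
    exact ⟨(k, l), hk, rfl⟩
  refine ⟨c1, c2, funext fun m => LinearMap.ext fun v => ?_⟩
  rw [fieldMul_apply c1, fieldMul_apply c2]
  simp only [e1, e2]
  rw [← finsum_curry (fun kl : ℤ × ℤ => A (m - kl.1) (B (kl.1 - kl.2) (C kl.2 v))) (h m v),
    ← finsum_comp_equiv (Equiv.prodComm ℤ ℤ), finsum_curry]
  · rfl
  · exact (h m v).preimage (Equiv.prodComm ℤ ℤ).injective.injOn

variable {A A' B P Q U V : Field M}

theorem NonnegSupp.composable (hP : NonnegSupp P) (hA : LowerTrunc A) : Composable P A := by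
  intro m v
  obtain ⟨N, hN⟩ := hA v
  refine (Set.finite_Icc N m).subset fun k hk => ?_
  by_contra hc
  rcases not_and_or.mp (by simpa using hc : ¬ (N ≤ k ∧ k ≤ m)) with h | h
  · exact hk (by simp [hN k (by omega)])
  · exact hk (by simp [hP (m - k) (by omega)])

theorem NonposSupp.composable (hU : NonposSupp U) (hU' : LowerTrunc U) : Composable A U := by
  intro m v
  obtain ⟨N, hN⟩ := hU' v
  refine (Set.finite_Icc N 0).subset fun k hk => ?_
  by_contra hc
  rcases not_and_or.mp (by simpa using hc : ¬ (N ≤ k ∧ k ≤ 0)) with h | h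
  · exact hk (by simp [hN k (by omega)])
  · exact hk (by simp [hU k (by omega)])

/-- A single lower bound valid for the finitely many nonzero vectors among the `U l v`. -/
theorem LowerTrunc.uniform (hA : LowerTrunc A) (hU : NonposSupp U) (hU' : LowerTrunc U)
    (v : M) : ∃ N : ℤ, ∀ m < N, ∀ l, A m (U l v) = 0 := by
  obtain ⟨N, hN⟩ := hU' v
  choose f hf using fun l : ℤ => hA (U l v)
  obtain ⟨K, hK⟩ := ((Set.finite_Icc N 0).image f).bddBelow
  refine ⟨K, fun m hm l => ?_⟩
  by_cases h1 : l < N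
  · simp [hN l h1]
  by_cases h2 : 0 < l
  · simp [hU l h2]
  exact hf l m (lt_of_lt_of_le hm (hK ⟨l, ⟨by omega, by omega⟩, rfl⟩))

theorem NonposSupp.lowerTrunc_fieldMul (hU : NonposSupp U) (hU' : LowerTrunc U)
    (hA : LowerTrunc A) : LowerTrunc (fieldMul A U) := by
  intro v
  obtain ⟨N, hN⟩ := hA.uniform hU hU' v
  obtain ⟨K, hK⟩ := hU' v
  refine ⟨N + K, fun m hm => ?_⟩
  rw [fieldMul_apply (hU.composable hU'), finsum_eq_zero_of_forall_eq_zero]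
  intro k
  by_cases h : k < K
  · simp [hK k h]
  · exact hN _ (by omega) _

/-- The product `P(z) A(z) U(z)` is associative if `P` has no negative and `U` no positive powers
of `z`: on a given vector only finitely many modes of `U` act, hence the modes of `A` that act on
the results are bounded below, and those of `P` bound the degree from above. -/
theorem fieldMul_assoc_mid (hP : NonnegSupp P) (hA : LowerTrunc A) (hU : NonposSupp U)
    (hU' : LowerTrunc U) :
    fieldMul P (fieldMul A U) = fieldMul (fieldMul P A) U := by
  refine (fieldMul_assoc_of_finite (hP.composable hA) (hU.composable hU') fun m v => ?_).2.2
  obtain ⟨N, hN⟩ := hA.uniform hU hU' v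
  obtain ⟨K, hK⟩ := hU' v
  refine ((Set.finite_Icc (N + K) m).prod (Set.finite_Icc K 0)).subset ?_
  rintro ⟨k, l⟩ hkl
  have h1 : ¬ l < K := fun h => hkl (by simp [hK l h])
  have h2 : ¬ 0 < l := fun h => hkl (by simp [hU l h])
  have h3 : ¬ m < k := fun h => hkl (by simp [hP (m - k) (by omega)])
  have h4 : ¬ k - l < N := fun h => hkl (by simp [hN _ h])
  simp only [Set.mem_prod, Set.mem_Icc]
  omega

theorem fieldMul_assoc_right (hU : NonposSupp U) (hU' : LowerTrunc U) (hV : NonposSupp V)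
    (hV' : LowerTrunc V) :
    fieldMul A (fieldMul U V) = fieldMul (fieldMul A U) V := by
  refine (fieldMul_assoc_of_finite (hU.composable hU') (hV.composable hV') fun m v => ?_).2.2
  obtain ⟨N, hN⟩ := hU'.uniform hV hV' v
  obtain ⟨K, hK⟩ := hV' v
  refine ((Set.finite_Icc (N + K) 0).prod (Set.finite_Icc K 0)).subset ?_
  rintro ⟨k, l⟩ hkl
  have h1 : ¬ l < K := fun h => hkl (by simp [hK l h])
  have h2 : ¬ 0 < l := fun h => hkl (by simp [hV l h])
  have h3 : ¬ 0 < k - l := fun h => hkl (by simp [hU _ h])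
  have h4 : ¬ k - l < N := fun h => hkl (by simp [hN _ h])
  simp only [Set.mem_prod, Set.mem_Icc]
  omega

theorem fieldMul_assoc_left (hP : NonnegSupp P) (hQ : NonnegSupp Q) (hA : LowerTrunc A)
    (hQ' : LowerTrunc Q) :
    fieldMul P (fieldMul Q A) = fieldMul (fieldMul P Q) A := by
  refine (fieldMul_assoc_of_finite (hP.composable hQ') (hQ.composable hA) fun m v => ?_).2.2
  obtain ⟨K, hK⟩ := hA v
  refine ((Set.finite_Icc K m).prod (Set.finite_Icc K m)).subset ?_
  rintro ⟨k, l⟩ hkl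
  have h1 : ¬ l < K := fun h => hkl (by simp [hK l h])
  have h2 : ¬ k - l < 0 := fun h => hkl (by simp [hQ _ h])
  have h3 : ¬ m < k := fun h => hkl (by simp [hP (m - k) (by omega)])
  simp only [Set.mem_prod, Set.mem_Icc]
  omega

theorem NonnegSupp.lowerTrunc (hP : NonnegSupp P) : LowerTrunc P :=
  fun v => ⟨0, fun m hm => by simp [hP m hm]⟩

theorem fieldMul_add_left (h : Composable A B) (h' : Composable A' B) :
    fieldMul (A + A') B = fieldMul A B + fieldMul A' B := by
  have hc : Composable (A + A') B := fun m v =>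
    ((h.finite m v).union (h'.finite m v)).subset
      (Function.support_add (fun k => A (m - k) (B k v)) fun k => A' (m - k) (B k v))
  funext m; ext v
  simp only [Pi.add_apply, LinearMap.add_apply, fieldMul_apply hc, fieldMul_apply h,
    fieldMul_apply h']
  exact finsum_add_distrib (h.finite m v) (h'.finite m v)

theorem fieldMul_add_right {B' : Field M} (h : Composable A B) (h' : Composable A B') :
    fieldMul A (B + B') = fieldMul A B + fieldMul A B' := by
  have hs : ∀ m v, (fun k => A (m - k) ((B + B') k v)) =
      fun k => A (m - k) (B k v) + A (m - k) (B' k v) := by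
    intro m v; funext k; simp
  have hc : Composable A (B + B') := fun m v => by
    refine ((h.finite m v).union (h'.finite m v)).subset ?_
    change Function.support (fun k => A (m - k) ((B + B') k v)) ⊆ _
    rw [hs]
    exact Function.support_add (fun k => A (m - k) (B k v)) fun k => A (m - k) (B' k v)
  funext m; ext v
  simp only [Pi.add_apply, LinearMap.add_apply, fieldMul_apply hc, fieldMul_apply h,
    fieldMul_apply h']
  rw [← finsum_add_distrib (h.finite m v) (h'.finite m v)]
  exact finsum_congr fun k => congrFun (hs m v) k

/-- Multiplication of a field by an operator from the left. -/
def lmul (a : Module.End ℂ M) (A : Field M) : Field M := fun m => a * A m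

/-- Multiplication of a field by an operator from the right. -/
def rmul (A : Field M) (a : Module.End ℂ M) : Field M := fun m => A m * a

/-- Multiplication of a field by `z ^ n`. -/
def shift (n : ℤ) (A : Field M) : Field M := fun m => A (m - n)

theorem lmul_fieldMul (h : Composable A B) (a : Module.End ℂ M) :
    lmul a (fieldMul A B) = fieldMul (lmul a A) B := by
  have hc : Composable (lmul a A) B := fun m v =>
    (h.finite m v).subset fun k hk => fun h0 => hk (by simp_all [lmul])
  funext m; ext v
  rw [fieldMul_apply hc, lmul, Module.End.mul_apply, fieldMul_apply h]
  exact a.toAddMonoidHom.map_finsum (h.finite m v)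

theorem rmul_fieldMul (h : Composable A B) (a : Module.End ℂ M) :
    rmul (fieldMul A B) a = fieldMul A (rmul B a) := by
  have hc : Composable A (rmul B a) := fun m v => h.finite m (a v)
  funext m; ext v
  rw [fieldMul_apply hc, rmul, Module.End.mul_apply, fieldMul_apply h]
  rfl

theorem fieldMul_rmul_left (a : Module.End ℂ M) :
    fieldMul (rmul A a) B = fieldMul A (lmul a B) := rfl

theorem fieldMul_shift_left (n : ℤ) :
    fieldMul (shift n A) B = shift n (fieldMul A B) := by
  funext m
  simp only [fieldMul, shift, sub_right_comm]

theorem Composable.lmul (h : Composable A B) (a : Module.End ℂ M) :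
    Composable (CKP.lmul a A) B := fun m v =>
  (h.finite m v).subset fun k hk => fun h0 => hk (by simp_all [CKP.lmul])

theorem Composable.shift_left (h : Composable A B) (n : ℤ) : Composable (shift n A) B :=
  fun m v => by simpa only [shift, sub_right_comm] using h (m - n) v

theorem Composable.shift_right (h : Composable A B) (n : ℤ) : Composable A (shift n B) :=
  fun m v => by
    refine ((h.finite (m - n) v).image (· + n)).subset fun k hk => ⟨k - n, ?_, by simp⟩
    intro h0
    have h0' : A (m - n - (k - n)) (B (k - n) v) = 0 := h0
    rw [sub_sub_sub_cancel_right] at h0'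
    exact hk h0'

theorem fieldMul_shift_right (h : Composable A B) (n : ℤ) :
    fieldMul A (shift n B) = shift n (fieldMul A B) := by
  have hc : Composable A (shift n B) := h.shift_right n
  funext m; ext v
  rw [fieldMul_apply hc, shift, fieldMul_apply h, ← finsum_comp_equiv (Equiv.addRight n)]
  refine finsum_congr fun k => ?_
  simp [shift, sub_sub, add_comm]

theorem Composable.rmul (h : Composable A B) (a : Module.End ℂ M) :
    Composable A (CKP.rmul B a) := fun m v => h m (a v)

theorem Composable.smul_right (h : Composable A B) (c : ℂ) : Composable A (c • B) :=
  fun m v => (h.finite m v).subset fun k hk h0 => hk (by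
    have h0' : A (m - k) (B k v) = 0 := h0
    simp [h0'])

theorem Composable.smul_left (h : Composable A B) (c : ℂ) : Composable (c • A) B :=
  fun m v => (h.finite m v).subset fun k hk h0 => hk (by
    have h0' : A (m - k) (B k v) = 0 := h0
    simp [h0'])

theorem fieldMul_smul_left (h : Composable A B) (c : ℂ) :
    fieldMul (c • A) B = c • fieldMul A B := by
  funext m
  refine LinearMap.ext fun v => ?_
  rw [fieldMul_apply (h.smul_left c), Pi.smul_apply, LinearMap.smul_apply, fieldMul_apply h,
    smul_finsum' c (h.finite m v)]
  rfl

theorem fieldMul_smul_right (h : Composable A B) (c : ℂ) :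
    fieldMul A (c • B) = c • fieldMul A B := by
  funext m
  refine LinearMap.ext fun v => ?_
  rw [fieldMul_apply (h.smul_right c), Pi.smul_apply, LinearMap.smul_apply, fieldMul_apply h,
    smul_finsum' c (h.finite m v)]
  exact finsum_congr fun k => by simp

theorem fieldMul_sub_right {B' : Field M} (h : Composable A B) (h' : Composable A B') :
    fieldMul A (B - B') = fieldMul A B - fieldMul A B' := by
  rw [sub_eq_add_neg, ← neg_one_smul ℂ B', fieldMul_add_right h (h'.smul_right _),
    fieldMul_smul_right h', neg_one_smul, ← sub_eq_add_neg]

theorem fieldMul_sub_left (h : Composable A B) (h' : Composable A' B) :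
    fieldMul (A - A') B = fieldMul A B - fieldMul A' B := by
  rw [sub_eq_add_neg, ← neg_one_smul ℂ A', fieldMul_add_left h (h'.smul_left _),
    fieldMul_smul_left h', neg_one_smul, ← sub_eq_add_neg]

/-- If `[a, A(z)] = A'(z)` and `[a, B(z)] = B'(z)`, then `[a, AB] = A'B + AB'`. -/
theorem lmul_fieldMul_of_commutator {B' : Field M} {a : Module.End ℂ M} (hAB : Composable A B)
    (hA'B : Composable A' B) (hAB' : Composable A B') (hA : lmul a A = rmul A a + A')
    (hB : lmul a B = rmul B a + B') :
    lmul a (fieldMul A B) = rmul (fieldMul A B) a + (fieldMul A' B + fieldMul A B') := by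
  have hc : Composable (rmul A a) B := fun m v => by
    have hB' : ∀ k, a (B k v) = B k (a v) + B' k v := fun k =>
      LinearMap.congr_fun (congrFun hB k) v
    refine ((hAB.finite m (a v)).union (hAB'.finite m v)).subset ?_
    refine subset_trans (fun k hk => ?_)
      (Function.support_add (fun k => A (m - k) (B k (a v))) fun k => A (m - k) (B' k v))
    intro h0
    refine hk ?_
    change A (m - k) (a (B k v)) = 0
    rw [hB', map_add]
    exact h0
  rw [lmul_fieldMul hAB, hA, fieldMul_add_left hc hA'B, fieldMul_rmul_left, hB,
    fieldMul_add_right (hAB.rmul a) hAB', rmul_fieldMul hAB]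
  abel

theorem LowerTrunc.add (hA : LowerTrunc A) (hB : LowerTrunc B) : LowerTrunc (A + B) := by
  intro v
  obtain ⟨N, hN⟩ := hA v
  obtain ⟨K, hK⟩ := hB v
  exact ⟨min N K, fun m hm => by simp [hN m (by omega), hK m (by omega)]⟩

theorem LowerTrunc.sub (hA : LowerTrunc A) (hB : LowerTrunc B) : LowerTrunc (A - B) := by
  intro v
  obtain ⟨N, hN⟩ := hA v
  obtain ⟨K, hK⟩ := hB v
  exact ⟨min N K, fun m hm => by simp [hN m (by omega), hK m (by omega)]⟩

theorem LowerTrunc.smul (hA : LowerTrunc A) (c : ℂ) : LowerTrunc (c • A) := by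
  intro v
  obtain ⟨N, hN⟩ := hA v
  exact ⟨N, fun m hm => by simp [hN m hm]⟩

theorem LowerTrunc.lmul (hA : LowerTrunc A) (a : Module.End ℂ M) :
    LowerTrunc (CKP.lmul a A) := by
  intro v
  obtain ⟨N, hN⟩ := hA v
  exact ⟨N, fun m hm => by simp [CKP.lmul, hN m hm]⟩

theorem LowerTrunc.rmul (hA : LowerTrunc A) (a : Module.End ℂ M) :
    LowerTrunc (CKP.rmul A a) := fun v => hA (a v)

theorem LowerTrunc.shift (hA : LowerTrunc A) (n : ℤ) : LowerTrunc (CKP.shift n A) := by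
  intro v
  obtain ⟨N, hN⟩ := hA v
  exact ⟨N + n, fun m hm => hN _ (by omega)⟩

/-- The constant field with value the identity. -/
def oneField : Field M := fun m => if m = 0 then 1 else 0

theorem oneField_fieldMul : fieldMul oneField A = A := by
  have hs : ∀ m v, ∀ k ≠ m, (oneField (M := M)) (m - k) (A k v) = 0 := fun m v k hk => by
    simp [oneField, sub_eq_zero, hk.symm]
  have hc : Composable oneField A := fun m v =>
    (Set.finite_singleton m).subset fun k hk => by_contra fun h => hk (hs m v k h)
  funext m; ext v
  rw [fieldMul_apply hc, finsum_eq_single _ m (hs m v)]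
  simp [oneField]

theorem fieldMul_oneField : fieldMul A oneField = A := by
  have hs : ∀ m v, ∀ k ≠ 0, A (m - k) ((oneField (M := M)) k v) = 0 := fun m v k hk => by
    simp [oneField, hk]
  have hc : Composable A oneField := fun m v =>
    (Set.finite_singleton 0).subset fun k hk => by_contra fun h => hk (hs m v k h)
  funext m; ext v
  rw [fieldMul_apply hc, finsum_eq_single _ 0 (hs m v)]
  simp [oneField]

theorem lowerTrunc_oneField : LowerTrunc (oneField (M := M)) :=
  fun v => ⟨0, fun m hm => by simp [oneField, hm.ne]⟩

/-! ### Power series as fields -/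

theorem nonnegSupp_ofPow (P : PowerSeries (Module.End ℂ M)) : NonnegSupp (ofPow P) :=
  fun m hm => by simp [ofPow, hm]

theorem nonposSupp_ofPowInv (P : PowerSeries (Module.End ℂ M)) : NonposSupp (ofPowInv P) :=
  fun m hm => by simp [ofPowInv, hm]

theorem ofPow_X_mul (P : PowerSeries (Module.End ℂ M)) :
    ofPow (PowerSeries.X * P) = shift 1 (ofPow P) := by
  funext m
  rcases lt_trichotomy m 0 with h | rfl | h
  · simp [ofPow, shift, show ¬ 0 ≤ m by omega, show ¬ 1 ≤ m by omega]
  · simp [ofPow, shift]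
  · obtain ⟨n, rfl⟩ : ∃ n : ℕ, m = (n + 1 : ℕ) := ⟨(m - 1).toNat, by omega⟩
    have h1 : ((n + 1 : ℕ) : ℤ) - 1 = n := by push_cast; ring
    simp only [ofPow, shift, h1, Int.toNat_natCast, PowerSeries.coeff_succ_X_mul]
    simp
    omega

theorem ofPowInv_X_mul (P : PowerSeries (Module.End ℂ M)) :
    ofPowInv (PowerSeries.X * P) = shift (-1) (ofPowInv P) := by
  funext m
  rcases lt_trichotomy m 0 with h | rfl | h
  · obtain ⟨n, rfl⟩ : ∃ n : ℕ, m = -(n + 1 : ℕ) := ⟨(-m - 1).toNat, by omega⟩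
    have h1 : -((n + 1 : ℕ) : ℤ) - -1 = -n := by push_cast; ring
    simp only [ofPowInv, shift, h1, neg_neg, Int.toNat_natCast, PowerSeries.coeff_succ_X_mul]
    simp
  · simp [ofPowInv, shift]
  · simp [ofPowInv, shift, show ¬ m ≤ 0 by omega, show ¬ m + 1 ≤ 0 by omega]

theorem shift_shift (m n : ℤ) (A : Field M) : shift m (shift n A) = shift (n + m) A := by
  funext k
  simp only [shift, sub_sub, add_comm]

theorem shift_zero (A : Field M) : shift 0 A = A := by
  funext k
  simp only [shift, sub_zero]

theorem ofPow_X_pow_mul (n : ℕ) (P : PowerSeries (Module.End ℂ M)) :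
    ofPow (PowerSeries.X ^ n * P) = shift n (ofPow P) := by
  induction n with
  | zero => rw [pow_zero, one_mul, Nat.cast_zero, shift_zero]
  | succ n ih => rw [pow_succ', mul_assoc, ofPow_X_mul, ih, shift_shift, Nat.cast_succ]

theorem ofPowInv_X_pow_mul (n : ℕ) (P : PowerSeries (Module.End ℂ M)) :
    ofPowInv (PowerSeries.X ^ n * P) = shift (-n) (ofPowInv P) := by
  induction n with
  | zero => rw [pow_zero, one_mul, Nat.cast_zero, neg_zero, shift_zero]
  | succ n ih =>
    rw [pow_succ', mul_assoc, ofPowInv_X_mul, ih, shift_shift, Nat.cast_succ, neg_add]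

theorem ofPow_smul (c : ℂ) (P : PowerSeries (Module.End ℂ M)) :
    ofPow (c • P) = c • ofPow P := by
  funext m
  simp only [ofPow, Pi.smul_apply, PowerSeries.coeff_smul]
  split_ifs <;> simp

theorem ofPowInv_smul (c : ℂ) (P : PowerSeries (Module.End ℂ M)) :
    ofPowInv (c • P) = c • ofPowInv P := by
  funext m
  simp only [ofPowInv, Pi.smul_apply, PowerSeries.coeff_smul]
  split_ifs <;> simp

theorem ofPow_C_mul (a : Module.End ℂ M) (P : PowerSeries (Module.End ℂ M)) :
    ofPow (PowerSeries.C a * P) = lmul a (ofPow P) := by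
  funext m
  simp only [ofPow, lmul, PowerSeries.coeff_C_mul]
  split_ifs <;> simp

theorem ofPow_mul_C (a : Module.End ℂ M) (P : PowerSeries (Module.End ℂ M)) :
    ofPow (P * PowerSeries.C a) = rmul (ofPow P) a := by
  funext m
  simp only [ofPow, rmul, PowerSeries.coeff_mul_C]
  split_ifs <;> simp

theorem ofPowInv_C_mul (a : Module.End ℂ M) (P : PowerSeries (Module.End ℂ M)) :
    ofPowInv (PowerSeries.C a * P) = lmul a (ofPowInv P) := by
  funext m
  simp only [ofPowInv, lmul, PowerSeries.coeff_C_mul]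
  split_ifs <;> simp

theorem ofPowInv_mul_C (a : Module.End ℂ M) (P : PowerSeries (Module.End ℂ M)) :
    ofPowInv (P * PowerSeries.C a) = rmul (ofPowInv P) a := by
  funext m
  simp only [ofPowInv, rmul, PowerSeries.coeff_mul_C]
  split_ifs <;> simp

theorem ofPow_add (P Q : PowerSeries (Module.End ℂ M)) : ofPow (P + Q) = ofPow P + ofPow Q := by
  funext m
  simp only [ofPow, Pi.add_apply, map_add]
  split_ifs <;> simp

theorem ofPow_sub (P Q : PowerSeries (Module.End ℂ M)) : ofPow (P - Q) = ofPow P - ofPow Q := by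
  funext m
  simp only [ofPow, Pi.sub_apply, map_sub]
  split_ifs <;> simp

theorem ofPowInv_add (P Q : PowerSeries (Module.End ℂ M)) :
    ofPowInv (P + Q) = ofPowInv P + ofPowInv Q := by
  funext m
  simp only [ofPowInv, Pi.add_apply, map_add]
  split_ifs <;> simp

theorem ofPowInv_sub (P Q : PowerSeries (Module.End ℂ M)) :
    ofPowInv (P - Q) = ofPowInv P - ofPowInv Q := by
  funext m
  simp only [ofPowInv, Pi.sub_apply, map_sub]
  split_ifs <;> simp

theorem ofPow_one : ofPow (1 : PowerSeries (Module.End ℂ M)) = oneField := by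
  funext m
  simp only [ofPow, oneField, PowerSeries.coeff_one]
  split_ifs <;> first | rfl | omega

theorem ofPowInv_one : ofPowInv (1 : PowerSeries (Module.End ℂ M)) = oneField := by
  funext m
  simp only [ofPowInv, oneField, PowerSeries.coeff_one]
  split_ifs <;> first | rfl | omega

theorem ofPowInv_mul (X Y : PowerSeries (Module.End ℂ M)) (hY : LowerTrunc (ofPowInv Y)) :
    fieldMul (ofPowInv X) (ofPowInv Y) = ofPowInv (X * Y) := by
  funext m; ext v
  have hc : Composable (ofPowInv X) (ofPowInv Y) :=
    (nonposSupp_ofPowInv Y).composable hY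
  rw [fieldMul_apply hc]
  by_cases hm : 0 < m
  · rw [nonposSupp_ofPowInv _ m hm]
    refine finsum_eq_zero_of_forall_eq_zero fun k => ?_
    by_cases hk : 0 < k
    · simp [nonposSupp_ofPowInv Y k hk]
    · simp [nonposSupp_ofPowInv X (m - k) (by omega)]
  obtain ⟨n, rfl⟩ : ∃ n : ℕ, m = -n := ⟨(-m).toNat, by omega⟩
  have hr : ofPowInv (X * Y) (-n) = PowerSeries.coeff n (X * Y) := by simp [ofPowInv]
  rw [hr, PowerSeries.coeff_mul, LinearMap.sum_apply]
  rw [finsum_eq_sum_of_support_subset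
    (s := (Finset.HasAntidiagonal.antidiagonal n).image fun p => -(p.2 : ℤ)), Finset.sum_image]
  · refine Finset.sum_congr rfl fun p hp => ?_
    have hp' := Finset.HasAntidiagonal.mem_antidiagonal.mp hp
    have h1 : -(-(n : ℤ) - -(p.2 : ℤ)) = p.1 := by omega
    have h2 : -(n : ℤ) - -(p.2 : ℤ) ≤ 0 := by omega
    simp only [ofPowInv, h1, h2, if_true]
    simp
  · rintro ⟨a, b⟩ hp ⟨c, d⟩ hq h
    simp only [Finset.mem_coe, Finset.HasAntidiagonal.mem_antidiagonal] at hp hq h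
    ext <;> simp <;> omega
  · intro k hk
    have h1 : ¬ 0 < k := fun h => hk (by simp [nonposSupp_ofPowInv Y k h])
    have h2 : ¬ 0 < -(n : ℤ) - k := fun h => hk (by simp [nonposSupp_ofPowInv X _ h])
    simp only [Finset.coe_image, Set.mem_image, Finset.mem_coe,
      Finset.HasAntidiagonal.mem_antidiagonal]
    exact ⟨(n - (-k).toNat, (-k).toNat), by simp only; omega, by simp only; omega⟩

theorem ofPow_mul (X Y : PowerSeries (Module.End ℂ M)) :
    fieldMul (ofPow X) (ofPow Y) = ofPow (X * Y) := by
  funext m; ext v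
  have hc : Composable (ofPow X) (ofPow Y) :=
    (nonnegSupp_ofPow X).composable (nonnegSupp_ofPow Y).lowerTrunc
  rw [fieldMul_apply hc]
  by_cases hm : m < 0
  · rw [nonnegSupp_ofPow _ m hm]
    refine finsum_eq_zero_of_forall_eq_zero fun k => ?_
    by_cases hk : k < 0
    · simp [nonnegSupp_ofPow Y k hk]
    · simp [nonnegSupp_ofPow X (m - k) (by omega)]
  obtain ⟨n, rfl⟩ : ∃ n : ℕ, m = n := ⟨m.toNat, by omega⟩
  have hr : ofPow (X * Y) n = PowerSeries.coeff n (X * Y) := by simp [ofPow]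
  rw [hr, PowerSeries.coeff_mul, LinearMap.sum_apply]
  rw [finsum_eq_sum_of_support_subset
    (s := (Finset.HasAntidiagonal.antidiagonal n).image fun p => (p.2 : ℤ)), Finset.sum_image]
  · refine Finset.sum_congr rfl fun p hp => ?_
    have hp' := Finset.HasAntidiagonal.mem_antidiagonal.mp hp
    have h1 : (n : ℤ) - (p.2 : ℤ) = p.1 := by omega
    simp [ofPow, h1]
  · rintro ⟨a, b⟩ hp ⟨c, d⟩ hq h
    simp only [Finset.mem_coe, Finset.HasAntidiagonal.mem_antidiagonal] at hp hq h
    ext <;> simp <;> omega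
  · intro k hk
    have h1 : ¬ k < 0 := fun h => hk (by simp [nonnegSupp_ofPow Y k h])
    have h2 : ¬ (n : ℤ) - k < 0 := fun h => hk (by simp [nonnegSupp_ofPow X _ h])
    simp only [Finset.coe_image, Set.mem_image, Finset.mem_coe,
      Finset.HasAntidiagonal.mem_antidiagonal]
    exact ⟨(n - k.toNat, k.toNat), by simp only; omega, by simp only; omega⟩

end FieldProducts

/-! ### Exponentials of power series with noncommuting coefficients -/

section Exponential

open Finset.HasAntidiagonal

variable {R : Type} [Ring R]

/-- The Euler derivation `z d/dz` of power series. -/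
def eulerPS (P : PowerSeries R) : PowerSeries R :=
  PowerSeries.mk fun m => m • PowerSeries.coeff m P

@[simp] theorem coeff_eulerPS (P : PowerSeries R) (m : ℕ) :
    PowerSeries.coeff m (eulerPS P) = m • PowerSeries.coeff m P := by
  simp [eulerPS]

theorem eulerPS_mul (P Q : PowerSeries R) :
    eulerPS (P * Q) = eulerPS P * Q + P * eulerPS Q := by
  ext m
  simp only [coeff_eulerPS, PowerSeries.coeff_mul, map_add, Finset.smul_sum,
    ← Finset.sum_add_distrib]
  refine Finset.sum_congr rfl fun p hp => ?_
  rw [← mem_antidiagonal.mp hp, add_smul, smul_mul_assoc, mul_smul_comm]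

theorem eulerPS_sub (P Q : PowerSeries R) : eulerPS (P - Q) = eulerPS P - eulerPS Q := by
  ext m; simp [smul_sub]

theorem eulerPS_neg (P : PowerSeries R) : eulerPS (-P) = -eulerPS P := by
  ext m; simp

theorem eulerPS_C (a : R) : eulerPS (PowerSeries.C a) = 0 := by
  ext m
  rcases m with _ | m
  · simp
  · simp

theorem commute_of_coeff {P Q : PowerSeries R}
    (h : ∀ i j, Commute (PowerSeries.coeff i P) (PowerSeries.coeff j Q)) : Commute P Q := by
  ext m
  rw [PowerSeries.coeff_mul, PowerSeries.coeff_mul, ← Finset.Nat.sum_antidiagonal_swap]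
  exact Finset.sum_congr rfl fun p _ => (h _ _).eq

theorem commute_C_iff {a : R} {P : PowerSeries R} :
    Commute (PowerSeries.C a) P ↔ ∀ i, Commute a (PowerSeries.coeff i P) := by
  constructor
  · intro h i
    have := congrArg (PowerSeries.coeff i) h.eq
    rwa [PowerSeries.coeff_C_mul, PowerSeries.coeff_mul_C] at this
  · intro h
    ext i
    simpa [PowerSeries.coeff_C_mul, PowerSeries.coeff_mul_C] using (h i).eq

theorem eulerPS_pow {P : PowerSeries R} (h : Commute P (eulerPS P)) (n : ℕ) :
    eulerPS (P ^ (n + 1)) = (n + 1) • (eulerPS P * P ^ n) := by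
  induction n with
  | zero => simp
  | succ n ih =>
    rw [pow_succ' P (n + 1), eulerPS_mul, ih, mul_smul_comm, ← mul_assoc, h.eq, mul_assoc,
      ← pow_succ', ← succ_nsmul']

theorem coeff_pow_eq_zero {P : PowerSeries R} (h : PowerSeries.coeff 0 P = 0) :
    ∀ n m, m < n → PowerSeries.coeff m (P ^ n) = 0 := by
  intro n
  induction n with
  | zero => intro m hm; omega
  | succ n ih =>
    intro m hm
    rw [pow_succ', PowerSeries.coeff_mul]
    refine Finset.sum_eq_zero fun p hp => ?_
    have hp' := mem_antidiagonal.mp hp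
    rcases Nat.eq_zero_or_pos p.1 with h0 | h0
    · rw [h0, h, zero_mul]
    · rw [ih p.2 (by omega), mul_zero]

theorem coeff_zero_eulerPS (X : PowerSeries R) : PowerSeries.coeff 0 (eulerPS X) = 0 := by
  simp

theorem commute_eulerPS {X : PowerSeries R}
    (hX : ∀ i j, Commute (PowerSeries.coeff i X) (PowerSeries.coeff j X)) :
    Commute X (eulerPS X) :=
  commute_of_coeff fun i j => by
    rw [coeff_eulerPS]
    exact (hX i j).smul_right j

theorem commutator_neg (a b : R) : a * -b - -b * a = -(a * b - b * a) := by
  noncomm_ring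

variable [Algebra ℂ R]

/-- A solution of the linear differential equation `z W' = H W` with `H` of positive order
is determined by its constant coefficient. -/
theorem eulerPS_unique {H W W' : PowerSeries R} (hH : PowerSeries.coeff 0 H = 0)
    (h : eulerPS W = H * W) (h' : eulerPS W' = H * W')
    (h0 : PowerSeries.coeff 0 W = PowerSeries.coeff 0 W') : W = W' := by
  ext m
  induction m using Nat.strong_induction_on with
  | _ m ih =>
    rcases Nat.eq_zero_or_pos m with rfl | hm
    · exact h0
    have e := congrArg (PowerSeries.coeff m) h
    have e' := congrArg (PowerSeries.coeff m) h'
    rw [coeff_eulerPS, PowerSeries.coeff_mul] at e e'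
    have : m • PowerSeries.coeff m W = m • PowerSeries.coeff m W' := by
      rw [e, e']
      refine Finset.sum_congr rfl fun p hp => ?_
      have hp' := mem_antidiagonal.mp hp
      rcases Nat.eq_zero_or_pos p.1 with hp0 | hp0
      · rw [hp0, hH, zero_mul, zero_mul]
      · rw [ih p.2 (by omega)]
    have h2 := congrArg (fun x => ((m : ℂ)⁻¹) • x) this
    have hm' : (m : ℂ) ≠ 0 := by exact_mod_cast hm.ne'
    simpa [← Nat.cast_smul_eq_nsmul ℂ, smul_smul, hm'] using h2

variable {X : PowerSeries R}

theorem coeff_expSeries_of_lt (hX0 : PowerSeries.coeff 0 X = 0) {m N : ℕ} (h : m < N) :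
    PowerSeries.coeff m (expSeries X) =
      ∑ n ∈ Finset.range N, ((n.factorial : ℂ)⁻¹) • PowerSeries.coeff m (X ^ n) := by
  rw [expSeries, PowerSeries.coeff_mk]
  refine Finset.sum_subset (by simpa using h) fun n _ hn => ?_
  rw [coeff_pow_eq_zero hX0 n m (by simpa using hn), smul_zero]

theorem coeff_zero_expSeries (X : PowerSeries R) : PowerSeries.coeff 0 (expSeries X) = 1 := by
  rw [PowerSeries.coeff_zero_eq_constantCoeff_apply, constantCoeff_expSeries]

/-- The exponential satisfies `z (exp X)' = z X' exp X`. -/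
theorem eulerPS_expSeries (hX0 : PowerSeries.coeff 0 X = 0)
    (hX : ∀ i j, Commute (PowerSeries.coeff i X) (PowerSeries.coeff j X)) :
    eulerPS (expSeries X) = eulerPS X * expSeries X := by
  ext m
  have hl : PowerSeries.coeff m (eulerPS (expSeries X)) =
      ∑ n ∈ Finset.range (m + 1), ((n.factorial : ℂ)⁻¹) •
        PowerSeries.coeff m (eulerPS X * X ^ n) := by
    rw [coeff_eulerPS, coeff_expSeries_of_lt hX0 (show m < m + 1 + 1 by omega),
      Finset.sum_range_succ', smul_add, Finset.smul_sum]
    have h0 : m • ((Nat.factorial 0 : ℂ)⁻¹ • PowerSeries.coeff m (X ^ 0)) = 0 := by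
      rcases m with _ | m
      · simp
      · simp [PowerSeries.coeff_one]
    rw [h0, add_zero]
    refine Finset.sum_congr rfl fun n _ => ?_
    rw [smul_comm, ← coeff_eulerPS, eulerPS_pow (commute_eulerPS hX), map_nsmul,
      ← Nat.cast_smul_eq_nsmul ℂ, smul_smul]
    congr 1
    have h1 : ((n + 1 : ℕ) : ℂ) ≠ 0 := by exact_mod_cast n.succ_ne_zero
    rw [Nat.factorial_succ, Nat.cast_mul, mul_inv, mul_right_comm, inv_mul_cancel₀ h1, one_mul]
  rw [hl, PowerSeries.coeff_mul]
  simp only [PowerSeries.coeff_mul, Finset.smul_sum]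
  rw [Finset.sum_comm]
  refine Finset.sum_congr rfl fun p hp => ?_
  have hp' := mem_antidiagonal.mp hp
  rw [coeff_expSeries_of_lt hX0 (show p.2 < m + 1 by omega), Finset.mul_sum]
  exact Finset.sum_congr rfl fun n _ => by rw [mul_smul_comm]

/-- An operator that commutes with all coefficients of `X` commutes with those of `exp X`. -/
theorem commute_coeff_expSeries {a : R} (h : ∀ i, Commute a (PowerSeries.coeff i X)) (m : ℕ) :
    Commute a (PowerSeries.coeff m (expSeries X)) := by
  rw [expSeries, PowerSeries.coeff_mk]
  refine Commute.sum_right _ _ _ fun n _ => Commute.smul_right ?_ _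
  exact commute_C_iff.mp ((commute_C_iff.mpr h).pow_right n) m

theorem expSeries_mul_expSeries_neg (hX0 : PowerSeries.coeff 0 X = 0)
    (hX : ∀ i j, Commute (PowerSeries.coeff i X) (PowerSeries.coeff j X)) :
    expSeries X * expSeries (-X) = 1 := by
  have hc : Commute (expSeries X) (eulerPS X) := commute_of_coeff fun i j => by
    rw [coeff_eulerPS]
    exact (commute_coeff_expSeries (fun k => hX j k) i).symm.smul_right j
  refine eulerPS_unique (H := 0) (by simp) ?_ ?_ ?_
  · rw [eulerPS_mul, eulerPS_expSeries hX0 hX,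
      eulerPS_expSeries (X := -X) (by rw [map_neg, hX0, neg_zero]) fun i j => by
        simpa using hX i j, eulerPS_neg, ← mul_assoc, mul_neg, hc.eq]
    simp
  · have : (1 : PowerSeries R) = PowerSeries.C 1 := by simp
    rw [this, eulerPS_C]
    simp
  · rw [PowerSeries.coeff_mul]
    simp [coeff_zero_expSeries]

theorem inverse_expSeries (hX0 : PowerSeries.coeff 0 X = 0)
    (hX : ∀ i j, Commute (PowerSeries.coeff i X) (PowerSeries.coeff j X)) :
    Ring.inverse (expSeries X) = expSeries (-X) := by
  have h1 := expSeries_mul_expSeries_neg hX0 hX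
  have h2 := expSeries_mul_expSeries_neg (X := -X) (by rw [map_neg, hX0, neg_zero]) fun i j => by
    simpa using hX i j
  rw [neg_neg] at h2
  exact Ring.inverse_unit ⟨_, _, h1, h2⟩

/-- If only odd powers of `z` occur in `X(z)`, then `exp (-X(z)) = (exp X)(-z)`. -/
theorem coeff_expSeries_neg_of_odd (hX0 : PowerSeries.coeff 0 X = 0)
    (hX : ∀ i j, Commute (PowerSeries.coeff i X) (PowerSeries.coeff j X))
    (hodd : ∀ i, ¬ Odd i → PowerSeries.coeff i X = 0) (m : ℕ) :
    PowerSeries.coeff m (expSeries (-X)) =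
      (-1 : ℂ) ^ m • PowerSeries.coeff m (expSeries X) := by
  have h : expSeries (-X) =
      PowerSeries.mk fun m => (-1 : ℂ) ^ m • PowerSeries.coeff m (expSeries X) := by
    refine eulerPS_unique (H := eulerPS (-X)) (coeff_zero_eulerPS _)
      (eulerPS_expSeries (by rw [map_neg, hX0, neg_zero]) fun i j => by simpa using hX i j) ?_
      (by simp [coeff_zero_expSeries])
    ext m
    rw [coeff_eulerPS, PowerSeries.coeff_mk, smul_comm, ← coeff_eulerPS,
      eulerPS_expSeries hX0 hX, PowerSeries.coeff_mul, PowerSeries.coeff_mul, Finset.smul_sum]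
    refine Finset.sum_congr rfl fun p hp => ?_
    rw [← mem_antidiagonal.mp hp, PowerSeries.coeff_mk, pow_add, mul_smul, eulerPS_neg, map_neg,
      mul_smul_comm, smul_comm, ← smul_mul_assoc]
    congr 1
    by_cases ho : Odd p.1
    · rw [ho.neg_one_pow, neg_one_smul, neg_mul]
    · simp [hodd _ ho]
  rw [h, PowerSeries.coeff_mk]

/-- If the commutator `[a, X]` is central, then `[a, exp X] = [a, X] exp X`. -/
theorem commutator_expSeries (hX0 : PowerSeries.coeff 0 X = 0)
    (hX : ∀ i j, Commute (PowerSeries.coeff i X) (PowerSeries.coeff j X)) {a : R}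
    {Z : PowerSeries R} (hZ : PowerSeries.C a * X - X * PowerSeries.C a = Z)
    (hZc : ∀ P : PowerSeries R, Commute Z P) :
    PowerSeries.C a * expSeries X - expSeries X * PowerSeries.C a = Z * expSeries X := by
  have hZ0 : PowerSeries.coeff 0 Z = 0 := by
    rw [← hZ, map_sub, PowerSeries.coeff_C_mul, PowerSeries.coeff_mul_C, hX0]
    simp
  have hE := eulerPS_expSeries hX0 hX
  have hEZ : eulerPS Z = PowerSeries.C a * eulerPS X - eulerPS X * PowerSeries.C a := by
    rw [← hZ, eulerPS_sub, eulerPS_mul, eulerPS_mul, eulerPS_C]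
    simp
  rw [← sub_eq_zero]
  refine eulerPS_unique (H := eulerPS X) (coeff_zero_eulerPS _) ?_ (by ext m; simp) ?_
  · rw [eulerPS_sub, eulerPS_sub, eulerPS_mul, eulerPS_mul, eulerPS_mul, eulerPS_C, hE, hEZ]
    have h1 : Z * (eulerPS X * expSeries X) = eulerPS X * (Z * expSeries X) := by
      rw [← mul_assoc, (hZc _).eq, mul_assoc]
    rw [h1]
    noncomm_ring
  · rw [map_sub, map_sub, PowerSeries.coeff_C_mul, PowerSeries.coeff_mul_C,
      PowerSeries.coeff_mul]
    simp [coeff_zero_expSeries, hZ0]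

/-! ### Exchange relations for exponentials of odd series -/

/-- The logarithm of a vertex operator: `∑_{k>0 odd} (2/k) J_k z^k`. -/
def oddLog (J : ℕ → R) : PowerSeries R :=
  PowerSeries.mk fun k => if Odd k then (2 / (k : ℂ)) • J k else 0

theorem coeff_zero_oddLog (J : ℕ → R) : PowerSeries.coeff 0 (oddLog J) = 0 := by
  simp [oddLog]

theorem oddLog_commute {J : ℕ → R} (hJ : ∀ i j, Odd i → Odd j → Commute (J i) (J j)) (i j : ℕ) :
    Commute (PowerSeries.coeff i (oddLog J)) (PowerSeries.coeff j (oddLog J)) := by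
  simp only [oddLog, PowerSeries.coeff_mk]
  split_ifs with h1 h2 h2
  · exact ((hJ i j h1 h2).smul_left _).smul_right _
  all_goals simp

theorem oddLog_eq_zero_of_not_odd (J : ℕ → R) {i : ℕ} (h : ¬ Odd i) :
    PowerSeries.coeff i (oddLog J) = 0 := by
  simp [oddLog, h]

theorem neg_oddLog (J : ℕ → R) : -oddLog J = oddLog (-J) := by
  ext k
  simp only [oddLog, map_neg, PowerSeries.coeff_mk, Pi.neg_apply, smul_neg]
  split_ifs <;> simp

/-- The coefficients of `(1 + w) / (1 - w)`. -/
def cayley (j : ℕ) : ℂ := if j = 0 then 1 else 2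

/-- The coefficients of `(∑_{k odd} w^k) (1 + w) / (1 - w) = w / (1 - w)²`. Hence
`(1 + w) / (1 - w)` solves `w S' = (∑_{k odd} 2 w^k) S`. -/
theorem sum_odd_cayley : ∀ m : ℕ,
    ∑ p ∈ antidiagonal m, (if Odd p.1 then cayley p.2 else 0) = m
  | 0 => by simp
  | 1 => by simp [Finset.Nat.antidiagonal_succ, cayley]
  | m + 2 => by
    have ih := sum_odd_cayley m
    rw [Finset.Nat.sum_antidiagonal_succ, Finset.Nat.sum_antidiagonal_succ]
    have h : ∀ n : ℕ, Odd (n + 1 + 1) ↔ Odd n := fun n => by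
      rw [Nat.odd_add_one, Nat.odd_add_one, not_not]
    simp only [h, ih]
    simp [cayley]
    ring

/-- The exchange relation `(1 - z/y) V(z) A(y) = (1 + z/y) A(y) V(z)` for
`V(z) = exp (∑_{k>0 odd} (2/k) J_k z^k)` and `A(y) = ∑ A_q y^q` with `[J_k, A_q] = A_{q-k}`.
Both `V(z) A(y)` and `(1 + z/y) / (1 - z/y) A(y) V(z)` solve `z W' = H W`,
with `H` the Euler derivative of the logarithm of `V`, and they agree at `z = 0`. -/
theorem expSeries_oddLog_exchange {J : ℕ → R} {A : ℤ → R}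
    (hJ : ∀ i j, Odd i → Odd j → Commute (J i) (J j))
    (hA : ∀ k q, Odd k → J k * A q - A q * J k = A (q - k)) (q : ℤ) :
    expSeries (oddLog J) * PowerSeries.C (A q) -
        PowerSeries.X * (expSeries (oddLog J) * PowerSeries.C (A (q - 1))) =
      PowerSeries.C (A q) * expSeries (oddLog J) +
        PowerSeries.X * (PowerSeries.C (A (q - 1)) * expSeries (oddLog J)) := by
  set V := expSeries (oddLog J) with hV
  have hE : eulerPS V = eulerPS (oddLog J) * V :=
    eulerPS_expSeries (coeff_zero_oddLog J) (oddLog_commute hJ)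
  have hh : ∀ k, PowerSeries.coeff k (eulerPS (oddLog J)) =
      if Odd k then (2 : ℂ) • J k else 0 := by
    intro k
    rw [coeff_eulerPS, oddLog, PowerSeries.coeff_mk]
    split_ifs with h
    · have : (k : ℂ) ≠ 0 := by exact_mod_cast h.pos.ne'
      rw [← Nat.cast_smul_eq_nsmul ℂ, smul_smul, mul_div_cancel₀ _ this]
    · simp
  -- `S q` is the expansion of `(1 + w) / (1 - w) A(y)`, `w = z / y`
  set S : ℤ → PowerSeries R := fun q => PowerSeries.mk fun j => cayley j • A (q - j) with hS
  have hSh : ∀ q, eulerPS (oddLog J) * S q - S q * eulerPS (oddLog J) = eulerPS (S q) := by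
    intro q
    ext m
    rw [map_sub, PowerSeries.coeff_mul, PowerSeries.coeff_mul,
      ← Finset.Nat.sum_antidiagonal_swap (n := m) (f := fun p =>
        PowerSeries.coeff p.1 (S q) * PowerSeries.coeff p.2 (eulerPS (oddLog J))),
      ← Finset.sum_sub_distrib, coeff_eulerPS]
    have h1 : ∀ p ∈ antidiagonal m,
        PowerSeries.coeff p.1 (eulerPS (oddLog J)) * PowerSeries.coeff p.2 (S q) -
          PowerSeries.coeff p.swap.1 (S q) * PowerSeries.coeff p.swap.2 (eulerPS (oddLog J)) =
        (if Odd p.1 then cayley p.2 else 0) • (2 : ℂ) • A (q - m) := by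
      intro p hp
      have hp' : (p.1 : ℤ) + p.2 = m := by exact_mod_cast mem_antidiagonal.mp hp
      rw [Prod.fst_swap, Prod.snd_swap, hh, hS]
      simp only [PowerSeries.coeff_mk]
      split_ifs with ho
      · have h2 := hA p.1 (q - p.2) ho
        rw [show q - (p.2 : ℤ) - p.1 = q - m by omega] at h2
        rw [← h2]
        simp only [smul_mul_assoc, mul_smul_comm, smul_sub]
        rw [smul_comm (2 : ℂ) (cayley p.2) (A _ * _)]
      · simp
    rw [Finset.sum_congr rfl h1, ← Finset.sum_smul, sum_odd_cayley, hS, PowerSeries.coeff_mk,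
      ← Nat.cast_smul_eq_nsmul ℂ]
    rcases Nat.eq_zero_or_pos m with rfl | hm
    · simp
    · simp [cayley, hm.ne']
  have hVS : ∀ q, V * PowerSeries.C (A q) = S q * V := by
    intro q
    refine eulerPS_unique (H := eulerPS (oddLog J)) (coeff_zero_eulerPS _) ?_ ?_ ?_
    · rw [eulerPS_mul, eulerPS_C, hE, mul_zero, add_zero, mul_assoc]
    · rw [eulerPS_mul, ← hSh, hE]
      noncomm_ring
    · rw [PowerSeries.coeff_mul_C, PowerSeries.coeff_mul]
      simp [hV, coeff_zero_expSeries, hS, cayley]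
  have hrec : S q = PowerSeries.C (A q) + PowerSeries.X * PowerSeries.C (A (q - 1)) +
      PowerSeries.X * S (q - 1) := by
    ext j
    rcases j with _ | _ | j
    · simp [hS, cayley]
    · simp [hS, cayley, PowerSeries.coeff_succ_X_mul, two_smul]
    · have h1 : q - 1 - ((j : ℤ) + 1) = q - (j + 1 + 1) := by ring
      simp [hS, cayley, PowerSeries.coeff_succ_X_mul, h1, PowerSeries.coeff_X]
  rw [hVS, hVS, hrec]
  noncomm_ring

/-- The exchange relation `(1 + z/y) V(z)⁻¹ A(y) = (1 - z/y) A(y) V(z)⁻¹`,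
obtained from that for `V(z)` by the substitutions `J → -J`, `A(y) → A(-y)`. -/
theorem expSeries_neg_oddLog_exchange {J : ℕ → R} {A : ℤ → R}
    (hJ : ∀ i j, Odd i → Odd j → Commute (J i) (J j))
    (hA : ∀ k q, Odd k → J k * A q - A q * J k = A (q - k)) (q : ℤ) :
    expSeries (oddLog (-J)) * PowerSeries.C (A q) +
        PowerSeries.X * (expSeries (oddLog (-J)) * PowerSeries.C (A (q - 1))) =
      PowerSeries.C (A q) * expSeries (oddLog (-J)) -
        PowerSeries.X * (PowerSeries.C (A (q - 1)) * expSeries (oddLog (-J))) := by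
  have hz : (-1 : ℂ) ≠ 0 := by norm_num
  have h := expSeries_oddLog_exchange (J := -J) (A := fun q => (-1 : ℂ) ^ q • A q)
    (fun i j hi hj => (hJ i j hi hj).neg_left.neg_right)
    (fun k q hk => by
      rw [Pi.neg_apply, mul_smul_comm, smul_mul_assoc, ← smul_sub, neg_mul, mul_neg,
        neg_sub_neg, ← neg_sub, hA k q hk, zpow_sub₀ hz, zpow_natCast, hk.neg_one_pow, smul_neg,
        div_neg, div_one, neg_smul]) q
  have hC : ∀ q, PowerSeries.C ((-1 : ℂ) ^ q • A q) = (-1 : ℂ) ^ q • PowerSeries.C (A q) :=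
    fun q => by
      ext i
      rw [PowerSeries.coeff_smul, PowerSeries.coeff_C, PowerSeries.coeff_C]
      split_ifs <;> simp
  have h' := congrArg (fun x => (-1 : ℂ) ^ q • x) h
  have e : (-1 : ℂ) ^ q * (-1 : ℂ) ^ q = 1 := by rw [← mul_zpow]; norm_num
  have e' : (-1 : ℂ) ^ q * (-1 : ℂ) ^ (q - 1) = -1 := by
    rw [zpow_sub_one₀ hz, ← mul_assoc, e]; norm_num
  simp only [hC, mul_smul_comm, smul_mul_assoc, smul_sub, smul_add, smul_smul, e, e', one_smul,
    neg_one_smul, sub_neg_eq_add, ← sub_eq_add_neg] at h'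
  exact h'

/-- The recursion `a_{p-1,q} + a_{p,q-1} = 2 (-1)^p δ_{p+q,0} x` determines `a` along an
antidiagonal up to a constant: `(-1)^p a_{p,N-p}` is linear in `p`. -/
theorem antidiagonal_rec {E : Type} [AddCommGroup E] [Module ℂ E] {a : ℤ → ℤ → E} {x : E}
    (hrec : ∀ p q, a (p - 1) q + a p (q - 1) = if p + q = 0 then (2 * (-1 : ℂ) ^ p) • x else 0)
    (N p : ℤ) :
    (-1 : ℂ) ^ p • a p (N - p) = a 0 N + (if N = -1 then (2 * p : ℂ) • x else 0) := by
  have hz : (-1 : ℂ) ≠ 0 := by norm_num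
  have hstep : ∀ p : ℤ, (-1 : ℂ) ^ p • a p (N - p) =
      (-1 : ℂ) ^ (p - 1) • a (p - 1) (N - (p - 1)) + (if N = -1 then (2 : ℂ) • x else 0) := by
    intro p
    have h := hrec p (N - (p - 1))
    have e1 : (-1 : ℂ) ^ p * (-1 : ℂ) ^ p = 1 := by rw [← mul_zpow]; norm_num
    rw [show N - (p - 1) - 1 = N - p by ring] at h
    rw [eq_sub_of_add_eq' h, smul_sub, zpow_sub_one₀ hz]
    have e : (-1 : ℂ)⁻¹ = -1 := by norm_num
    rw [e, mul_neg_one, neg_smul]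
    by_cases hN : N = -1
    · rw [if_pos (by omega), if_pos hN, smul_smul, mul_left_comm, e1, mul_one]
      abel
    · rw [if_neg (by omega), if_neg hN, smul_zero]
      abel
  induction p using Int.induction_on with
  | zero => simp
  | succ i ih =>
    rw [hstep, add_sub_cancel_right, ih, add_assoc]
    congr 1
    split_ifs
    · rw [← add_smul]; congr 1; push_cast; ring
    · simp
  | pred i ih =>
    have h := hstep (-i)
    rw [ih] at h
    rw [← sub_eq_iff_eq_add] at h
    rw [← h, add_sub_assoc]
    congr 1
    split_ifs
    · rw [← sub_smul]; congr 1; push_cast; ring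
    · simp

end Exponential

/-! ### The grading of the Fock space and Schur's lemma -/

open MvPolynomial in
/-- A polynomial of degree `n`, where `φ_j` has degree `2 j` (so that all degrees are integers). -/
def HomF (n : ℤ) (v : F) : Prop :=
  IsWeightedHomogeneous (fun k : ℕ => 2 * (k : ℤ) + 1) v n

/-- The operator `A` raises the degree by `d`. -/
def HasDeg (A : Module.End ℂ F) (d : ℤ) : Prop := ∀ n v, HomF n v → HomF (n + d) (A v)

theorem HomF.zero (n : ℤ) : HomF n 0 := MvPolynomial.isWeightedHomogeneous_zero _ _ _

theorem HomF.add {n : ℤ} {v w : F} (hv : HomF n v) (hw : HomF n w) : HomF n (v + w) :=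
  MvPolynomial.IsWeightedHomogeneous.add hv hw

theorem HomF.smul {n : ℤ} {v : F} (c : ℂ) (hv : HomF n v) : HomF n (c • v) :=
  (MvPolynomial.weightedHomogeneousSubmodule ℂ _ n).smul_mem c hv

theorem HomF.vac : HomF 0 vac := MvPolynomial.isWeightedHomogeneous_one _ _

theorem HomF.eq_zero_of_neg {n : ℤ} (hn : n < 0) {v : F} (hv : HomF n v) : v = 0 := by
  by_contra hne
  obtain ⟨d, hd⟩ := MvPolynomial.ne_zero_iff.mp hne
  have h := hv hd
  have h2 : 0 ≤ Finsupp.weight (fun k : ℕ => 2 * (k : ℤ) + 1) d := by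
    rw [Finsupp.weight_apply]
    exact Finset.sum_nonneg fun i _ => by positivity
  omega

namespace HasDeg

variable {A B : Module.End ℂ F} {d e : ℤ}

theorem mul (hA : HasDeg A d) (hB : HasDeg B e) : HasDeg (A * B) (d + e) := fun n v hv => by
  rw [add_comm d e, ← add_assoc]
  exact hA _ _ (hB _ _ hv)

theorem add (hA : HasDeg A d) (hB : HasDeg B d) : HasDeg (A + B) d := fun n v hv =>
  (hA n v hv).add (hB n v hv)

theorem smul (c : ℂ) (hA : HasDeg A d) : HasDeg (c • A) d := fun n v hv =>
  (hA n v hv).smul c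

theorem sub (hA : HasDeg A d) (hB : HasDeg B d) : HasDeg (A - B) d := by
  rw [sub_eq_add_neg, ← neg_one_smul ℂ B]
  exact hA.add (hB.smul _)

theorem zero (d : ℤ) : HasDeg 0 d := fun n _ _ => HomF.zero (n + d)

theorem one : HasDeg 1 0 := fun n v hv => by simpa using hv

theorem sum {ι : Type} (s : Finset ι) {f : ι → Module.End ℂ F} (h : ∀ i ∈ s, HasDeg (f i) d) :
    HasDeg (∑ i ∈ s, f i) d :=
  Finset.sum_induction f (HasDeg · d) (fun _ _ => add) (zero d) h

theorem locSum {ι : Type} {f : ι → Module.End ℂ F} (h : ∀ i, HasDeg (f i) d) :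
    HasDeg (locSum f) d := by
  by_cases hf : LocFin f
  · intro n v hv
    rw [locSum_apply hf]
    exact finsum_induction (HomF (n + d)) (HomF.zero _) (fun _ _ => HomF.add)
      fun i => h i n v hv
  · rw [CKP.locSum, dif_neg hf]
    exact zero d

/-- The degree of a nonzero scalar is `0`. -/
theorem scalar_eq_zero {c : ℂ} (h : HasDeg (c • 1) d) (hd : d ≠ 0) : c = 0 := by
  by_contra hc
  have h1 : HomF (0 + d) (c • vac) := h 0 vac HomF.vac
  have h2 : HomF 0 (c • vac) := HomF.vac.smul c
  have h3 : c • vac ≠ 0 := smul_ne_zero hc one_ne_zero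
  have := MvPolynomial.IsWeightedHomogeneous.inj_right h3 h1 h2
  omega

end HasDeg

/-- Operators of sufficiently negative degree annihilate a given vector. -/
theorem exists_forall_hasDeg_eq_zero (v : F) :
    ∃ D : ℤ, ∀ A d, HasDeg A d → d < D → A v = 0 := by
  induction v using MvPolynomial.induction_on' with
  | monomial u a =>
    refine ⟨-Finsupp.weight (fun k : ℕ => 2 * (k : ℤ) + 1) u, fun A d hA hd => ?_⟩
    refine (hA _ _ (MvPolynomial.isWeightedHomogeneous_monomial _ u a rfl)).eq_zero_of_neg ?_
    omega
  | add p q hp hq =>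
    obtain ⟨D, hD⟩ := hp
    obtain ⟨D', hD'⟩ := hq
    refine ⟨min D D', fun A d hA hd => ?_⟩
    rw [map_add, hD A d hA (by omega), hD' A d hA (by omega), add_zero]

theorem lowerTrunc_of_hasDeg {A : Field F} {s : ℤ} (h : ∀ m, HasDeg (A m) (2 * m + s)) :
    LowerTrunc A := by
  intro v
  obtain ⟨D, hD⟩ := exists_forall_hasDeg_eq_zero v
  exact ⟨min 0 (D - s), fun m hm => hD _ _ (h m) (by omega)⟩

theorem phi_hasDeg (m : ℤ) : HasDeg (phi m) (2 * m + 1) := by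
  rcases m with k | k
  · intro n v hv
    have h := (MvPolynomial.isWeightedHomogeneous_X ℂ (fun k : ℕ => 2 * (k : ℤ) + 1) k).mul hv
    rw [add_comm] at h
    exact h
  · intro n v hv
    refine HomF.smul _ (MvPolynomial.IsWeightedHomogeneous.pderiv hv ?_)
    rw [Int.negSucc_eq]
    ring

theorem phi_lowerTrunc : LowerTrunc phi := lowerTrunc_of_hasDeg phi_hasDeg

/-- The vacuum generates the Fock space under the creation operators. -/
theorem submodule_eq_top_of_phi {S : Submodule ℂ F} (h1 : vac ∈ S)
    (h : ∀ (k : ℕ), ∀ v ∈ S, phi k v ∈ S) : S = ⊤ := by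
  refine eq_top_iff.mpr fun v _ => ?_
  induction v using MvPolynomial.induction_on with
  | C a =>
    rw [← mul_one (MvPolynomial.C a), ← MvPolynomial.smul_eq_C_mul]
    exact S.smul_mem a h1
  | add p q hp hq => exact S.add_mem (hp trivial) (hq trivial)
  | mul_X p k hp =>
    rw [mul_comm]
    exact h k p (hp trivial)

theorem eq_C_of_pderiv_eq_zero {v : F} (h : ∀ k, MvPolynomial.pderiv k v = 0) :
    v = MvPolynomial.C (MvPolynomial.coeff 0 v) := by
  have key : ∀ (p : F) (k : ℕ) (d : ℕ →₀ ℕ),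
      MvPolynomial.coeff d (MvPolynomial.pderiv k p) =
        MvPolynomial.coeff (d + Finsupp.single k 1) p * (d k + 1) := by
    intro p k d
    induction p using MvPolynomial.induction_on' with
    | monomial u a =>
      rw [MvPolynomial.pderiv_monomial, MvPolynomial.coeff_monomial, MvPolynomial.coeff_monomial]
      by_cases hu : u = d + Finsupp.single k 1
      · subst hu
        simp
      · rw [if_neg hu, zero_mul]
        split_ifs with h1
        · rcases Nat.eq_zero_or_pos (u k) with h0 | h0
          · simp [h0]
          · refine absurd ?_ hu
            rw [← h1, tsub_add_cancel_of_le]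
            simpa using Nat.one_le_iff_ne_zero.mpr h0.ne'
        · rfl
    | add p q hp hq => rw [map_add, MvPolynomial.coeff_add, hp, hq, MvPolynomial.coeff_add]; ring
  ext d
  rw [MvPolynomial.coeff_C]
  split_ifs with hd
  · rw [hd]
  · obtain ⟨k, hk⟩ : ∃ k, d k ≠ 0 := by
      by_contra hc
      exact hd (Finsupp.ext fun k => by simpa [eq_comm] using not_exists.mp hc k)
    have h1 := key v k (d - Finsupp.single k 1)
    rw [h k, MvPolynomial.coeff_zero, tsub_add_cancel_of_le] at h1
    · refine (mul_eq_zero.mp h1.symm).resolve_right ?_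
      exact Nat.cast_add_one_ne_zero _
    · simpa using Nat.one_le_iff_ne_zero.mpr hk

/-- An operator that commutes with the creation operators is determined by its value on the
vacuum. -/
theorem eq_of_commute_phi {A : Module.End ℂ F} {c : ℂ} (h : ∀ m, Commute A (phi m))
    (h1 : A vac = c • vac) : A = c • 1 := by
  have : LinearMap.eqLocus A (c • 1) = ⊤ := by
    refine submodule_eq_top_of_phi h1 fun k v hv => ?_
    have hv' : A v = c • v := hv
    have := LinearMap.congr_fun (h k).eq v
    simp only [Module.End.mul_apply] at this
    change A (phi k v) = c • phi k v
    rw [this, hv', map_smul]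
  exact LinearMap.eqLocus_eq_top.mp this

/-- Schur's lemma for the Fock space. -/
theorem exists_scalar_of_commute_phi {A : Module.End ℂ F} (h : ∀ m, Commute A (phi m)) :
    ∃ c : ℂ, A = c • 1 := by
  refine ⟨_, eq_of_commute_phi (c := MvPolynomial.coeff 0 (A vac)) h ?_⟩
  have h1 : ∀ k, MvPolynomial.pderiv k (A vac) = 0 := by
    intro k
    have h2 := LinearMap.congr_fun (h (Int.negSucc k)).eq vac
    rw [Module.End.mul_apply, Module.End.mul_apply, phi_vac _ (Int.negSucc_lt_zero k),
      map_zero] at h2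
    have h3 : (-1 : ℂ) ^ k • MvPolynomial.pderiv k (A vac) = 0 := h2.symm
    exact (smul_eq_zero.mp h3).resolve_left (pow_ne_zero _ (by norm_num))
  rw [vac, MvPolynomial.smul_eq_C_mul, mul_one]
  exact eq_C_of_pderiv_eq_zero h1

/-! ### The currents -/

theorem nord_hasDeg (a b : ℤ) : HasDeg (nord a b) (2 * (a + b) + 2) := by
  rw [nord]
  split_ifs
  · convert (phi_hasDeg a).mul (phi_hasDeg b) using 1; ring
  · convert (phi_hasDeg b).mul (phi_hasDeg a) using 1; ring

theorem currentTerm_hasDeg (n a : ℤ) : HasDeg (currentTerm n a) (-2 * n) := by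
  rw [currentTerm]
  convert (nord_hasDeg a (-n - 1 - a)).smul _ using 1
  ring

theorem current_hasDeg (n : ℤ) : HasDeg (current n) (-2 * n) :=
  HasDeg.locSum (currentTerm_hasDeg n)

theorem currentTerm_locFin (n : ℤ) : LocFin (currentTerm n) := by
  intro v
  obtain ⟨N, hN⟩ := phi_lowerTrunc v
  refine (Set.finite_Icc (min N (-n.natAbs - 1)) (max (-n - 1 - N) (n.natAbs + 1))).subset
    fun a ha => ?_
  have ha' : nord a (-n - 1 - a) v ≠ 0 := fun h0 => ha (by simp [currentTerm, h0])
  rw [nord] at ha'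
  rw [Set.mem_Icc]
  split_ifs at ha' with h
  · have hb : ¬ -n - 1 - a < N := fun hb => ha' (by simp [hN _ hb])
    omega
  · have hb : ¬ a < N := fun hb => ha' (by simp [hN _ hb])
    omega

theorem commutator_mul_left {R : Type} [Ring R] (A B C : R) :
    A * B * C - C * (A * B) = (A * C - C * A) * B + A * (B * C - C * B) := by
  noncomm_ring

theorem nord_commutator_phi (a b m : ℤ) :
    nord a b * phi m - phi m * nord a b =
      (if a + m = -1 then (-1 : ℂ) ^ m • phi b else 0) +
        (if b + m = -1 then (-1 : ℂ) ^ m • phi a else 0) := by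
  have ha := phi_comm a m
  have hb := phi_comm b m
  rw [nord]
  split_ifs <;> rw [commutator_mul_left, ha, hb] <;> simp [*, add_comm]

theorem neg_one_zpow_mul_self (m : ℤ) : (-1 : ℂ) ^ m * (-1 : ℂ) ^ m = 1 := by
  rw [← mul_zpow]; norm_num

theorem neg_one_zpow_neg (m : ℤ) : (-1 : ℂ) ^ (-m) = (-1 : ℂ) ^ m := by
  rw [zpow_neg, ← inv_zpow]; norm_num

/-- `[J_n, φ(z)] = z^n φ(z)` for odd `n`. -/
theorem current_commutator_phi {n : ℤ} (hn : Odd n) (m : ℤ) :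
    current n * phi m - phi m * current n = phi (m - n) := by
  refine LinearMap.ext fun v => ?_
  have h1 := currentTerm_locFin n (phi m v)
  have h2 : (Function.support fun a => phi m (currentTerm n a v)).Finite :=
    (currentTerm_locFin n v).subset fun a ha h0 => ha (by
      change phi m (currentTerm n a v) = 0
      have h0' : currentTerm n a v = 0 := h0
      rw [h0', map_zero])
  have h3 : phi m (current n v) = ∑ᶠ a, phi m (currentTerm n a v) := by
    rw [current, locSum_apply (currentTerm_locFin n)]
    exact (phi m).toAddMonoidHom.map_finsum (currentTerm_locFin n v)
  rw [LinearMap.sub_apply, Module.End.mul_apply, Module.End.mul_apply, h3, current,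
    locSum_apply (currentTerm_locFin n), ← finsum_sub_distrib h1 h2]
  have hs1 : -(1 / 2) * (-1 : ℂ) ^ (-1 - m) * (-1 : ℂ) ^ m = 1 / 2 := by
    rw [show -1 - m = -(m + 1) by ring, neg_one_zpow_neg, zpow_add_one₀ (by norm_num)]
    linear_combination (1 / 2) * neg_one_zpow_mul_self m
  have hs2 : -(1 / 2) * (-1 : ℂ) ^ (m - n) * (-1 : ℂ) ^ m = 1 / 2 := by
    rw [zpow_sub₀ (by norm_num), hn.neg_one_zpow]
    linear_combination (1 / 2) * neg_one_zpow_mul_self m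
  have hterm : ∀ a, currentTerm n a (phi m v) - phi m (currentTerm n a v) =
      (if a = -1 - m then (1 / 2 : ℂ) • phi (m - n) v else 0) +
        (if a = m - n then (1 / 2 : ℂ) • phi (m - n) v else 0) := by
    intro a
    have h := LinearMap.congr_fun (nord_commutator_phi a (-n - 1 - a) m) v
    simp only [LinearMap.sub_apply, Module.End.mul_apply, LinearMap.add_apply] at h
    simp only [currentTerm, LinearMap.smul_apply, map_smul, ← smul_sub, h, smul_add]
    congr 1
    · by_cases ha : a = -1 - m
      · subst ha
        rw [if_pos (by ring), if_pos rfl, LinearMap.smul_apply, smul_smul, hs1]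
        congr 3; ring
      · rw [if_neg (by omega), if_neg ha, LinearMap.zero_apply, smul_zero]
    · by_cases ha : a = m - n
      · subst ha
        rw [if_pos (by ring), if_pos rfl, LinearMap.smul_apply, smul_smul, hs2]
      · rw [if_neg (by omega), if_neg ha, LinearMap.zero_apply, smul_zero]
  have hf : ∀ (c : ℤ) (x : F), (Function.support fun a : ℤ => if a = c then x else 0).Finite :=
    fun c x => (Set.finite_singleton c).subset fun a ha => by
      by_contra h
      exact ha (if_neg h)
  rw [finsum_congr hterm, finsum_add_distrib (hf _ _) (hf _ _),
    finsum_eq_single _ (-1 - m) (fun a ha => if_neg ha),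
    finsum_eq_single _ (m - n) (fun a ha => if_neg ha), if_pos rfl, if_pos rfl, ← add_smul]
  norm_num

theorem current_vac {n : ℤ} (hn : 0 < n) : current n vac = 0 :=
  (current_hasDeg n 0 vac HomF.vac).eq_zero_of_neg (by omega)

theorem current_apply_phi {n : ℤ} (hn : Odd n) (m : ℤ) (v : F) :
    current n (phi m v) = phi m (current n v) + phi (m - n) v := by
  have h := LinearMap.congr_fun (current_commutator_phi hn m) v
  simp only [LinearMap.sub_apply, Module.End.mul_apply] at h
  rw [← h]; abel

/-- Only the `n` terms of `J_{-n}` that consist of two creation operators contribute to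
`J_n J_{-n} |0⟩`, and all of them contribute equally. -/
theorem current_apply_currentTerm_vac {n : ℤ} (hn : Odd n) (h0 : 0 < n) (a : ℤ) :
    current n (currentTerm (-n) a vac) =
      if a ∈ Finset.Ico 0 n then (-(1 / 2) : ℂ) • vac else 0 := by
  simp only [currentTerm, LinearMap.smul_apply, map_smul, Finset.mem_Ico]
  rw [show - -n - 1 - a = n - 1 - a by ring]
  split_ifs with ha
  · have hb : nord a (n - 1 - a) = phi a * phi (n - 1 - a) := by
      rw [nord]
      split_ifs
      · rfl
      · have := phi_comm a (n - 1 - a)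
        rw [if_neg (by omega), sub_eq_zero] at this
        exact this.symm
    have hc := LinearMap.congr_fun (phi_comm (a - n) (n - 1 - a)) vac
    rw [if_pos (by ring), LinearMap.sub_apply, Module.End.mul_apply, Module.End.mul_apply,
      phi_vac (a - n) (by omega), map_zero, sub_zero] at hc
    rw [hb, Module.End.mul_apply, current_apply_phi hn, current_apply_phi hn, current_vac h0,
      phi_vac (n - 1 - a - n) (by omega), hc]
    simp only [map_zero, add_zero, zero_add, LinearMap.smul_apply, Module.End.one_apply, smul_smul]
    congr 1
    rw [show n - 1 - a = n + -(a + 1) by ring, zpow_add₀ (by norm_num), hn.neg_one_zpow,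
      neg_one_zpow_neg, zpow_add_one₀ (by norm_num)]
    linear_combination (-(1 / 2)) * neg_one_zpow_mul_self a
  · have : nord a (n - 1 - a) vac = 0 := by
      rw [nord]
      split_ifs with h
      · rw [Module.End.mul_apply, phi_vac (n - 1 - a) (by omega), map_zero]
      · rw [Module.End.mul_apply, phi_vac a (by omega), map_zero]
    rw [this, map_zero, smul_zero]

theorem current_current_neg_vac {n : ℤ} (hn : Odd n) (h0 : 0 < n) :
    current n (current (-n) vac) = (-(n / 2) : ℂ) • vac := by
  have h1 : current n (current (-n) vac) = ∑ᶠ a, current n (currentTerm (-n) a vac) := by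
    rw [current.eq_def (-n), locSum_apply (currentTerm_locFin (-n))]
    exact (current n).toAddMonoidHom.map_finsum (currentTerm_locFin (-n) vac)
  rw [h1, finsum_congr (current_apply_currentTerm_vac hn h0),
    finsum_eq_sum_of_support_subset (s := Finset.Ico 0 n), Finset.sum_ite_mem, Finset.inter_self,
    Finset.sum_const, Int.card_Ico, ← Nat.cast_smul_eq_nsmul ℂ, smul_smul]
  · congr 1
    have : ((n - 0).toNat : ℂ) = n := by
      have : (((n - 0).toNat : ℤ) : ℂ) = n := by congr 1; omega
      exact_mod_cast this
    rw [this]; ring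
  · intro a ha
    by_contra h
    exact ha (if_neg h)

/-- A form of the Jacobi identity: `[A, B]` commutes with `C` if `[A, [B, C]] = [B, [A, C]]`. -/
theorem commute_commutator {R : Type} [Ring R] {A B C A' B' : R} (hA : A * C - C * A = A')
    (hB : B * C - C * B = B') (h : A * B' - B' * A = B * A' - A' * B) :
    Commute (A * B - B * A) C := by
  have : (A * B - B * A) * C - C * (A * B - B * A) =
      (A * (B * C - C * B) - (B * C - C * B) * A) -
        (B * (A * C - C * A) - (A * C - C * A) * B) := by
    noncomm_ring
  rw [hA, hB, h, sub_self, sub_eq_zero] at this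
  exact this

/-- The Heisenberg relations. The commutator is a scalar by Schur's lemma, which vanishes for
degree reasons unless `m + n = 0`, and is then computed on the vacuum. -/
theorem current_commutator_current {m n : ℤ} (hm : Odd m) (hn : Odd n) :
    current m * current n - current n * current m =
      if m + n = 0 then (n / 2 : ℂ) • 1 else 0 := by
  obtain ⟨c, hc⟩ := exists_scalar_of_commute_phi
    (A := current m * current n - current n * current m) fun q =>
      commute_commutator (current_commutator_phi hm q) (current_commutator_phi hn q) (by
        rw [current_commutator_phi hm, current_commutator_phi hn, sub_right_comm])
  rw [hc]
  split_ifs with h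
  · obtain rfl : m = -n := by omega
    congr 1
    have hv := LinearMap.congr_fun hc vac
    have hinj : Function.Injective fun c : ℂ => c • vac :=
      smul_left_injective ℂ (one_ne_zero : (1 : F) ≠ 0)
    rcases lt_trichotomy n 0 with h0 | rfl | h0
    · have := current_current_neg_vac hm (by omega)
      rw [neg_neg] at this
      rw [LinearMap.sub_apply, Module.End.mul_apply, Module.End.mul_apply, this,
        current_vac (by omega : 0 < -n), map_zero, sub_zero] at hv
      have := hinj hv
      rw [← this]; push_cast; ring
    · exact absurd hn (by decide)
    · have := current_current_neg_vac hn h0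
      rw [LinearMap.sub_apply, Module.End.mul_apply, Module.End.mul_apply, this,
        current_vac h0, map_zero, zero_sub, ← neg_smul] at hv
      have := hinj hv
      rw [← this]; ring
  · have hd : HasDeg (c • 1) (-2 * m + -2 * n) := by
      rw [← hc]
      refine ((current_hasDeg m).mul (current_hasDeg n)).sub ?_
      rw [add_comm]
      exact (current_hasDeg n).mul (current_hasDeg m)
    rw [hd.scalar_eq_zero (by omega), zero_smul]

/-! ### The vertex operators -/

theorem current_commute_of_add_ne_zero {m n : ℤ} (hm : Odd m) (hn : Odd n) (h : m + n ≠ 0) :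
    Commute (current m) (current n) := by
  have := current_commutator_current hm hn
  rwa [if_neg h, sub_eq_zero] at this

theorem odd_neg_natCast {k : ℕ} (h : Odd k) : Odd (-(k : ℤ)) :=
  ((Int.odd_coe_nat k).mpr h).neg

/-- `V_+ = exp (oddLog annihilators)`. -/
def annihilators (k : ℕ) : Module.End ℂ F := current k

/-- `V_- = exp (oddLog creators)`; the sign is that of `2 / k` for negative `k`. -/
def creators (k : ℕ) : Module.End ℂ F := -current (-k)

theorem annihilators_commute (i j : ℕ) (hi : Odd i) (hj : Odd j) :
    Commute (annihilators i) (annihilators j) :=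
  current_commute_of_add_ne_zero ((Int.odd_coe_nat i).mpr hi) ((Int.odd_coe_nat j).mpr hj)
    (by have := hi.pos; omega)

theorem creators_commute (i j : ℕ) (hi : Odd i) (hj : Odd j) :
    Commute (creators i) (creators j) :=
  (current_commute_of_add_ne_zero (odd_neg_natCast hi) (odd_neg_natCast hj)
    (by have := hi.pos; omega)).neg_left.neg_right

theorem Vplus_eq : Vplus = expSeries (oddLog annihilators) := rfl

theorem Vminus_eq : Vminus = expSeries (oddLog creators) := by
  rw [Vminus]
  congr 1
  ext k : 1
  simp only [oddLog, PowerSeries.coeff_mk, creators]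
  split_ifs
  · rw [div_neg, smul_neg]
    exact neg_smul (2 / (k : ℂ)) (current (-k))
  · rfl

theorem inverse_Vplus : Ring.inverse Vplus = expSeries (oddLog (-annihilators)) := by
  rw [Vplus_eq, inverse_expSeries (coeff_zero_oddLog _) (oddLog_commute annihilators_commute),
    neg_oddLog]

theorem inverse_Vminus : Ring.inverse Vminus = expSeries (oddLog (-creators)) := by
  rw [Vminus_eq, inverse_expSeries (coeff_zero_oddLog _) (oddLog_commute creators_commute),
    neg_oddLog]

theorem coeff_inverse_Vplus (m : ℕ) : PowerSeries.coeff m (Ring.inverse Vplus) =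
    (-1 : ℂ) ^ m • PowerSeries.coeff m Vplus := by
  rw [Vplus_eq, inverse_expSeries (coeff_zero_oddLog _) (oddLog_commute annihilators_commute)]
  exact coeff_expSeries_neg_of_odd (coeff_zero_oddLog _) (oddLog_commute annihilators_commute)
    (fun _ => oddLog_eq_zero_of_not_odd _) m

theorem coeff_inverse_Vminus (m : ℕ) : PowerSeries.coeff m (Ring.inverse Vminus) =
    (-1 : ℂ) ^ m • PowerSeries.coeff m Vminus := by
  rw [Vminus_eq, inverse_expSeries (coeff_zero_oddLog _) (oddLog_commute creators_commute)]
  exact coeff_expSeries_neg_of_odd (coeff_zero_oddLog _) (oddLog_commute creators_commute)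
    (fun _ => oddLog_eq_zero_of_not_odd _) m

open Finset.HasAntidiagonal in
theorem hasDeg_coeff_mul {P Q : PowerSeries (Module.End ℂ F)} {c : ℤ}
    (hP : ∀ m : ℕ, HasDeg (PowerSeries.coeff m P) (c * m))
    (hQ : ∀ m : ℕ, HasDeg (PowerSeries.coeff m Q) (c * m)) (m : ℕ) :
    HasDeg (PowerSeries.coeff m (P * Q)) (c * m) := by
  rw [PowerSeries.coeff_mul]
  refine HasDeg.sum _ fun p hp => ?_
  rw [← mem_antidiagonal.mp hp]
  push_cast
  rw [mul_add]
  exact (hP _).mul (hQ _)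

theorem hasDeg_coeff_expSeries {P : PowerSeries (Module.End ℂ F)} {c : ℤ}
    (hP : ∀ m : ℕ, HasDeg (PowerSeries.coeff m P) (c * m)) (m : ℕ) :
    HasDeg (PowerSeries.coeff m (expSeries P)) (c * m) := by
  rw [expSeries, PowerSeries.coeff_mk]
  refine HasDeg.sum _ fun n hn => HasDeg.smul _ ?_
  clear hn
  induction n generalizing m with
  | zero =>
    rw [pow_zero, PowerSeries.coeff_one]
    split_ifs with h
    · subst h
      simpa using HasDeg.one
    · exact HasDeg.zero _
  | succ n ih =>
    rw [pow_succ]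
    exact hasDeg_coeff_mul (fun m => ih m) hP m

theorem hasDeg_oddLog {J : ℕ → Module.End ℂ F} {c : ℤ} (hJ : ∀ k : ℕ, HasDeg (J k) (c * k))
    (m : ℕ) : HasDeg (PowerSeries.coeff m (oddLog J)) (c * m) := by
  rw [oddLog, PowerSeries.coeff_mk]
  split_ifs
  · exact (hJ m).smul _
  · exact HasDeg.zero _

theorem Vplus_hasDeg (m : ℕ) : HasDeg (PowerSeries.coeff m Vplus) (-2 * m) := by
  rw [Vplus_eq]
  exact hasDeg_coeff_expSeries (hasDeg_oddLog fun k => current_hasDeg k) m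

theorem Vminus_hasDeg (m : ℕ) : HasDeg (PowerSeries.coeff m Vminus) (2 * m) := by
  rw [Vminus_eq]
  refine hasDeg_coeff_expSeries (hasDeg_oddLog fun k => ?_) m
  rw [creators, ← neg_one_smul ℂ]
  convert (current_hasDeg (-k)).smul _ using 1
  ring

theorem ofPow_hasDeg {P : PowerSeries (Module.End ℂ F)}
    (h : ∀ m : ℕ, HasDeg (PowerSeries.coeff m P) (2 * m)) (m : ℤ) :
    HasDeg (ofPow P m) (2 * m + 0) := by
  rw [ofPow]
  split_ifs with hm
  · convert h m.toNat using 1; omega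
  · exact HasDeg.zero _

theorem ofPowInv_hasDeg {P : PowerSeries (Module.End ℂ F)}
    (h : ∀ m : ℕ, HasDeg (PowerSeries.coeff m P) (-2 * m)) (m : ℤ) :
    HasDeg (ofPowInv P m) (2 * m + 0) := by
  rw [ofPowInv]
  split_ifs with hm
  · convert h (-m).toNat using 1; omega
  · exact HasDeg.zero _

theorem VplusInv_hasDeg (m : ℤ) : HasDeg (VplusInv m) (2 * m + 0) :=
  ofPowInv_hasDeg (fun m => by
    rw [coeff_inverse_Vplus]
    exact (Vplus_hasDeg m).smul _) m

theorem VminusInv_hasDeg (m : ℤ) : HasDeg (VminusInv m) (2 * m + 0) :=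
  ofPow_hasDeg (fun m => by
    rw [coeff_inverse_Vminus]
    exact (Vminus_hasDeg m).smul _) m

theorem fieldMul_hasDeg {A B : Field F} {s u : ℤ} (hA : ∀ m, HasDeg (A m) (2 * m + s))
    (hB : ∀ m, HasDeg (B m) (2 * m + u)) (m : ℤ) :
    HasDeg (fieldMul A B m) (2 * m + (s + u)) :=
  HasDeg.locSum fun k => by
    convert (hA (m - k)).mul (hB k) using 1
    ring

theorem theta_hasDeg (m : ℤ) : HasDeg (theta m) (2 * m + 1) :=
  fieldMul_hasDeg VminusInv_hasDeg (fieldMul_hasDeg phi_hasDeg VplusInv_hasDeg) m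

theorem lowerTrunc_Vplus : LowerTrunc (ofPowInv Vplus) :=
  lowerTrunc_of_hasDeg (ofPowInv_hasDeg Vplus_hasDeg)

theorem lowerTrunc_VplusInv : LowerTrunc VplusInv := lowerTrunc_of_hasDeg VplusInv_hasDeg

theorem nonposSupp_VplusInv : NonposSupp VplusInv := nonposSupp_ofPowInv _

theorem nonnegSupp_VminusInv : NonnegSupp VminusInv := nonnegSupp_ofPow _

theorem lowerTrunc_theta : LowerTrunc theta := lowerTrunc_of_hasDeg theta_hasDeg

theorem composable_Vplus (A : Field F) : Composable A (ofPowInv Vplus) :=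
  (nonposSupp_ofPowInv _).composable lowerTrunc_Vplus

theorem composable_VplusInv (A : Field F) : Composable A VplusInv :=
  nonposSupp_VplusInv.composable lowerTrunc_VplusInv

theorem composable_Vminus {A : Field F} (hA : LowerTrunc A) : Composable (ofPow Vminus) A :=
  (nonnegSupp_ofPow _).composable hA

theorem composable_VminusInv {A : Field F} (hA : LowerTrunc A) : Composable VminusInv A :=
  nonnegSupp_VminusInv.composable hA

theorem lowerTrunc_mul_Vplus {A : Field F} (hA : LowerTrunc A) :
    LowerTrunc (fieldMul A (ofPowInv Vplus)) :=
  (nonposSupp_ofPowInv _).lowerTrunc_fieldMul lowerTrunc_Vplus hA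

theorem lowerTrunc_mul_VplusInv {A : Field F} (hA : LowerTrunc A) :
    LowerTrunc (fieldMul A VplusInv) :=
  nonposSupp_VplusInv.lowerTrunc_fieldMul lowerTrunc_VplusInv hA

theorem fieldMul_Vplus_VplusInv : fieldMul (ofPowInv Vplus) VplusInv = oneField := by
  rw [VplusInv, ofPowInv_mul _ _ lowerTrunc_VplusInv, Ring.mul_inverse_cancel _ isUnit_Vplus,
    ofPowInv_one]

theorem fieldMul_VplusInv_Vplus : fieldMul VplusInv (ofPowInv Vplus) = oneField := by
  rw [VplusInv, ofPowInv_mul _ _ lowerTrunc_Vplus, Ring.inverse_mul_cancel _ isUnit_Vplus,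
    ofPowInv_one]

theorem fieldMul_Vminus_VminusInv : fieldMul (ofPow Vminus) VminusInv = oneField := by
  rw [VminusInv, ofPow_mul, Ring.mul_inverse_cancel _ isUnit_Vminus, ofPow_one]

theorem fieldMul_VminusInv_Vminus : fieldMul VminusInv (ofPow Vminus) = oneField := by
  rw [VminusInv, ofPow_mul, Ring.inverse_mul_cancel _ isUnit_Vminus, ofPow_one]

/-! ### Dressing by the vertex operators -/

/-- The dressing `V_-(z) A(z) V_+(z)` of a field. -/
def dress (A : Field F) : Field F := fieldMul (ofPow Vminus) (fieldMul A (ofPowInv Vplus))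

/-- Undressing: `V_-(z)⁻¹ A(z) V_+(z)⁻¹`. -/
def undress (A : Field F) : Field F := fieldMul VminusInv (fieldMul A VplusInv)

theorem dress_undress {A : Field F} (hA : LowerTrunc A) : dress (undress A) = A := by
  have hA' := lowerTrunc_mul_VplusInv hA
  rw [dress, undress, ← fieldMul_assoc_mid nonnegSupp_VminusInv hA' (nonposSupp_ofPowInv _)
    lowerTrunc_Vplus, ← fieldMul_assoc_right nonposSupp_VplusInv lowerTrunc_VplusInv
    (nonposSupp_ofPowInv _) lowerTrunc_Vplus, fieldMul_VplusInv_Vplus, fieldMul_oneField,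
    fieldMul_assoc_left (nonnegSupp_ofPow _) nonnegSupp_VminusInv hA
    nonnegSupp_VminusInv.lowerTrunc, fieldMul_Vminus_VminusInv, oneField_fieldMul]

theorem undress_dress {A : Field F} (hA : LowerTrunc A) : undress (dress A) = A := by
  have hA' := lowerTrunc_mul_Vplus hA
  rw [dress, undress, ← fieldMul_assoc_mid (nonnegSupp_ofPow _) hA' nonposSupp_VplusInv
    lowerTrunc_VplusInv, ← fieldMul_assoc_right (nonposSupp_ofPowInv _) lowerTrunc_Vplus
    nonposSupp_VplusInv lowerTrunc_VplusInv, fieldMul_Vplus_VplusInv, fieldMul_oneField,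
    fieldMul_assoc_left nonnegSupp_VminusInv (nonnegSupp_ofPow _) hA
    (nonnegSupp_ofPow _).lowerTrunc, fieldMul_VminusInv_Vminus, oneField_fieldMul]

/-- `φ(z) = V_-(z) θ(z) V_+(z)`. -/
theorem phi_eq_dress_theta : phi = dress theta := (dress_undress phi_lowerTrunc).symm

theorem dress_add {A B : Field F} (hA : LowerTrunc A) (hB : LowerTrunc B) :
    dress (A + B) = dress A + dress B := by
  rw [dress, fieldMul_add_left (composable_Vplus _) (composable_Vplus _),
    fieldMul_add_right (composable_Vminus (lowerTrunc_mul_Vplus hA))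
      (composable_Vminus (lowerTrunc_mul_Vplus hB))]
  rfl

theorem dress_smul {A : Field F} (hA : LowerTrunc A) (c : ℂ) : dress (c • A) = c • dress A := by
  rw [dress, fieldMul_smul_left (composable_Vplus _),
    fieldMul_smul_right (composable_Vminus (lowerTrunc_mul_Vplus hA))]
  rfl

theorem dress_shift {A : Field F} (hA : LowerTrunc A) (n : ℤ) :
    dress (shift n A) = shift n (dress A) := by
  rw [dress, fieldMul_shift_left,
    fieldMul_shift_right (composable_Vminus (lowerTrunc_mul_Vplus hA))]
  rfl

theorem lmul_eq_rmul_ofPow {P : PowerSeries (Module.End ℂ F)} {a : Module.End ℂ F}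
    (h : ∀ m, Commute a (PowerSeries.coeff m P)) : lmul a (ofPow P) = rmul (ofPow P) a := by
  rw [← ofPow_C_mul, ← ofPow_mul_C, (commute_C_iff.mpr h).eq]

theorem lmul_eq_rmul_ofPowInv {P : PowerSeries (Module.End ℂ F)} {a : Module.End ℂ F}
    (h : ∀ m, Commute a (PowerSeries.coeff m P)) :
    lmul a (ofPowInv P) = rmul (ofPowInv P) a := by
  rw [← ofPowInv_C_mul, ← ofPowInv_mul_C, (commute_C_iff.mpr h).eq]

theorem commute_coeff_oddLog {J : ℕ → Module.End ℂ F} {a : Module.End ℂ F}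
    (h : ∀ k, Odd k → Commute a (J k)) (i : ℕ) :
    Commute a (PowerSeries.coeff i (oddLog J)) := by
  rw [oddLog, PowerSeries.coeff_mk]
  split_ifs with hi
  · exact (h i hi).smul_right _
  · exact Commute.zero_right a

theorem commute_coeff_Vplus {a : Module.End ℂ F} (ha : ∀ n, Odd n → Commute a (current n))
    (m : ℕ) : Commute a (PowerSeries.coeff m Vplus) :=
  commute_coeff_expSeries (commute_coeff_oddLog (J := annihilators) fun k hk =>
    ha k ((Int.odd_coe_nat k).mpr hk)) m

theorem commute_coeff_Vminus {a : Module.End ℂ F} (ha : ∀ n, Odd n → Commute a (current n))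
    (m : ℕ) : Commute a (PowerSeries.coeff m Vminus) := by
  rw [Vminus_eq]
  exact commute_coeff_expSeries (commute_coeff_oddLog fun k hk =>
    (ha _ (odd_neg_natCast hk)).neg_right) m

/-- An operator commuting with the currents can be pulled out of a dressed field to the left. -/
theorem lmul_dress {A : Field F} {a : Module.End ℂ F}
    (ha : ∀ n, Odd n → Commute a (current n)) (hA : LowerTrunc A) :
    lmul a (dress A) = dress (lmul a A) := by
  rw [dress, lmul_fieldMul (composable_Vminus (lowerTrunc_mul_Vplus hA)),
    lmul_eq_rmul_ofPow (commute_coeff_Vminus ha), fieldMul_rmul_left,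
    lmul_fieldMul (composable_Vplus _)]
  rfl

/-- An operator commuting with the currents can be pulled out of a dressed field to the
right. -/
theorem rmul_dress {A : Field F} {a : Module.End ℂ F}
    (ha : ∀ n, Odd n → Commute a (current n)) (hA : LowerTrunc A) :
    rmul (dress A) a = dress (rmul A a) := by
  rw [dress, rmul_fieldMul (composable_Vminus (lowerTrunc_mul_Vplus hA)),
    rmul_fieldMul (composable_Vplus _), ← lmul_eq_rmul_ofPowInv (commute_coeff_Vplus ha),
    ← fieldMul_rmul_left]
  rfl

/-! ### The field `θ` commutes with the currents -/

theorem commutator_oddLog {J : ℕ → Module.End ℂ F} {a : Module.End ℂ F} {n : ℕ} (hn : Odd n)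
    {c : ℂ} (h : ∀ k, Odd k → a * J k - J k * a = if k = n then (c * (n / 2)) • 1 else 0) :
    PowerSeries.C a * oddLog J - oddLog J * PowerSeries.C a =
      c • (PowerSeries.X : PowerSeries (Module.End ℂ F)) ^ n := by
  ext k : 1
  rw [map_sub, PowerSeries.coeff_C_mul, PowerSeries.coeff_mul_C, PowerSeries.coeff_smul,
    PowerSeries.coeff_X_pow, oddLog, PowerSeries.coeff_mk]
  by_cases hk : Odd k
  · have hk0 : (k : ℂ) ≠ 0 := by exact_mod_cast hk.pos.ne'
    rw [if_pos hk, mul_smul_comm, smul_mul_assoc, ← smul_sub, h k hk]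
    split_ifs with hkn
    · subst hkn
      rw [smul_smul]
      congr 1
      field_simp
    · simp
  · have hkn : k ≠ n := fun h => hk (h ▸ hn)
    simp [hk, hkn]

theorem commutator_expSeries_oddLog {J : ℕ → Module.End ℂ F}
    (hJ : ∀ i j, Odd i → Odd j → Commute (J i) (J j)) {a : Module.End ℂ F} {n : ℕ} (hn : Odd n)
    {c : ℂ} (h : ∀ k, Odd k → a * J k - J k * a = if k = n then (c * (n / 2)) • 1 else 0) :
    PowerSeries.C a * expSeries (oddLog J) - expSeries (oddLog J) * PowerSeries.C a =
      c • (PowerSeries.X ^ n * expSeries (oddLog J)) := by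
  rw [commutator_expSeries (coeff_zero_oddLog J) (oddLog_commute hJ) (commutator_oddLog hn h),
    smul_mul_assoc]
  exact fun P => ((PowerSeries.commute_X_pow P n).symm).smul_left c

theorem lmul_ofPow_of_commutator {P Z : PowerSeries (Module.End ℂ F)} {a : Module.End ℂ F}
    (h : PowerSeries.C a * P - P * PowerSeries.C a = Z) :
    lmul a (ofPow P) = rmul (ofPow P) a + ofPow Z := by
  rw [← ofPow_C_mul, ← ofPow_mul_C, ← ofPow_add, ← h, add_sub_cancel]

theorem lmul_ofPowInv_of_commutator {P Z : PowerSeries (Module.End ℂ F)} {a : Module.End ℂ F}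
    (h : PowerSeries.C a * P - P * PowerSeries.C a = Z) :
    lmul a (ofPowInv P) = rmul (ofPowInv P) a + ofPowInv Z := by
  rw [← ofPowInv_C_mul, ← ofPowInv_mul_C, ← ofPowInv_add, ← h, add_sub_cancel]

/-- The current `J_n` has the commutator `-z^n` with exactly one of the exponents of
`V_-(z)⁻¹` and `V_+(z)⁻¹`, according to the sign of `n`. -/
theorem lmul_current_vertexInv {n : ℤ} (hn : Odd n) :
    ∃ c d : ℂ, c + d = -1 ∧
      lmul (current n) VminusInv = rmul VminusInv (current n) + c • shift n VminusInv ∧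
      lmul (current n) VplusInv = rmul VplusInv (current n) + d • shift n VplusInv := by
  have hmC : ∀ i j, Odd i → Odd j → Commute ((-creators) i) ((-creators) j) := fun i j hi hj =>
    (creators_commute i j hi hj).neg_left.neg_right
  have hpC : ∀ i j, Odd i → Odd j → Commute ((-annihilators) i) ((-annihilators) j) :=
    fun i j hi hj => (annihilators_commute i j hi hj).neg_left.neg_right
  rcases lt_or_ge 0 n with h0 | h0
  · obtain ⟨k, rfl⟩ : ∃ k : ℕ, n = k := ⟨n.toNat, by omega⟩
    have hk : Odd k := (Int.odd_coe_nat k).mp hn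
    refine ⟨-1, 0, by ring, ?_, ?_⟩
    · have h := commutator_expSeries_oddLog hmC (a := current k) hk (c := -1) fun j hj => by
        have := current_commutator_current hn (odd_neg_natCast hj)
        rw [Pi.neg_apply, creators, neg_neg, this]
        by_cases hjk : j = k
        · subst hjk
          rw [if_pos (by ring), if_pos rfl]
          congr 1
          push_cast; ring
        · rw [if_neg (by omega), if_neg hjk]
      rw [VminusInv, inverse_Vminus, lmul_ofPow_of_commutator h, ofPow_smul, ofPow_X_pow_mul]
    · rw [zero_smul, add_zero, VplusInv, inverse_Vplus]
      refine lmul_eq_rmul_ofPowInv fun m => commute_coeff_expSeries (commute_coeff_oddLog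
        fun j hj => ?_) m
      have := hj.pos
      exact (current_commute_of_add_ne_zero hn ((Int.odd_coe_nat j).mpr hj)
        (by omega)).neg_right
  · obtain ⟨k, rfl⟩ : ∃ k : ℕ, n = -k := ⟨(-n).toNat, by omega⟩
    have hk : Odd k := by
      have := hn.neg
      rw [neg_neg] at this
      exact (Int.odd_coe_nat k).mp this
    refine ⟨0, -1, by ring, ?_, ?_⟩
    · rw [zero_smul, add_zero, VminusInv, inverse_Vminus]
      refine lmul_eq_rmul_ofPow fun m => commute_coeff_expSeries (commute_coeff_oddLog
        fun j hj => ?_) m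
      have := hj.pos
      rw [Pi.neg_apply, creators, neg_neg]
      exact current_commute_of_add_ne_zero hn (odd_neg_natCast hj) (by omega)
    · have h := commutator_expSeries_oddLog hpC (a := current (-k)) hk (c := -1) fun j hj => by
        have := current_commutator_current hn ((Int.odd_coe_nat j).mpr hj)
        refine (commutator_neg (current (-k)) (current j)).trans ?_
        rw [this]
        by_cases hjk : j = k
        · subst hjk
          rw [if_pos (by ring), if_pos rfl]
          refine (neg_smul _ _).symm.trans ?_
          congr 1
          push_cast; ring
        · rw [if_neg (by omega), if_neg hjk, neg_zero]
      rw [VplusInv, inverse_Vplus, lmul_ofPowInv_of_commutator h, ofPowInv_smul,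
        ofPowInv_X_pow_mul]

/-- `[J_n, θ(z)] = 0`: the contribution `z^n` of `φ(z)` is cancelled by that of
`V_-(z)⁻¹` or `V_+(z)⁻¹`. -/
theorem lmul_current_theta {n : ℤ} (hn : Odd n) :
    lmul (current n) theta = rmul theta (current n) := by
  obtain ⟨c, d, hcd, hW, hU⟩ := lmul_current_vertexInv hn
  have hphi : lmul (current n) phi = rmul phi (current n) + shift n phi := by
    funext m
    rw [Pi.add_apply, lmul, rmul, shift, ← current_commutator_phi hn, add_sub_cancel]
  have hY := lowerTrunc_mul_VplusInv phi_lowerTrunc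
  have h1 := lmul_fieldMul_of_commutator (composable_VplusInv phi)
    (composable_VplusInv (shift n phi))
    (((composable_VplusInv phi).shift_right n).smul_right d) hphi hU
  rw [fieldMul_shift_left, fieldMul_smul_right ((composable_VplusInv phi).shift_right n),
    fieldMul_shift_right (composable_VplusInv phi)] at h1
  have hc := composable_VminusInv hY
  have hcs := hc.shift_right n
  have h2 := lmul_fieldMul_of_commutator hc ((hc.shift_left n).smul_left c)
    (composable_VminusInv ((hY.shift n).add ((hY.shift n).smul d))) hW h1
  rw [fieldMul_smul_left (hc.shift_left n), fieldMul_shift_left,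
    fieldMul_add_right hcs (hcs.smul_right d), fieldMul_smul_right hcs,
    fieldMul_shift_right hc] at h2
  rw [theta, h2]
  have : ∀ A : Field F, c • A + (A + d • A) = (0 : Field F) := fun A => by
    have : c • A + (A + d • A) = (c + d + 1) • A := by module
    rw [this, hcd]
    simp
  rw [this, add_zero]

theorem current_commute_theta {n : ℤ} (hn : Odd n) (m : ℤ) : Commute (current n) (theta m) :=
  congrFun (lmul_current_theta hn) m

/-! ### The anticommutators of `θ` -/

/-- `(z + y) V_+(z)⁻¹ φ(y) = (z - y) φ(y) V_+(z)⁻¹`, for the coefficient of `y ^ q`. -/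
theorem VplusInv_exchange (q : ℤ) :
    shift 1 (rmul VplusInv (phi q)) + rmul VplusInv (phi (q - 1)) =
      shift 1 (lmul (phi q) VplusInv) - lmul (phi (q - 1)) VplusInv := by
  have h := expSeries_neg_oddLog_exchange (J := annihilators) (A := phi) annihilators_commute
    (fun k q hk => current_commutator_phi ((Int.odd_coe_nat k).mpr hk) q) q
  have h' := congrArg ofPowInv h
  rw [← inverse_Vplus, ofPowInv_sub, ofPowInv_add, ofPowInv_X_mul, ofPowInv_X_mul,
    ofPowInv_C_mul, ofPowInv_mul_C, ofPowInv_C_mul, ofPowInv_mul_C] at h'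
  funext m
  have hm := congrFun h' (m - 1)
  simp only [Pi.sub_apply, Pi.add_apply, shift, sub_neg_eq_add, sub_add_cancel] at hm ⊢
  exact hm

/-- `(z + y) φ(y) V_-(z)⁻¹ = (y - z) V_-(z)⁻¹ φ(y)`, for the coefficient of `y ^ q`. -/
theorem VminusInv_exchange (q : ℤ) :
    shift 1 (lmul (phi q) VminusInv) + lmul (phi (q - 1)) VminusInv =
      rmul VminusInv (phi (q - 1)) - shift 1 (rmul VminusInv (phi q)) := by
  -- `V_-(z)⁻¹` is a series in `z`, so the exchange relation is used with `y⁻¹` in place of `y`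
  have h := expSeries_oddLog_exchange (J := -creators) (A := fun q => phi (-q))
    (fun i j hi hj => (creators_commute i j hi hj).neg_left.neg_right)
    (fun k q hk => by
      have := current_commutator_phi (odd_neg_natCast hk) (-q)
      rw [Pi.neg_apply, creators, neg_neg, this]
      congr 1; ring) (1 - q)
  have h' := congrArg ofPow h
  rw [← inverse_Vminus, ofPow_sub, ofPow_add, ofPow_X_mul, ofPow_X_mul,
    ofPow_C_mul, ofPow_mul_C, ofPow_C_mul, ofPow_mul_C] at h'
  rw [show -(1 - q) = q - 1 by ring, show -(1 - q - 1) = q by ring] at h'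
  rw [add_comm]
  exact h'.symm

theorem phi_commutator_field (q : ℤ) :
    rmul phi (phi q) = lmul (phi q) phi + (-1 : ℂ) ^ q • shift (-1 - q) oneField := by
  funext m
  have h := phi_comm m q
  rw [Pi.add_apply, rmul, lmul, ← sub_eq_iff_eq_add', h]
  simp only [Pi.smul_apply, shift, oneField]
  split_ifs <;> first | rfl | omega | simp

/-- `(z + y) (θ(z) φ(y) + φ(y) θ(z)) = 2 z δ(z + y) V_-(z)⁻¹ V_+(z)⁻¹`, for the coefficient
of `y ^ q`. -/
theorem theta_phi_anticomm (q : ℤ) :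
    shift 1 (rmul theta (phi q) + lmul (phi q) theta) +
        (rmul theta (phi (q - 1)) + lmul (phi (q - 1)) theta) =
      (2 * (-1 : ℂ) ^ q) • shift (-q) (fieldMul VminusInv VplusInv) := by
  set Y := fieldMul phi VplusInv with hY
  have hYt : LowerTrunc Y := lowerTrunc_mul_VplusInv phi_lowerTrunc
  have hth : theta = fieldMul VminusInv Y := rfl
  have hWY := composable_VminusInv hYt
  have hl : ∀ a, LowerTrunc (lmul a Y) := fun a => hYt.lmul a
  have hr : ∀ a, LowerTrunc (rmul Y a) := fun a => hYt.rmul a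
  have hUt := lowerTrunc_VplusInv
  -- moving `φ(y)` to the left of `V_+(z)⁻¹`
  have hA : shift 1 (rmul Y (phi q)) + rmul Y (phi (q - 1)) =
      shift 1 (lmul (phi q) Y) - lmul (phi (q - 1)) Y +
        (2 * (-1 : ℂ) ^ q) • shift (-q) VplusInv := by
    have hc : ∀ a, Composable phi (rmul VplusInv a) := fun a => (composable_VplusInv phi).rmul a
    have hphiU : ∀ r, fieldMul phi (lmul (phi r) VplusInv) =
        lmul (phi r) Y + (-1 : ℂ) ^ r • shift (-1 - r) VplusInv := fun r => by
      rw [← fieldMul_rmul_left, phi_commutator_field,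
        fieldMul_add_left (composable_VplusInv _) (composable_VplusInv _),
        fieldMul_smul_left (composable_VplusInv _), fieldMul_shift_left, oneField_fieldMul,
        lmul_fieldMul (composable_VplusInv phi)]
    have hlc : ∀ r, Composable phi (lmul (phi r) VplusInv) := fun r m v =>
      composable_VplusInv (rmul phi (phi r)) m v
    have e1 : shift 1 (rmul Y (phi q)) + rmul Y (phi (q - 1)) =
        fieldMul phi (shift 1 (rmul VplusInv (phi q)) + rmul VplusInv (phi (q - 1))) := by
      rw [fieldMul_add_right ((hc _).shift_right 1) (hc _), fieldMul_shift_right (hc _),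
        ← rmul_fieldMul (composable_VplusInv phi), ← rmul_fieldMul (composable_VplusInv phi)]
    have e2 : fieldMul phi (shift 1 (lmul (phi q) VplusInv) - lmul (phi (q - 1)) VplusInv) =
        shift 1 (fieldMul phi (lmul (phi q) VplusInv)) -
          fieldMul phi (lmul (phi (q - 1)) VplusInv) := by
      rw [fieldMul_sub_right ((hlc _).shift_right 1) (hlc _), fieldMul_shift_right (hlc _)]
    rw [e1, VplusInv_exchange, e2, hphiU, hphiU]
    funext m
    simp only [Pi.sub_apply, Pi.add_apply, Pi.smul_apply, shift,
      zpow_sub_one₀ (show (-1 : ℂ) ≠ 0 by norm_num)]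
    rw [show m - 1 - (-1 - q) = m - -q by ring, show m - (-1 - (q - 1)) = m - -q by ring]
    module
  -- moving `φ(y)` to the right of `V_-(z)⁻¹`
  have hB : shift 1 (lmul (phi q) theta) + lmul (phi (q - 1)) theta =
      fieldMul VminusInv (lmul (phi (q - 1)) Y) -
        shift 1 (fieldMul VminusInv (lmul (phi q) Y)) := by
    have hc : ∀ r, Composable (lmul (phi r) VminusInv) Y := fun r => hWY.lmul _
    have e1 : shift 1 (lmul (phi q) theta) + lmul (phi (q - 1)) theta =
        fieldMul (shift 1 (lmul (phi q) VminusInv) + lmul (phi (q - 1)) VminusInv) Y := by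
      rw [fieldMul_add_left ((hc _).shift_left 1) (hc _), fieldMul_shift_left,
        ← lmul_fieldMul hWY, ← lmul_fieldMul hWY, ← hth]
    have hcr : ∀ r, Composable (rmul VminusInv (phi r)) Y := fun r m v =>
      composable_VminusInv (hl (phi r)) m v
    rw [e1, VminusInv_exchange, fieldMul_sub_left (hcr _) ((hcr _).shift_left 1),
      fieldMul_shift_left, fieldMul_rmul_left, fieldMul_rmul_left]
  have hC : shift 1 (rmul theta (phi q)) + rmul theta (phi (q - 1)) =
      shift 1 (fieldMul VminusInv (lmul (phi q) Y)) -
        fieldMul VminusInv (lmul (phi (q - 1)) Y) +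
        (2 * (-1 : ℂ) ^ q) • shift (-q) (fieldMul VminusInv VplusInv) := by
    have e1 : shift 1 (rmul theta (phi q)) + rmul theta (phi (q - 1)) =
        fieldMul VminusInv (shift 1 (rmul Y (phi q)) + rmul Y (phi (q - 1))) := by
      rw [fieldMul_add_right (composable_VminusInv ((hr _).shift 1)) (composable_VminusInv (hr _)),
        fieldMul_shift_right (composable_VminusInv (hr _)), ← rmul_fieldMul hWY,
        ← rmul_fieldMul hWY, ← hth]
    have hl1 := composable_VminusInv ((hl (phi q)).shift 1)
    have hl2 := composable_VminusInv (hl (phi (q - 1)))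
    have hU1 := composable_VminusInv hUt
    rw [e1, hA, fieldMul_add_right
        (composable_VminusInv (((hl (phi q)).shift 1).sub (hl (phi (q - 1)))))
        ((hU1.shift_right _).smul_right _),
      fieldMul_smul_right (hU1.shift_right _), fieldMul_shift_right hU1,
      fieldMul_sub_right hl1 hl2, fieldMul_shift_right (composable_VminusInv (hl (phi q)))]
  have hs : shift 1 (rmul theta (phi q) + lmul (phi q) theta) +
        (rmul theta (phi (q - 1)) + lmul (phi (q - 1)) theta) =
      (shift 1 (rmul theta (phi q)) + rmul theta (phi (q - 1))) +
        (shift 1 (lmul (phi q) theta) + lmul (phi (q - 1)) theta) := by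
    funext m
    simp only [Pi.add_apply, shift]
    abel
  rw [hs, hC, hB]
  abel

/-- `V_-(z)⁻¹ V_+(z)⁻¹ = V_-(-z) V_+(-z)`. -/
theorem fieldMul_VminusInv_VplusInv (m : ℤ) :
    fieldMul VminusInv VplusInv m = (-1 : ℂ) ^ m • dress oneField m := by
  have hd : dress oneField = fieldMul (ofPow Vminus) (ofPowInv Vplus) := by
    rw [dress, oneField_fieldMul]
  have hW : ∀ j, VminusInv j = (-1 : ℂ) ^ j • ofPow Vminus j := fun j => by
    rw [VminusInv, ofPow, ofPow]
    split_ifs with hj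
    · rw [coeff_inverse_Vminus, ← zpow_natCast, Int.toNat_of_nonneg hj]
    · simp
  have hU : ∀ j, VplusInv j = (-1 : ℂ) ^ j • ofPowInv Vplus j := fun j => by
    rw [VplusInv, ofPowInv, ofPowInv]
    split_ifs with hj
    · rw [coeff_inverse_Vplus, ← zpow_natCast, Int.toNat_of_nonneg (by omega), neg_one_zpow_neg]
    · simp
  have hc := composable_Vplus (ofPow Vminus)
  refine LinearMap.ext fun v => ?_
  rw [fieldMul_apply (composable_VplusInv _), hd, LinearMap.smul_apply, fieldMul_apply hc,
    smul_finsum' _ (hc.finite m v)]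
  refine finsum_congr fun k => ?_
  rw [hW, hU, LinearMap.smul_apply, LinearMap.smul_apply, map_smul, smul_smul, ← zpow_add₀
    (by norm_num), sub_add_cancel]

/-- `{θ_p, θ(y)}`. -/
def thetaAnti (p : ℤ) : Field F := lmul (theta p) theta + rmul theta (theta p)

theorem lowerTrunc_thetaAnti (p : ℤ) : LowerTrunc (thetaAnti p) :=
  (lowerTrunc_theta.lmul _).add (lowerTrunc_theta.rmul _)

/-- `V_-(y) {θ_p, θ(y)} V_+(y) = {θ_p, φ(y)}`, as `θ_p` commutes with the currents. -/
theorem dress_thetaAnti (p : ℤ) :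
    dress (thetaAnti p) = lmul (theta p) phi + rmul phi (theta p) := by
  have hc : ∀ n, Odd n → Commute (theta p) (current n) := fun n hn =>
    (current_commute_theta hn p).symm
  rw [thetaAnti, dress_add (lowerTrunc_theta.lmul _) (lowerTrunc_theta.rmul _),
    ← lmul_dress hc lowerTrunc_theta, ← rmul_dress hc lowerTrunc_theta, ← phi_eq_dress_theta]

/-- `(z + y) {θ(z), θ(y)} = 2 z δ(z + y)`. After dressing in the variable `y` this is the relation
for `{θ(z), φ(y)}`, whose right hand side is supported at `y = -z`, where `V_-(z)⁻¹ V_+(z)⁻¹`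
becomes `V_-(y) V_+(y)`. -/
theorem thetaAnti_rec (p : ℤ) :
    thetaAnti (p - 1) + shift 1 (thetaAnti p) = (2 * (-1 : ℂ) ^ p) • shift (-p) oneField := by
  have hL := (lowerTrunc_thetaAnti (p - 1)).add ((lowerTrunc_thetaAnti p).shift 1)
  have h1 := (lowerTrunc_oneField (M := F)).shift (-p)
  rw [← undress_dress hL, ← undress_dress (h1.smul (2 * (-1 : ℂ) ^ p))]
  congr 1
  rw [dress_add (lowerTrunc_thetaAnti _) ((lowerTrunc_thetaAnti p).shift 1),
    dress_shift (lowerTrunc_thetaAnti p), dress_smul h1, dress_shift lowerTrunc_oneField,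
    dress_thetaAnti, dress_thetaAnti]
  funext q
  have h := congrFun (theta_phi_anticomm q) p
  simp only [Pi.add_apply, Pi.smul_apply, shift, lmul, rmul] at h ⊢
  rw [h, fieldMul_VminusInv_VplusInv, smul_smul, show p - -q = q - -p by ring]
  congr 1
  rw [show q - -p = p + q by ring, zpow_add₀ (by norm_num)]
  linear_combination (2 * (-1 : ℂ) ^ p) * neg_one_zpow_mul_self q

/-- An operator that commutes with the currents and with `θ` commutes with `φ = V_- θ V_+`. -/
theorem commute_phi_of_commute {a : Module.End ℂ F} (ha : ∀ n, Odd n → Commute a (current n))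
    (hth : ∀ m, Commute a (theta m)) (m : ℤ) : Commute a (phi m) := by
  have h : lmul a theta = rmul theta a := funext hth
  have : lmul a phi = rmul phi a := by
    rw [phi_eq_dress_theta, lmul_dress ha lowerTrunc_theta, h, rmul_dress ha lowerTrunc_theta]
  exact congrFun this m

theorem super_jacobi {R : Type} [Ring R] (x y z : R) :
    ((x * y + y * x) * z - z * (x * y + y * x)) +
      ((y * z + z * y) * x - x * (y * z + z * y)) +
      ((z * x + x * z) * y - y * (z * x + x * z)) = 0 := by
  noncomm_ring

/-- The anticommutation relations of the modes of `θ`. The recursion `thetaAnti_rec` leaves one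
unknown operator on each antidiagonal `p + q = N`. -/
theorem theta_anticomm (p q : ℤ) :
    theta p * theta q + theta q * theta p =
      if p + q = -1 then ((-1 : ℂ) ^ q * (2 * q + 1)) • 1 else 0 := by
  set a : ℤ → ℤ → Module.End ℂ F := fun p q => theta p * theta q + theta q * theta p with ha
  have hsymm : ∀ p q, a p q = a q p := fun p q => add_comm _ _
  have hrec : ∀ p q, a (p - 1) q + a p (q - 1) =
      if p + q = 0 then (2 * (-1 : ℂ) ^ p) • 1 else 0 := fun p q => by
    have h := congrFun (thetaAnti_rec p) q
    simp only [thetaAnti, Pi.add_apply, Pi.smul_apply, shift, lmul, rmul, oneField] at h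
    rw [ha]
    simp only
    rw [h]
    split_ifs <;> first | rfl | omega | simp
  have hlin := antidiagonal_rec hrec
  have hval : ∀ p q, a p q = (-1 : ℂ) ^ p • (a 0 (p + q) +
      (if p + q = -1 then (2 * p : ℂ) • 1 else 0)) := fun p q => by
    rw [← hlin, smul_smul, neg_one_zpow_mul_self, one_smul, add_sub_cancel_left]
  -- symmetry fixes the constant if `p + q` is odd
  have hodd : ∀ p q, Odd (p + q) →
      a p q = if p + q = -1 then ((-1 : ℂ) ^ q * (2 * q + 1)) • 1 else 0 := by
    intro p q hN
    have h1 := hval p q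
    have h2 := hval q p
    have hs : (-1 : ℂ) ^ q = -(-1 : ℂ) ^ p := by
      have := hN.neg_one_zpow (α := ℂ)
      rw [zpow_add₀ (by norm_num)] at this
      linear_combination (-1 : ℂ) ^ p * this - (-1 : ℂ) ^ q * neg_one_zpow_mul_self p
    rw [add_comm q p, hs] at h2
    rw [hs]
    have h3 : a p q = (1 / 2 : ℂ) • (a p q + a q p) := by
      rw [hsymm q p]; module
    rw [h3, h1, h2]
    split_ifs with h
    · have hp : (p : ℂ) = -1 - q := by
        have : (p : ℤ) = -1 - q := by omega
        rw [this]; push_cast; ring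
      rw [hp]
      module
    · module
  by_cases hN : Odd (p + q)
  · exact hodd p q hN
  have hne : p + q ≠ -1 := fun h => hN (by rw [h]; decide)
  rw [if_neg hne]
  -- if `p + q` is even, the constant commutes with all the modes of `θ` by the Jacobi identity
  have hthc : ∀ r, Commute (a 0 (p + q)) (theta r) := by
    intro r
    -- with these three modes the other two anticommutators lie on the odd antidiagonals
    -- `p + q - 1` and `2 r + 1`, so they are scalars
    have hj := super_jacobi (theta (r + 1)) (theta (p + q - (r + 1))) (theta r)
    have hs : ∀ x y z, Odd (x + y) → a x y * theta z - theta z * a x y = 0 := fun x y z h => by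
      rw [hodd x y h]
      split_ifs <;> simp
    have hN' : Even (p + q) := Int.not_odd_iff_even.mp hN
    have e1 := hs (p + q - (r + 1)) r (r + 1) (by
      rw [show p + q - (r + 1) + r = p + q + (-1) by ring]
      exact hN'.add_odd (by decide))
    have e2 := hs r (r + 1) (p + q - (r + 1)) ⟨r, by ring⟩
    simp only [ha] at e1 e2
    rw [e1, e2, add_zero, add_zero] at hj
    have hb : a (r + 1) (p + q - (r + 1)) * theta r - theta r * a (r + 1) (p + q - (r + 1)) = 0 :=
      hj
    have hv := hlin (p + q) (r + 1)
    rw [if_neg hne, add_zero] at hv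
    rw [← hv]
    exact Commute.smul_left (sub_eq_zero.mp hb) _
  have hcur : ∀ n, Odd n → Commute (a 0 (p + q)) (current n) := fun n hn => by
    have h0 := (current_commute_theta hn 0).symm
    have h1 := (current_commute_theta hn (p + q)).symm
    exact (h0.mul_left h1).add_left (h1.mul_left h0)
  obtain ⟨c, hc⟩ := exists_scalar_of_commute_phi (commute_phi_of_commute hcur hthc)
  have hd : HasDeg (a 0 (p + q)) (2 * (p + q) + 2) := by
    refine HasDeg.add ?_ ?_
    · convert (theta_hasDeg 0).mul (theta_hasDeg (p + q)) using 1; ring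
    · convert (theta_hasDeg (p + q)).mul (theta_hasDeg 0) using 1; ring
  rw [hc] at hd
  have h0 : a 0 (p + q) = 0 := by
    rw [hc, hd.scalar_eq_zero (by omega), zero_smul]
  have := hval p q
  rw [h0, if_neg hne, add_zero, smul_zero] at this
  exact this

/-! ### Supercommutation relations -/

theorem J_half (k : ℤ) : J (.half k) = (1 / 2 : ℂ) • theta (-k - 1) := rfl

theorem odd_two_mul_add_one (k : ℤ) : Odd (2 * k + 1) := ⟨k, rfl⟩

theorem supercommutator_half {R : Type} [Ring R] [Algebra ℂ R] (x y : R) :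
    ((1 / 2 : ℂ) • x) * ((1 / 2 : ℂ) • y) -
      (-1 : ℂ) ^ (1 * 1) • (((1 / 2 : ℂ) • y) * ((1 / 2 : ℂ) • x)) =
      (1 / 4 : ℂ) • (x * y + y * x) := by
  simp only [smul_mul_assoc, mul_smul_comm]
  module

theorem J_int_commute_half (k l : ℤ) : Commute (J (.int k)) (J (.half l)) :=
  (current_commute_theta (odd_two_mul_add_one k) (-l - 1)).smul_right _

theorem int_val_ne_neg_half_val (k l : ℤ) : (Idx.int k).val ≠ -(Idx.half l).val := fun h => by
  simp only [Idx.val] at h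
  have : ((4 * k + 2 * l + 3 : ℤ) : ℚ) = 0 := by push_cast; linarith
  have := Int.cast_eq_zero.mp this
  omega

theorem superComm_eq (i j : Idx) :
    superComm i j = if i.val = -j.val then
      ((j.val : ℂ) / 2 * (-1 : ℂ) ^ ⌊j.val - 1 / 2⌋) • (1 : Module.End ℂ F) else 0 := by
  have hf1 : ∀ l : ℤ, ⌊(2 * (l : ℚ) + 1) - 1 / 2⌋ = 2 * l := fun l => by
    rw [Int.floor_eq_iff]; push_cast; constructor <;> linarith
  have hf2 : ∀ l : ℤ, ⌊((l : ℚ) + 1 / 2) - 1 / 2⌋ = l := fun l => by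
    rw [add_sub_cancel_right, Int.floor_intCast]
  rcases i with k | k <;> rcases j with l | l
  · have h := current_commutator_current (odd_two_mul_add_one k) (odd_two_mul_add_one l)
    have e : superComm (.int k) (.int l) =
        current (2 * k + 1) * current (2 * l + 1) - current (2 * l + 1) * current (2 * k + 1) := by
      simp [superComm, Idx.parity, J]
    have hiff : (Idx.int k).val = -(Idx.int l).val ↔ 2 * k + 1 + (2 * l + 1) = 0 := by
      simp only [Idx.val]
      rw [← Int.cast_inj (α := ℚ)]
      push_cast
      constructor <;> intro h <;> linarith
    rw [e, h]
    simp only [hiff]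
    split_ifs
    · congr 1
      simp only [Idx.val, hf1]
      rw [zpow_mul]
      push_cast
      norm_num
    · rfl
  · rw [if_neg (int_val_ne_neg_half_val k l), superComm, (J_int_commute_half k l).eq]
    simp [Idx.parity]
  · rw [if_neg fun h => int_val_ne_neg_half_val l k (by rw [h, neg_neg]), superComm,
      (J_int_commute_half l k).eq]
    simp [Idx.parity]
  · have h := theta_anticomm (-k - 1) (-l - 1)
    have e : superComm (.half k) (.half l) = (1 / 4 : ℂ) •
        (theta (-k - 1) * theta (-l - 1) + theta (-l - 1) * theta (-k - 1)) := by
      simp only [superComm, Idx.parity, J_half]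
      exact supercommutator_half (theta (-k - 1)) (theta (-l - 1))
    have hiff : (Idx.half k).val = -(Idx.half l).val ↔ -k - 1 + (-l - 1) = -1 := by
      simp only [Idx.val]
      rw [← Int.cast_inj (α := ℚ)]
      push_cast
      constructor <;> intro h <;> linarith
    rw [e, h]
    by_cases hkl : -k - 1 + (-l - 1) = -1
    · have hc : (1 / 4 : ℂ) * ((-1 : ℂ) ^ (-l - 1) * (2 * ((-l - 1 : ℤ) : ℂ) + 1)) =
          ((Idx.half l).val : ℂ) / 2 * (-1 : ℂ) ^ ⌊(Idx.half l).val - 1 / 2⌋ := by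
        simp only [Idx.val, hf2]
        rw [show -l - 1 = -(l + 1) by ring, neg_one_zpow_neg, zpow_add_one₀ (by norm_num)]
        push_cast
        ring
      rw [if_pos hkl, if_pos (hiff.mpr hkl), ← hc, smul_smul]
    · rw [if_neg hkl, if_neg (mt hiff.mp hkl), smul_zero]

/-- The constant `c_j` in `σ J_{-j} σ⁻¹ = c_j t_j`. -/
def creationCoeff (j : TIdx) : ℂ := (-1 : ℂ) ^ ⌊1 / 2 - j.pos.val⌋ * ((j.pos.val : ℂ) / 2)

theorem TIdx.pos_val_pos (j : TIdx) : 0 < j.pos.val := by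
  rcases j with k | k <;> simp only [TIdx.pos, Idx.val] <;> positivity

theorem TIdx.neg_val (j : TIdx) : j.neg.val = -j.pos.val := by
  rcases j with k | k <;> simp only [TIdx.pos, TIdx.neg, Idx.val] <;> push_cast <;> ring

theorem TIdx.neg_parity (j : TIdx) : j.neg.parity = j.pos.parity := by
  rcases j with k | k <;> rfl

theorem TIdx.pos_val_injective {i j : TIdx} (h : i.pos.val = j.pos.val) : i = j := by
  rcases i with a | a <;> rcases j with b | b <;> simp only [TIdx.pos, Idx.val] at h
  · congr 1
    have : (a : ℚ) = b := by push_cast at h; linarith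
    exact_mod_cast this
  · have : ((4 * a + 1 : ℤ) : ℚ) = ((2 * b : ℤ) : ℚ) := by push_cast at h ⊢; linarith
    have := Int.cast_inj.mp this
    omega
  · have : ((4 * b + 1 : ℤ) : ℚ) = ((2 * a : ℤ) : ℚ) := by push_cast at h ⊢; linarith
    have := Int.cast_inj.mp this
    omega
  · congr 1
    have : (a : ℚ) = b := by push_cast at h; linarith
    exact_mod_cast this

theorem creationCoeff_ne_zero (j : TIdx) : creationCoeff j ≠ 0 := by
  refine mul_ne_zero (zpow_ne_zero _ (by norm_num)) (div_ne_zero ?_ two_ne_zero)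
  exact_mod_cast j.pos_val_pos.ne'

/-- The creation operator corresponding to `t_j`. -/
def create (j : TIdx) : Module.End ℂ F := (creationCoeff j)⁻¹ • J j.neg

theorem J_neg_eq (j : TIdx) : J j.neg = creationCoeff j • create j := by
  rw [create, smul_smul, mul_inv_cancel₀ (creationCoeff_ne_zero j), one_smul]

theorem superComm_pos_neg (i j : TIdx) : superComm i.pos j.neg =
    (open Classical in if i = j then creationCoeff j • 1 else 0) := by
  classical
  rw [superComm_eq, TIdx.neg_val, neg_neg]
  by_cases h : i = j
  · subst h
    rw [if_pos rfl, if_pos rfl, creationCoeff]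
    congr 1
    rw [show -i.pos.val - 1 / 2 = 1 / 2 - i.pos.val - 1 by ring, Int.floor_sub_one,
      zpow_sub_one₀ (by norm_num)]
    push_cast
    ring
  · rw [if_neg h, if_neg fun h' => h (TIdx.pos_val_injective h')]

theorem superComm_neg_neg (i j : TIdx) : superComm i.neg j.neg = 0 := by
  rw [superComm_eq, TIdx.neg_val, TIdx.neg_val, if_neg]
  have := i.pos_val_pos
  have := j.pos_val_pos
  linarith

/-- The creation operators supercommute. -/
theorem create_mul_create (i j : TIdx) : create i * create j =
    (-1 : ℂ) ^ (i.pos.parity * j.pos.parity) • (create j * create i) := by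
  have h := superComm_neg_neg i j
  rw [superComm, TIdx.neg_parity, TIdx.neg_parity, sub_eq_zero] at h
  simp only [create, smul_mul_assoc, mul_smul_comm, h]
  rw [smul_comm (creationCoeff i)⁻¹, smul_comm (creationCoeff i)⁻¹,
    smul_comm (creationCoeff j)⁻¹ ((-1 : ℂ) ^ _)]

/-- `[J_i, c_j⁻¹ J_{-j}]_s = δ_{ij}`, applied to a vector. -/
theorem J_pos_create_apply (i j : TIdx) (v : F) : J i.pos (create j v) =
    (-1 : ℂ) ^ (i.pos.parity * j.pos.parity) • create j (J i.pos v) +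
      (open Classical in if i = j then v else 0) := by
  classical
  have h := LinearMap.congr_fun (superComm_pos_neg i j) v
  rw [superComm, TIdx.neg_parity, LinearMap.sub_apply, Module.End.mul_apply,
    LinearMap.smul_apply, Module.End.mul_apply, sub_eq_iff_eq_add] at h
  rw [create, LinearMap.smul_apply, map_smul, h, smul_add, add_comm, LinearMap.smul_apply]
  congr 1
  · rw [smul_comm]
  · split_ifs with hij
    · rw [LinearMap.smul_apply, smul_smul, inv_mul_cancel₀ (creationCoeff_ne_zero j), one_smul]
      rfl
    · simp

theorem J_pos_vac (j : TIdx) : J j.pos vac = 0 := by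
  rcases j with k | k
  · exact current_vac (by positivity)
  · rw [TIdx.pos, J_half, LinearMap.smul_apply,
      (theta_hasDeg (-k - 1) 0 vac HomF.vac).eq_zero_of_neg (by omega), smul_zero]

theorem J_mem_range (i : Idx) : ∃ j : TIdx, i = j.pos ∨ i = j.neg := by
  rcases i with k | k
  · rcases lt_or_ge k 0 with h | h
    · exact ⟨.int (-k - 1).toNat, Or.inr (by rw [TIdx.neg]; congr 1; omega)⟩
    · exact ⟨.int k.toNat, Or.inl (by rw [TIdx.pos]; congr 1; omega)⟩
  · rcases lt_or_ge k 0 with h | h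
    · exact ⟨.half (-k - 1).toNat, Or.inr (by rw [TIdx.neg]; congr 1; omega)⟩
    · exact ⟨.half k.toNat, Or.inl (by rw [TIdx.pos]; congr 1; omega)⟩

/-! ### The polynomial superalgebra as a Fock space -/

/-- The variables generate the polynomial superalgebra. -/
theorem submodule_eq_top_of_tMul {S : Submodule ℂ T} (h1 : (1 : T) ∈ S)
    (h : ∀ j, ∀ v ∈ S, tMul j v ∈ S) : S = ⊤ := by
  have hw : ∀ w : ExteriorAlgebra ℂ (ℕ →₀ ℂ), (1 : MvPolynomial ℕ ℂ) ⊗ₜ[ℂ] w ∈ S := by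
    intro w
    induction w using CliffordAlgebra.left_induction with
    | algebraMap r =>
      rw [Algebra.algebraMap_eq_smul_one, TensorProduct.tmul_smul]
      exact S.smul_mem r h1
    | add x y hx hy =>
      rw [TensorProduct.tmul_add]
      exact S.add_mem hx hy
    | ι_mul x m hx =>
      induction m using Finsupp.induction_linear with
      | zero => rw [map_zero, zero_mul, TensorProduct.tmul_zero]; exact S.zero_mem
      | add f g hf hg =>
        rw [map_add, add_mul, TensorProduct.tmul_add]
        exact S.add_mem hf hg
      | single k a =>
        have e : Finsupp.single k a = a • Finsupp.single k (1 : ℂ) := by simp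
        rw [e, map_smul, smul_mul_assoc, TensorProduct.tmul_smul]
        refine S.smul_mem a ?_
        have := h (.half k) _ hx
        rw [tMul, LinearMap.mulLeft_apply, t, Algebra.TensorProduct.tmul_mul_tmul, one_mul] at this
        exact this
  refine eq_top_iff.mpr fun v _ => ?_
  induction v using TensorProduct.induction_on with
  | zero => exact S.zero_mem
  | add x y hx hy => exact S.add_mem (hx trivial) (hy trivial)
  | tmul p w =>
    induction p using MvPolynomial.induction_on with
    | C a =>
      rw [← mul_one (MvPolynomial.C a), ← MvPolynomial.smul_eq_C_mul, ← TensorProduct.smul_tmul']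
      exact S.smul_mem a (hw w)
    | add p q hp hq =>
      rw [TensorProduct.add_tmul]
      exact S.add_mem (hp trivial) (hq trivial)
    | mul_X p k hp =>
      have := h (.int k) _ (hp trivial)
      rw [tMul, LinearMap.mulLeft_apply, t, Algebra.TensorProduct.tmul_mul_tmul, one_mul,
        mul_comm] at this
      exact this

theorem tMul_tMul_apply (i j : TIdx) (v : T) : tMul i (tMul j v) =
    (-1 : ℂ) ^ (i.pos.parity * j.pos.parity) • tMul j (tMul i v) := by
  simp only [tMul, LinearMap.mulLeft_apply, ← mul_assoc, t_comm i j, smul_mul_assoc]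

theorem tDer_tMul_apply (i j : TIdx) (v : T) : tDer i (tMul j v) =
    (-1 : ℂ) ^ (i.pos.parity * j.pos.parity) • tMul j (tDer i v) +
      (open Classical in if i = j then v else 0) := by
  classical
  have h := LinearMap.congr_fun (tDer_tMul i j) v
  rw [LinearMap.sub_apply, Module.End.mul_apply, LinearMap.smul_apply, Module.End.mul_apply,
    sub_eq_iff_eq_add] at h
  rw [h, add_comm]
  congr 1
  split_ifs <;> rfl

theorem tDer_finite (v : T) : (Function.support fun j => tDer j v).Finite := by
  let S : Submodule ℂ T :=
    { carrier := {v | (Function.support fun j => tDer j v).Finite}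
      add_mem' := fun {x y} hx hy => (hx.union hy).subset fun j hj => by
        by_contra hc
        simp only [Set.mem_union, Function.mem_support, not_or, not_not] at hc
        exact hj (by simp [hc.1, hc.2])
      zero_mem' := by simp
      smul_mem' := fun c x hx => hx.subset fun j hj h0 => hj (by
        have h0' : tDer j x = 0 := h0
        simp [h0']) }
  have hS : S = ⊤ := by
    refine submodule_eq_top_of_tMul ?_ fun i v hv => ?_
    · change (Function.support fun j => tDer j (1 : T)).Finite
      simp [tDer_one]
    · refine (hv.union (Set.finite_singleton i)).subset fun j hj => ?_
      by_contra hc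
      simp only [Set.mem_union, Function.mem_support, not_or, not_not,
        Set.mem_singleton_iff] at hc
      exact hj (by simp only [tDer_tMul_apply, hc.1, if_neg hc.2]; simp)
  have : v ∈ S := hS ▸ Submodule.mem_top
  exact this

theorem tEuler_locFin : LocFin fun j => tMul j * tDer j := fun v =>
  (tDer_finite v).subset fun j hj h0 => hj (by
    have h0' : tDer j v = 0 := h0
    simp [h0'])

/-- The Euler operator `∑ t_j ∂/∂t_j` on the polynomial superalgebra. -/
def tEuler : Module.End ℂ T := locSum fun j => tMul j * tDer j

theorem tEuler_apply (v : T) : tEuler v = ∑ᶠ j, tMul j (tDer j v) :=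
  locSum_apply tEuler_locFin v

theorem tEuler_one : tEuler 1 = 0 := by
  rw [tEuler_apply]
  refine finsum_eq_zero_of_forall_eq_zero fun j => ?_
  rw [tDer_one, map_zero]

theorem tEuler_tMul (j : TIdx) (v : T) : tEuler (tMul j v) = tMul j (tEuler v) + tMul j v := by
  classical
  have h : ∀ i, tMul i (tDer i (tMul j v)) =
      tMul j (tMul i (tDer i v)) + if i = j then tMul j v else 0 := by
    intro i
    rw [tDer_tMul_apply, map_add, map_smul, tMul_tMul_apply i j, smul_smul, ← mul_pow]
    have e : ((-1 : ℂ) * -1) = 1 := by norm_num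
    rw [e, one_pow, one_smul]
    congr 1
    split_ifs with hij
    · rw [hij]
    · rw [map_zero]
  have hs : tMul j (tEuler v) = ∑ᶠ i, tMul j (tMul i (tDer i v)) := by
    rw [tEuler_apply]
    exact (tMul j).toAddMonoidHom.map_finsum (tEuler_locFin v)
  rw [tEuler_apply, finsum_congr h, hs, finsum_add_distrib,
    finsum_eq_single _ j fun i hi => if_neg hi, if_pos rfl]
  · exact (tEuler_locFin v).subset fun i hi h0 => hi (by
      have h0' : tMul i (tDer i v) = 0 := h0
      simp [h0'])
  · exact (Set.finite_singleton j).subset fun i hi => by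
      by_contra hc
      exact hi (if_neg hc)

/-- Only the constants are annihilated by the Euler operator: all other products of variables
are eigenvectors with nonzero eigenvalue. -/
theorem exists_eq_smul_one_of_tEuler_eq_zero {v : T} (hv : tEuler v = 0) :
    ∃ c : ℂ, v = c • 1 := by
  let E : ℂ → Submodule ℂ T := tEuler.eigenspace
  have hmul : ∀ (μ : ℂ) (j : TIdx) (u : T), u ∈ E μ → tMul j u ∈ E (μ + 1) := by
    intro μ j u hu
    have hu' : tEuler u = μ • u := Module.End.mem_eigenspace_iff.mp hu
    refine Module.End.mem_eigenspace_iff.mpr ?_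
    rw [tEuler_tMul, hu', map_smul, add_smul, one_smul]
  have htop : Submodule.span ℂ {(1 : T)} ⊔ ⨆ n : ℕ, E (n + 1) = ⊤ := by
    refine submodule_eq_top_of_tMul
      (Submodule.mem_sup_left (Submodule.mem_span_singleton_self 1)) fun j u hu => ?_
    obtain ⟨x, hx, y, hy, rfl⟩ := Submodule.mem_sup.mp hu
    clear hu
    rw [map_add]
    refine Submodule.mem_sup_right (Submodule.add_mem _ ?_ ?_)
    · obtain ⟨c, rfl⟩ := Submodule.mem_span_singleton.mp hx
      have h1 : (1 : T) ∈ E 0 := Module.End.mem_eigenspace_iff.mpr (by rw [tEuler_one, zero_smul])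
      rw [map_smul]
      refine Submodule.smul_mem _ c (Submodule.mem_iSup_of_mem 0 ?_)
      simpa using hmul 0 j 1 h1
    · induction hy using Submodule.iSup_induction' with
      | mem n y hy =>
        refine Submodule.mem_iSup_of_mem (n + 1) ?_
        have := hmul _ j y hy
        rwa [← Nat.cast_succ] at this
      | zero => rw [map_zero]; exact Submodule.zero_mem _
      | add a b _ _ ha hb =>
        rw [map_add]
        exact Submodule.add_mem _ ha hb
  obtain ⟨x, hx, y, hy, rfl⟩ := Submodule.mem_sup.mp
    (htop ▸ Submodule.mem_top : v ∈ Submodule.span ℂ {(1 : T)} ⊔ ⨆ n : ℕ, E (n + 1))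
  obtain ⟨c, rfl⟩ := Submodule.mem_span_singleton.mp hx
  refine ⟨c, ?_⟩
  have hy0 : y ∈ E 0 := Module.End.mem_eigenspace_iff.mpr (by
    rw [map_add, map_smul, tEuler_one, smul_zero, zero_add] at hv
    rw [hv, zero_smul])
  have hy1 : y ∈ ⨆ (μ : ℂ) (_ : μ ≠ 0), E μ := by
    refine (iSup_le fun n : ℕ => ?_ : (⨆ n : ℕ, E (n + 1)) ≤ _) hy
    exact le_iSup₂_of_le ((n : ℂ) + 1) (Nat.cast_add_one_ne_zero n) le_rfl
  have := (Submodule.disjoint_def.mp (tEuler.eigenspaces_iSupIndep 0)) y hy0 hy1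
  rw [this, add_zero]

/-- The vectors annihilated by all products of `n` derivatives. -/
def nilDer : ℕ → Submodule ℂ T
  | 0 => ⊥
  | n + 1 => ⨅ j, (nilDer n).comap (tDer j)

theorem mem_nilDer_succ {n : ℕ} {v : T} : v ∈ nilDer (n + 1) ↔ ∀ j, tDer j v ∈ nilDer n := by
  simp [nilDer, Submodule.mem_iInf]

theorem nilDer_mono : Monotone nilDer := by
  refine monotone_nat_of_le_succ fun n => ?_
  induction n with
  | zero => exact bot_le
  | succ n ih => exact fun v hv => mem_nilDer_succ.mpr fun j => ih (mem_nilDer_succ.mp hv j)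

theorem tMul_mem_nilDer (i : TIdx) : ∀ (n : ℕ) (v : T), v ∈ nilDer n → tMul i v ∈ nilDer (n + 1)
  | 0, v, hv => by
    have hv' : v = 0 := hv
    rw [hv', map_zero]
    exact Submodule.zero_mem _
  | n + 1, v, hv => mem_nilDer_succ.mpr fun j => by
    classical
    rw [tDer_tMul_apply]
    refine Submodule.add_mem _ (Submodule.smul_mem _ _
      (tMul_mem_nilDer i n _ (mem_nilDer_succ.mp hv j))) ?_
    split_ifs
    · exact hv
    · exact Submodule.zero_mem _

theorem exists_mem_nilDer (v : T) : ∃ n, v ∈ nilDer n := by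
  have htop : ⨆ n, nilDer n = ⊤ := by
    refine submodule_eq_top_of_tMul (Submodule.mem_iSup_of_mem 1 (mem_nilDer_succ.mpr fun j => ?_))
      fun j v hv => ?_
    · rw [tDer_one]
      exact Submodule.zero_mem _
    · obtain ⟨n, hn⟩ := (Submodule.mem_iSup_of_directed _ nilDer_mono.directed_le).mp hv
      exact Submodule.mem_iSup_of_mem (n + 1) (tMul_mem_nilDer j n v hn)
  exact (Submodule.mem_iSup_of_directed _ nilDer_mono.directed_le).mp (htop ▸ Submodule.mem_top)

/-- A nonzero subspace of the polynomial superalgebra that is stable under all derivatives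
contains `1`. -/
theorem eq_bot_of_tDer_stable {K : Submodule ℂ T} (hK : ∀ j, ∀ v ∈ K, tDer j v ∈ K)
    (h1 : (1 : T) ∉ K) : K = ⊥ := by
  have h : ∀ n, ∀ v ∈ K, v ∈ nilDer n → v = 0 := by
    intro n
    induction n with
    | zero => exact fun v _ hv => hv
    | succ n ih =>
      intro v hv hn
      have hd : ∀ j, tDer j v = 0 := fun j => ih _ (hK j v hv) (mem_nilDer_succ.mp hn j)
      obtain ⟨c, rfl⟩ := exists_eq_smul_one_of_tEuler_eq_zero (v := v) (by
        rw [tEuler_apply]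
        exact finsum_eq_zero_of_forall_eq_zero fun j => by rw [hd, map_zero])
      by_contra hc
      have hc0 : c ≠ 0 := fun h0 => hc (by rw [h0, zero_smul])
      refine h1 ?_
      have := K.smul_mem c⁻¹ hv
      rwa [smul_smul, inv_mul_cancel₀ hc0, one_smul] at this
  refine (Submodule.eq_bot_iff K).mpr fun v hv => ?_
  obtain ⟨n, hn⟩ := exists_mem_nilDer v
  exact h n v hv hn

/-! ### The isomorphism `σ` -/

section Representations

variable {A : Type} [Ring A] [Algebra ℂ A]

open scoped IsMulCommutative in
theorem exists_algHom_of_commute {f : ℕ → A} (h : ∀ i j, Commute (f i) (f j)) :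
    ∃ ρ : MvPolynomial ℕ ℂ →ₐ[ℂ] A, ∀ k, ρ (MvPolynomial.X k) = f k := by
  have hc : ∀ a ∈ Set.range f, ∀ b ∈ Set.range f, a * b = b * a := by
    rintro _ ⟨i, rfl⟩ _ ⟨j, rfl⟩
    exact h i j
  have := Algebra.isMulCommutative_adjoin ℂ hc
  refine ⟨(Algebra.adjoin ℂ (Set.range f)).val.comp
    (MvPolynomial.aeval fun k => ⟨f k, Algebra.subset_adjoin ⟨k, rfl⟩⟩), fun k => ?_⟩
  rw [AlgHom.comp_apply, MvPolynomial.aeval_X]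
  rfl

theorem exists_algHom_of_anticommute {f : ℕ → A} (h : ∀ i j, f i * f j + f j * f i = 0) :
    ∃ ρ : ExteriorAlgebra ℂ (ℕ →₀ ℂ) →ₐ[ℂ] A,
      ∀ k, ρ (ExteriorAlgebra.ι ℂ (Finsupp.single k 1)) = f k := by
  let L : (ℕ →₀ ℂ) →ₗ[ℂ] A := Finsupp.linearCombination ℂ f
  have hL : ∀ x y, L x * L y + L y * L x = 0 := by
    intro x y
    induction x using Finsupp.induction_linear with
    | zero => simp
    | add x x' hx hx' =>
      have e : L (x + x') * L y + L y * L (x + x') =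
          (L x * L y + L y * L x) + (L x' * L y + L y * L x') := by
        rw [map_add]
        noncomm_ring
      rw [e, hx, hx', add_zero]
    | single i a =>
      induction y using Finsupp.induction_linear with
      | zero => simp
      | add y y' hy hy' =>
        have e : ∀ z, L z * L (y + y') + L (y + y') * L z =
            (L z * L y + L y * L z) + (L z * L y' + L y' * L z) := fun z => by
          rw [map_add]
          noncomm_ring
        rw [e, hy, hy', add_zero]
      | single j b =>
        simp only [L, Finsupp.linearCombination_single, smul_mul_assoc, mul_smul_comm]
        rw [smul_comm b a, ← smul_add, ← smul_add, h, smul_zero, smul_zero]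
  have hsq : ∀ x, L x * L x = 0 := fun x => by
    have h2 : (2 : ℂ) • (L x * L x) = 0 := by rw [two_smul]; exact hL x x
    exact (smul_eq_zero.mp h2).resolve_left two_ne_zero
  refine ⟨ExteriorAlgebra.lift ℂ ⟨L, hsq⟩, fun k => ?_⟩
  rw [ExteriorAlgebra.lift_ι_apply]
  simp [L]

theorem neg_one_smul_add_self (x : A) : (-1 : ℂ) • x + x = 0 := by
  rw [neg_one_smul, neg_add_cancel]

end Representations

theorem create_int_commute (i : ℕ) (j : TIdx) : Commute (create (.int i)) (create j) := by
  have h := create_mul_create (.int i) j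
  simp only [TIdx.pos, Idx.parity, zero_mul, pow_zero] at h
  rw [one_smul] at h
  exact h

theorem create_half_anticommute (i j : ℕ) :
    create (.half i) * create (.half j) + create (.half j) * create (.half i) = 0 := by
  have h := create_mul_create (.half i) (.half j)
  simp only [TIdx.pos, Idx.parity, one_mul, pow_one] at h
  rw [h]
  exact neg_one_smul_add_self (create (.half j) * create (.half i))

/-- The Fock representation of the superalgebra `ℂ[t]`: polynomials in the creation operators
acting on the vacuum. -/
theorem exists_fockMap : ∃ g : T →ₗ[ℂ] F, g 1 = vac ∧ ∀ j v, g (tMul j v) = create j (g v) := by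
  obtain ⟨ρ, hρ⟩ := exists_algHom_of_commute fun i j => create_int_commute i (.int j)
  obtain ⟨r, hr⟩ := exists_algHom_of_anticommute create_half_anticommute
  have hcomm : ∀ p j, Commute (ρ p) (create (.half j)) := by
    intro p j
    induction p using MvPolynomial.induction_on with
    | C a =>
      rw [← MvPolynomial.algebraMap_eq, AlgHom.commutes]
      exact Algebra.commutes a _
    | add p q hp hq => rw [map_add]; exact hp.add_left hq
    | mul_X p k hp => rw [map_mul, hρ]; exact hp.mul_left (create_int_commute k (.half j))
  let g : T →ₗ[ℂ] F := TensorProduct.lift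
    (LinearMap.mk₂ ℂ (fun p w => ρ p (r w vac)) (fun p q w => by rw [map_add]; rfl)
      (fun c p w => by rw [map_smul]; rfl)
      (fun p w w' => by rw [map_add, LinearMap.add_apply, map_add])
      (fun c p w => by rw [map_smul, LinearMap.smul_apply, map_smul]))
  have hg : ∀ p w, g (p ⊗ₜ w) = ρ p (r w vac) := fun p w => rfl
  refine ⟨g, ?_, fun j v => ?_⟩
  · rw [Algebra.TensorProduct.one_def, hg, map_one, map_one]
    rfl
  · induction v using TensorProduct.induction_on with
    | zero => simp only [map_zero]
    | add x y hx hy => simp only [map_add, hx, hy]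
    | tmul p w =>
      rw [tMul, LinearMap.mulLeft_apply]
      rcases j with k | k
      · rw [t, Algebra.TensorProduct.tmul_mul_tmul, one_mul, hg, hg, map_mul, hρ]
        rfl
      · rw [t, Algebra.TensorProduct.tmul_mul_tmul, one_mul, hg, hg, map_mul, hr]
        exact LinearMap.congr_fun (hcomm p k).eq _

/-- The Fock map intertwines `∂/∂t_j` and `J_j`: both annihilate the generating vector and have the
same supercommutators with the variables and the creation operators. -/
theorem fockMap_tDer {g : T →ₗ[ℂ] F} (h1 : g 1 = vac)
    (hg : ∀ j v, g (tMul j v) = create j (g v)) (j : TIdx) (v : T) :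
    g (tDer j v) = J j.pos (g v) := by
  classical
  have htop : LinearMap.eqLocus (g ∘ₗ tDer j) (J j.pos ∘ₗ g) = ⊤ := by
    refine submodule_eq_top_of_tMul ?_ fun i v hv => ?_
    · change g (tDer j 1) = J j.pos (g 1)
      rw [tDer_one, map_zero, h1, J_pos_vac]
    · have hv' : g (tDer j v) = J j.pos (g v) := hv
      change g (tDer j (tMul i v)) = J j.pos (g (tMul i v))
      rw [tDer_tMul_apply, map_add, map_smul, hg, hg, J_pos_create_apply, hv']
      split_ifs
      · rfl
      · rw [map_zero]
  exact LinearMap.congr_fun (LinearMap.eqLocus_eq_top.mp htop) v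

/-- The kernel of the Fock map is stable under all derivatives and does not contain `1`. -/
theorem fockMap_injective {g : T →ₗ[ℂ] F} (h1 : g 1 = vac)
    (hg : ∀ j v, g (tMul j v) = create j (g v)) : Function.Injective g := by
  rw [← LinearMap.ker_eq_bot]
  refine eq_bot_of_tDer_stable (fun j v hv => ?_) fun h => ?_
  · rw [LinearMap.mem_ker] at hv ⊢
    rw [fockMap_tDer h1 hg, hv, map_zero]
  · rw [LinearMap.mem_ker, h1] at h
    exact one_ne_zero (h : (1 : F) = 0)

/-- The subalgebra of the operators that preserve a subspace. -/
def preserving (S : Submodule ℂ F) : Subalgebra ℂ (Module.End ℂ F) where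
  carrier := {A | ∀ v ∈ S, A v ∈ S}
  mul_mem' := fun {_ _} hA hB v hv => hA _ (hB v hv)
  add_mem' := fun {_ _} hA hB v hv => S.add_mem (hA v hv) (hB v hv)
  algebraMap_mem' := fun c _ hv => S.smul_mem c hv

theorem coeff_expSeries_mem {R : Type} [Ring R] [Algebra ℂ R] {S : Subalgebra ℂ R}
    {X : PowerSeries R} (hX : ∀ k, PowerSeries.coeff k X ∈ S) (m : ℕ) :
    PowerSeries.coeff m (expSeries X) ∈ S := by
  rw [expSeries, PowerSeries.coeff_mk]
  refine S.sum_mem fun n hn => S.smul_mem ?_ _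
  clear hn
  induction n generalizing m with
  | zero =>
    rw [pow_zero, PowerSeries.coeff_one]
    split_ifs
    · exact S.one_mem
    · exact S.zero_mem
  | succ n ih =>
    rw [pow_succ, PowerSeries.coeff_mul]
    exact S.sum_mem fun p _ => S.mul_mem (ih _) (hX _)

theorem coeff_oddLog_mem {R : Type} [Ring R] [Algebra ℂ R] {S : Subalgebra ℂ R}
    {J : ℕ → R} (hJ : ∀ k, Odd k → J k ∈ S) (m : ℕ) : PowerSeries.coeff m (oddLog J) ∈ S := by
  rw [oddLog, PowerSeries.coeff_mk]
  split_ifs with h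
  · exact S.smul_mem (hJ m h) _
  · exact S.zero_mem

theorem fieldMul_mem_preserving {S : Submodule ℂ F} {A B : Field F}
    (hA : ∀ m, A m ∈ preserving S) (hB : ∀ m, B m ∈ preserving S) (m : ℤ) :
    fieldMul A B m ∈ preserving S := by
  by_cases hf : LocFin fun k : ℤ => A (m - k) * B k
  · intro v hv
    rw [fieldMul, locSum_apply hf]
    exact finsum_induction (· ∈ S) S.zero_mem (fun _ _ => S.add_mem)
      fun k => hA _ _ (hB _ _ hv)
  · rw [fieldMul, locSum, dif_neg hf]
    exact (preserving S).zero_mem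

/-- The vacuum is cyclic for the currents `J_i`. -/
theorem submodule_eq_top_of_J {S : Submodule ℂ F} (h1 : vac ∈ S)
    (hpos : ∀ j : TIdx, ∀ v ∈ S, J j.pos v ∈ S) (hneg : ∀ j : TIdx, ∀ v ∈ S, J j.neg v ∈ S) :
    S = ⊤ := by
  have hJ : ∀ i, J i ∈ preserving S := fun i => by
    obtain ⟨j, rfl | rfl⟩ := J_mem_range i
    · exact hpos j
    · exact hneg j
  have hcur : ∀ n, Odd n → current n ∈ preserving S := by
    rintro _ ⟨k, rfl⟩
    exact hJ (.int k)
  have htheta : ∀ m, theta m ∈ preserving S := fun m => by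
    have := (preserving S).smul_mem (hJ (.half (-m - 1))) 2
    rw [J_half, smul_smul, show -(-m - 1) - 1 = m by ring] at this
    norm_num at this
    exact this
  have hp : ∀ m, ofPowInv Vplus m ∈ preserving S := fun m => by
    rw [ofPowInv]
    split_ifs
    · exact coeff_expSeries_mem (coeff_oddLog_mem (J := annihilators) fun k hk =>
        hcur k ((Int.odd_coe_nat k).mpr hk)) _
    · exact (preserving S).zero_mem
  have hm : ∀ m, ofPow Vminus m ∈ preserving S := fun m => by
    rw [ofPow]
    split_ifs
    · rw [Vminus_eq]
      exact coeff_expSeries_mem (coeff_oddLog_mem fun k hk =>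
        (preserving S).neg_mem (hcur _ (odd_neg_natCast hk))) _
    · exact (preserving S).zero_mem
  refine submodule_eq_top_of_phi h1 fun k v hv => ?_
  rw [phi_eq_dress_theta]
  exact fieldMul_mem_preserving hm (fieldMul_mem_preserving htheta hp) k v hv

theorem fockMap_surjective {g : T →ₗ[ℂ] F} (h1 : g 1 = vac)
    (hg : ∀ j v, g (tMul j v) = create j (g v)) : Function.Surjective g := by
  rw [← LinearMap.range_eq_top]
  refine submodule_eq_top_of_J ⟨1, h1⟩ ?_ ?_
  · rintro j _ ⟨v, rfl⟩
    exact ⟨tDer j v, fockMap_tDer h1 hg j v⟩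
  · rintro j _ ⟨v, rfl⟩
    exact ⟨creationCoeff j • tMul j v, by rw [map_smul, hg, J_neg_eq]; rfl⟩

/-- The inverse of the Fock map is a bosonization. -/
theorem exists_isBosonization : ∃ σ : F ≃ₗ[ℂ] T, IsBosonization σ := by
  obtain ⟨g, h1, hg⟩ := exists_fockMap
  let e : T ≃ₗ[ℂ] F := LinearEquiv.ofBijective g
    ⟨fockMap_injective h1 hg, fockMap_surjective h1 hg⟩
  have he : ∀ v, e v = g v := fun v => rfl
  refine ⟨e.symm, ?_, fun j => ⟨LinearMap.ext fun v => ?_, LinearMap.ext fun v => ?_⟩⟩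
  · rw [LinearEquiv.symm_apply_eq, he, h1]
  · rw [LinearEquiv.conj_apply_apply, LinearEquiv.symm_symm, LinearEquiv.symm_apply_eq, he, he,
      LinearMap.smul_apply, map_smul, hg, J_neg_eq]
    rfl
  · rw [LinearEquiv.conj_apply_apply, LinearEquiv.symm_symm, LinearEquiv.symm_apply_eq, he, he,
      fockMap_tDer h1 hg]

/-! ### The bosonic form of `φ` -/

section Transport

variable {M N : Type} [AddCommGroup M] [Module ℂ M] [AddCommGroup N] [Module ℂ N]

/-- Conjugation of a field by a linear isomorphism. -/
def conjField (σ : M ≃ₗ[ℂ] N) (A : Field M) : Field N := fun m => σ.conj (A m)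

theorem Composable.conjField {A B : Field M} (h : Composable A B) (σ : M ≃ₗ[ℂ] N) :
    Composable (conjField σ A) (conjField σ B) := fun m v =>
  (h.finite m (σ.symm v)).subset fun k hk h0 => hk (by
    have h0' : A (m - k) (B k (σ.symm v)) = 0 := h0
    simp [CKP.conjField, LinearEquiv.conj_apply_apply, h0'])

theorem fieldMul_conjField {A B : Field M} (h : Composable A B) (σ : M ≃ₗ[ℂ] N) :
    fieldMul (conjField σ A) (conjField σ B) = conjField σ (fieldMul A B) := by
  funext m
  refine LinearMap.ext fun v => ?_
  rw [fieldMul_apply (h.conjField σ), conjField, LinearEquiv.conj_apply_apply, fieldMul_apply h]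
  refine Eq.trans ?_ (σ.toLinearMap.toAddMonoidHom.map_finsum (h.finite m _)).symm
  refine finsum_congr fun k => ?_
  simp [conjField, LinearEquiv.conj_apply_apply]

theorem Composable.of_commute {A B : Field M} (h : Composable B A)
    (hc : ∀ m k, Commute (A m) (B k)) : Composable A B := fun m v => by
  refine ((h.finite m v).image (fun k => m - k)).subset fun k hk => ⟨m - k, fun h0 => hk ?_, by simp⟩
  have h0' : B (m - (m - k)) (A (m - k) v) = 0 := h0
  rw [sub_sub_cancel] at h0'
  change (A (m - k) * B k) v = 0
  rw [(hc _ _).eq]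
  exact h0'

theorem fieldMul_comm_of_commute {A B : Field M} (h : Composable B A)
    (hc : ∀ m k, Commute (A m) (B k)) : fieldMul A B = fieldMul B A := by
  funext m
  refine LinearMap.ext fun v => ?_
  rw [fieldMul_apply (h.of_commute hc), fieldMul_apply h,
    ← finsum_comp_equiv (Equiv.subLeft m)]
  refine finsum_congr fun k => ?_
  rw [Equiv.subLeft_apply, sub_sub_cancel]
  exact LinearMap.congr_fun (hc k (m - k)).eq v

theorem map_coeff_expSeries {R R' : Type} [Ring R] [Algebra ℂ R] [Ring R'] [Algebra ℂ R']
    (f : R →ₐ[ℂ] R') (X : PowerSeries R) (m : ℕ) :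
    f (PowerSeries.coeff m (expSeries X)) =
      PowerSeries.coeff m (expSeries (PowerSeries.map f.toRingHom X)) := by
  rw [expSeries, expSeries, PowerSeries.coeff_mk, PowerSeries.coeff_mk, map_sum]
  refine Finset.sum_congr rfl fun n _ => ?_
  rw [map_smul, ← map_pow, PowerSeries.coeff_map]
  rfl

/-- Conjugation by a linear isomorphism as a homomorphism of algebras. -/
def conjAlgHom (σ : M ≃ₗ[ℂ] N) : Module.End ℂ M →ₐ[ℂ] Module.End ℂ N :=
  AlgHom.ofLinearMap σ.conj.toLinearMap (by ext v; simp [LinearEquiv.conj_apply_apply])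
    (fun A B => by ext v; simp [LinearEquiv.conj_apply_apply])

theorem conjField_ofPow_expSeries (σ : M ≃ₗ[ℂ] N) {X : PowerSeries (Module.End ℂ M)}
    {Y : PowerSeries (Module.End ℂ N)}
    (h : ∀ k, σ.conj (PowerSeries.coeff k X) = PowerSeries.coeff k Y) :
    conjField σ (ofPow (expSeries X)) = ofPow (expSeries Y) := by
  have hY : Y = PowerSeries.map (conjAlgHom σ).toRingHom X := by
    ext k : 1
    rw [← h, PowerSeries.coeff_map]
    rfl
  funext m
  rw [conjField, ofPow, ofPow]
  split_ifs
  · rw [hY, ← map_coeff_expSeries]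
    rfl
  · exact map_zero _

theorem conjField_ofPowInv_expSeries (σ : M ≃ₗ[ℂ] N) {X : PowerSeries (Module.End ℂ M)}
    {Y : PowerSeries (Module.End ℂ N)}
    (h : ∀ k, σ.conj (PowerSeries.coeff k X) = PowerSeries.coeff k Y) :
    conjField σ (ofPowInv (expSeries X)) = ofPowInv (expSeries Y) := by
  have hY : Y = PowerSeries.map (conjAlgHom σ).toRingHom X := by
    ext k : 1
    rw [← h, PowerSeries.coeff_map]
    rfl
  funext m
  rw [conjField, ofPowInv, ofPowInv]
  split_ifs
  · rw [hY, ← map_coeff_expSeries]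
    rfl
  · exact map_zero _

end Transport

theorem creationCoeff_int (k : ℕ) : creationCoeff (.int k) = -((2 * k + 1) / 2) := by
  have hf : ⌊(1 / 2 : ℚ) - (2 * ((k : ℤ) : ℚ) + 1)⌋ = -(2 * (k : ℤ) + 1) := by
    rw [Int.floor_eq_iff]; push_cast; constructor <;> linarith
  rw [creationCoeff, TIdx.pos, Idx.val, hf, (odd_two_mul_add_one k).neg.neg_one_zpow]
  push_cast
  ring

theorem creationCoeff_half (k : ℕ) :
    creationCoeff (.half k) = (-1) ^ k * ((2 * k + 1) / 4) := by
  have hf : ⌊(1 / 2 : ℚ) - (((k : ℤ) : ℚ) + 1 / 2)⌋ = -(k : ℤ) := by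
    rw [Int.floor_eq_iff]; push_cast; constructor <;> linarith
  rw [creationCoeff, TIdx.pos, Idx.val, hf, neg_one_zpow_neg, zpow_natCast]
  push_cast
  ring

theorem IsBosonization.conj_neg {σ : F ≃ₗ[ℂ] T} (hσ : IsBosonization σ) (j : TIdx) :
    σ.conj (J j.neg) = creationCoeff j • tMul j := (hσ.2 j).1

theorem IsBosonization.conj_pos {σ : F ≃ₗ[ℂ] T} (hσ : IsBosonization σ) (j : TIdx) :
    σ.conj (J j.pos) = tDer j := (hσ.2 j).2

theorem IsBosonization.conjField_Vplus {σ : F ≃ₗ[ℂ] T} (hσ : IsBosonization σ) :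
    conjField σ (ofPowInv Vplus) = expD := by
  refine conjField_ofPowInv_expSeries σ fun k => ?_
  rw [PowerSeries.coeff_mk, PowerSeries.coeff_mk]
  split_ifs with hk
  · obtain ⟨j, rfl⟩ := hk
    rw [map_smul, show (2 * j + 1) / 2 = j by omega, ← hσ.conj_pos]
    simp only [TIdx.pos, J]
    push_cast
    rfl
  · exact map_zero _

theorem IsBosonization.conjField_Vminus {σ : F ≃ₗ[ℂ] T} (hσ : IsBosonization σ) :
    conjField σ (ofPow Vminus) = expT := by
  refine conjField_ofPow_expSeries σ fun k => ?_
  rw [PowerSeries.coeff_mk, PowerSeries.coeff_mk]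
  split_ifs with hk
  · obtain ⟨j, rfl⟩ := hk
    have h := hσ.conj_neg (.int j)
    have e : J (TIdx.neg (.int j)) = current (-((2 * j + 1 : ℕ) : ℤ)) := by
      simp only [TIdx.neg, J]
      congr 1; push_cast; ring
    rw [e] at h
    rw [map_smul, h, show (2 * j + 1) / 2 = j by omega, smul_smul, creationCoeff_int]
    have h0 : (2 * (j : ℂ) + 1) ≠ 0 := by exact_mod_cast (Nat.succ_ne_zero (2 * j))
    have e1 : (2 / (-((2 * j + 1 : ℕ) : ℂ))) * -((2 * (j : ℂ) + 1) / 2) = 1 := by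
      push_cast
      field_simp
    rw [e1, one_smul]
  · exact map_zero _

theorem theta_eq_two_smul_J (k : ℤ) : theta (-k - 1) = (2 : ℂ) • J (.half k) := by
  rw [J_half, smul_smul]
  norm_num

theorem IsBosonization.conjField_theta {σ : F ≃ₗ[ℂ] T} (hσ : IsBosonization σ) :
    conjField σ theta = oddField := by
  funext m
  rw [conjField]
  rcases m with k | k
  · have e : theta (Int.ofNat k) = (2 : ℂ) • J (TIdx.neg (.half k)) := by
      rw [TIdx.neg, ← theta_eq_two_smul_J]
      congr 1
      rw [Int.ofNat_eq_natCast]; ring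
    rw [e, map_smul, hσ.conj_neg, smul_smul, creationCoeff_half, oddField]
    congr 1
    ring
  · have e : theta (Int.negSucc k) = (2 : ℂ) • J (TIdx.pos (.half k)) := by
      rw [TIdx.pos, ← theta_eq_two_smul_J]
      congr 1
      rw [Int.negSucc_eq]; ring
    rw [e, map_smul, hσ.conj_pos, oddField]

theorem Vplus_commute_theta (m k : ℤ) : Commute (ofPowInv Vplus m) (theta k) := by
  rw [ofPowInv]
  split_ifs
  · exact (commute_coeff_Vplus (fun n hn => (current_commute_theta hn k).symm) _).symm
  · exact Commute.zero_left _

theorem composable_Vplus_theta : Composable (ofPowInv Vplus) theta :=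
  (composable_Vplus theta).of_commute Vplus_commute_theta

theorem fieldMul_Vplus_theta :
    fieldMul (ofPowInv Vplus) theta = fieldMul theta (ofPowInv Vplus) :=
  fieldMul_comm_of_commute (composable_Vplus theta) Vplus_commute_theta

theorem composable_Vminus_Vplus_theta :
    Composable (ofPow Vminus) (fieldMul (ofPowInv Vplus) theta) := by
  rw [fieldMul_Vplus_theta]
  exact composable_Vminus (lowerTrunc_mul_Vplus lowerTrunc_theta)

/-- Local finiteness is inherited from the Fock space through the isomorphism `σ`. -/
theorem composable_expD_oddField : Composable expD oddField := by
  obtain ⟨σ, hσ⟩ := exists_isBosonization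
  rw [← hσ.conjField_Vplus, ← hσ.conjField_theta]
  exact composable_Vplus_theta.conjField σ

theorem composable_expT : Composable expT (fieldMul expD oddField) := by
  obtain ⟨σ, hσ⟩ := exists_isBosonization
  rw [← hσ.conjField_Vplus, ← hσ.conjField_theta, ← hσ.conjField_Vminus,
    fieldMul_conjField composable_Vplus_theta]
  exact composable_Vminus_Vplus_theta.conjField σ

theorem IsBosonization.conjField_phi {σ : F ≃ₗ[ℂ] T} (hσ : IsBosonization σ) :
    conjField σ phi = fieldMul expT (fieldMul expD oddField) := by
  rw [← hσ.conjField_Vplus, ← hσ.conjField_theta, ← hσ.conjField_Vminus,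
    fieldMul_conjField composable_Vplus_theta,
    fieldMul_conjField composable_Vminus_Vplus_theta, fieldMul_Vplus_theta]
  exact congrArg (conjField σ) phi_eq_dress_theta

/-- Two bosonizations conjugate `φ` to the same field, so they differ by an operator that
commutes with all `φ_j` and fixes the vacuum. -/
theorem IsBosonization.unique {σ τ : F ≃ₗ[ℂ] T} (hσ : IsBosonization σ)
    (hτ : IsBosonization τ) : σ = τ := by
  have hphi : ∀ m v, σ (phi m (σ.symm v)) = τ (phi m (τ.symm v)) := fun m v => by
    have := LinearMap.congr_fun (congrFun (hσ.conjField_phi.trans hτ.conjField_phi.symm) m) v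
    simpa only [conjField, LinearEquiv.conj_apply_apply] using this
  let A : Module.End ℂ F := (σ.trans τ.symm).toLinearMap
  have hA : ∀ v, A v = τ.symm (σ v) := fun v => rfl
  have h1 : A = (1 : ℂ) • 1 := by
    refine eq_of_commute_phi (fun m => LinearMap.ext fun v => ?_) ?_
    · rw [Module.End.mul_apply, Module.End.mul_apply, hA, hA, LinearEquiv.symm_apply_eq, ← hphi,
        LinearEquiv.symm_apply_apply]
    · rw [hA, hσ.1, ← hτ.1, LinearEquiv.symm_apply_apply, one_smul]
  refine LinearEquiv.ext fun v => ?_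
  have h2 := LinearMap.congr_fun h1 v
  rw [one_smul, hA, LinearEquiv.symm_apply_eq] at h2
  exact h2

/-! ### The operator product in terms of the formal delta function -/

section Delta

variable {R : Type} [Ring R] [Algebra ℂ R]

theorem two_ymul_dy_delta_add_delta (p q : ℤ) :
    (-(2 • ymul (dy (delta R))) - delta R) p q =
      if p + q = -1 then (-(2 * q + 1) : ℂ) • 1 else 0 := by
  simp only [Pi.sub_apply, Pi.neg_apply, Pi.smul_apply, ymul, dy, delta, sub_add_cancel]
  split_ifs
  · rw [← Int.cast_smul_eq_zsmul ℂ, ← Nat.cast_smul_eq_nsmul ℂ]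
    module
  · simp

theorem eulerY_delta (p q : ℤ) :
    (-eulerY (delta R)) p q = if p + q = -1 then (-(2 * q + 1) : ℂ) • 1 else 0 := by
  simp only [eulerY, Pi.add_apply, Pi.neg_apply, ymul, dy, delta, sub_add_cancel,
    add_sub_cancel_right]
  split_ifs
  · rw [← Int.cast_smul_eq_zsmul ℂ, ← Int.cast_smul_eq_zsmul ℂ]
    push_cast
    module
  · simp

end Delta

theorem anticomm_reflect_theta (p q : ℤ) : anticomm (reflect theta) theta p q =
    if p + q = -1 then (-(2 * q + 1) : ℂ) • 1 else 0 := by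
  rw [anticomm, reflect, smul_mul_assoc, mul_smul_comm, ← smul_add, theta_anticomm]
  split_ifs with h
  · have e : (-1 : ℂ) ^ p * ((-1 : ℂ) ^ q * (2 * q + 1)) = -(2 * q + 1) := by
      rw [← mul_assoc, ← zpow_add₀ (by norm_num), h]
      norm_num
    rw [smul_smul, e]
  · rw [smul_zero]

end CKP

end

theorem mainTheorem1 :
    -- all the infinite sums that enter the definitions of `J_n` and `θ(z)` are locally finite
    (∀ n : ℤ, CKP.LocFin (CKP.currentTerm n)) ∧
    CKP.Composable CKP.phi CKP.VplusInv ∧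
    CKP.Composable CKP.VminusInv (CKP.fieldMul CKP.phi CKP.VplusInv) ∧
    -- `φ(z) = V_-(z) θ(z) V_+(z)`
    CKP.Composable CKP.theta (CKP.ofPowInv CKP.Vplus) ∧
    CKP.Composable (CKP.ofPow CKP.Vminus) (CKP.fieldMul CKP.theta (CKP.ofPowInv CKP.Vplus)) ∧
    CKP.phi =
      CKP.fieldMul (CKP.ofPow CKP.Vminus) (CKP.fieldMul CKP.theta (CKP.ofPowInv CKP.Vplus)) ∧
    -- `[J_n, θ(z)] = 0` for `n` odd
    (∀ n : ℤ, Odd n → ∀ m : ℤ,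
      CKP.current n * CKP.theta m - CKP.theta m * CKP.current n = 0) ∧
    -- `θ(-z)θ(y) + θ(y)θ(-z) = -2y ∂_y δ(z-y) - δ(z-y) = -D_y δ(z-y)`
    (CKP.anticomm (CKP.reflect CKP.theta) CKP.theta =
        -(2 • CKP.ymul (CKP.dy (CKP.delta (Module.End ℂ CKP.F)))) -
          CKP.delta (Module.End ℂ CKP.F) ∧
      CKP.anticomm (CKP.reflect CKP.theta) CKP.theta =
        -CKP.eulerY (CKP.delta (Module.End ℂ CKP.F))) ∧
    -- `[J_i, J_j]_s = (j/2) (-1)^{[j-1/2]} δ_{i,-j}`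
    (∀ i j : CKP.Idx,
      CKP.superComm i j =
        if i.val = -j.val then
          ((j.val : ℂ) / 2 * (-1 : ℂ) ^ ⌊j.val - 1 / 2⌋) • (1 : Module.End ℂ CKP.F)
        else 0) ∧
    -- the isomorphism `σ`
    (∃! σ : CKP.F ≃ₗ[ℂ] CKP.T, CKP.IsBosonization σ) ∧
    -- the vertex operator formula for `σ φ(z) σ⁻¹`
    CKP.Composable CKP.expD CKP.oddField ∧
    CKP.Composable CKP.expT (CKP.fieldMul CKP.expD CKP.oddField) ∧
    (∀ σ : CKP.F ≃ₗ[ℂ] CKP.T, CKP.IsBosonization σ →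
      (fun m : ℤ => σ.conj (CKP.phi m)) =
        CKP.fieldMul CKP.expT (CKP.fieldMul CKP.expD CKP.oddField)) := by
  refine ⟨CKP.currentTerm_locFin, CKP.composable_VplusInv _,
    CKP.composable_VminusInv (CKP.lowerTrunc_mul_VplusInv CKP.phi_lowerTrunc),
    CKP.composable_Vplus _,
    CKP.composable_Vminus (CKP.lowerTrunc_mul_Vplus CKP.lowerTrunc_theta),
    CKP.phi_eq_dress_theta, fun n hn m => sub_eq_zero.mpr (CKP.current_commute_theta hn m).eq,
    ⟨?_, ?_⟩, CKP.superComm_eq, ?_, CKP.composable_expD_oddField, CKP.composable_expT,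
    fun σ hσ => hσ.conjField_phi⟩
  · funext p q
    rw [CKP.anticomm_reflect_theta]
    exact (CKP.two_ymul_dy_delta_add_delta p q).symm
  · funext p q
    rw [CKP.anticomm_reflect_theta]
    exact (CKP.eulerY_delta p q).symm
  · obtain ⟨σ, hσ⟩ := CKP.exists_isBosonization
    exact ⟨σ, hσ, fun τ hτ => hτ.unique hσ⟩
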